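/- Let $T\in\{-1,0,1\}^{k\times n}$ be totally unimodular, $b\in\mathbb{Z}^k$, $c,\gamma\in\mathbb{Z}^n$, $m\in\mathbb{Z}_{>0}$ and $R\subseteq\{0,\dots,m-1\}$, and consider the $R$-CCTU problem $$\min\{c^\top x \;:\; Tx\le b,\ \gamma^\top x\in R \ (\mathrm{mod}\ m),\ x\in\mathbb{Z}^n\},$$ where $\gamma^\top x\in R\ (\mathrm{mod}\ m)$ means that $\gamma^\top x\equiv r\ (\mathrm{mod}\ m)$ for some $r\in R$. Its relaxation is $\min\{c^\top x : Tx\le b,\ x\in\mathbb{Z}^n\}$. A vector $d\in\mathbb{Z}^n$ is TU-appendable to $T$ if $\begin{pmatrix}T\\ d^\top\end{pmatrix}$ is totally unimodular. Assume that the $R$-CCTU problem is feasible. (i) For every feasible solution $x_0$ of the relaxation there is a feasible solution $x$ of the $R$-CCTU problem such that $\|x-x_0\|_\infty\le m-|R|$ and, more generally, $d^\top(x-x_0)\le m-|R|$ for every $d$ that is TU-appendable to $T$. (ii) For every optimal solution $x_0$ of the relaxation there is an optimal solution $x$ of the $R$-CCTU problem such that $\|x-x_0\|_\infty\le m-|R|$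 and, more generally, $d^\top(x-x_0)\le m-|R|$ for every $d$ that is TU-appendable to $T$. Moreover, in (i) and (ii), given $x_0$ and any feasible (respectively optimal) solution $y$ of the $R$-CCTU problem, a solution $x$ with the stated properties can be found in strongly polynomial time in the following sense. There is one program for a random access machine over the integers (elementary operations: $+$, $-$, $\cdot$, integer quotient and remainder, comparison, reading and writing memory, branching) that, given $T,b,c,m,\gamma,x_0,y$ and a list of the elements of $R$, computes such an $x$ with a number of elementary operations that is polynomial in the number of integers in the input and in the binary encoding length of $m$, independently of the size of the numbers in $b,c,\gamma,x_0,y$, while all integers that occur during the computation have encoding length polynomial in that of the input. In particular, for every fixed modulus $m$ the number of operations is polynomial in the number of integers in the input alone. -/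

import Mathlib

/-! ### Congruency-constrained totally unimodular problems -/

/-- An instance of the problem
`min {cᵀx | T x ≤ b, γᵀx ∈ R (mod m), x ∈ ℤⁿ}` with `T` totally unimodular with `k` rows. -/
structure RCCTU (k n : ℕ) where
  T : Matrix (Fin k) (Fin n) ℤ
  b : Fin k → ℤ
  c : Fin n → ℤ
  m : ℕ
  γ : Fin n → ℤ
  R : Finset ℕ
  isTotallyUnimodular : T.IsTotallyUnimodular
  m_pos : 0 < m
  R_subset : R ⊆ Finset.range m

/-- `d` is TU-appendable to `T`: the matrix `T` with the additional row `dᵀ` is totally unimodular. -/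
def TUAppendable {k n : ℕ} (T : Matrix (Fin k) (Fin n) ℤ) (d : Fin n → ℤ) : Prop :=
  (Matrix.fromRows T (Matrix.replicateRow Unit d)).IsTotallyUnimodular

namespace RCCTU

variable {k n : ℕ}

/-- Feasible for the relaxation: the congruency constraint is dropped, integrality is kept. -/
def RelaxFeasible (P : RCCTU k n) (x : Fin n → ℤ) : Prop :=
  ∀ i, P.T.mulVec x i ≤ P.b i

def Feasible (P : RCCTU k n) (x : Fin n → ℤ) : Prop :=
  P.RelaxFeasible x ∧ ∃ r ∈ P.R, dotProduct P.γ x ≡ (r : ℤ) [ZMOD (P.m : ℤ)]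

def RelaxOptimal (P : RCCTU k n) (x : Fin n → ℤ) : Prop :=
  P.RelaxFeasible x ∧ ∀ z, P.RelaxFeasible z → dotProduct P.c x ≤ dotProduct P.c z

def Optimal (P : RCCTU k n) (x : Fin n → ℤ) : Prop :=
  P.Feasible x ∧ ∀ z, P.Feasible z → dotProduct P.c x ≤ dotProduct P.c z

/-- The two proximity bounds: in the maximum norm (the norm of `Fin n → ℤ`), and in the direction
of every TU-appendable vector. -/
def Near (P : RCCTU k n) (x₀ x : Fin n → ℤ) : Prop :=
  ‖x - x₀‖ ≤ (P.m : ℝ) - (P.R.card : ℝ) ∧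
    ∀ d : Fin n → ℤ, TUAppendable P.T d →
      dotProduct d (x - x₀) ≤ (P.m : ℤ) - (P.R.card : ℤ)

end RCCTU

/-! ### A random access machine over the integers, programmed by while-programs

The memory holds integer variables `0, 1, 2, …` and integer arrays `0, 1, 2, …`; an array cell is
addressed by a computed integer.  Each arithmetic operation, comparison, memory access and control
step costs one unit of time. -/

/-- The elementary arithmetic operations; `div` and `mod` are integer quotient and remainder. -/
inductive ArithOp
  | add | sub | mul | div | mod

def ArithOp.eval : ArithOp → ℤ → ℤ → ℤ
  | .add, x, y => x + y
  | .sub, x, y => x - y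
  | .mul, x, y => x * y
  | .div, x, y => x / y
  | .mod, x, y => x % y

structure Store where
  var : ℕ → ℤ
  arr : ℕ → ℤ → ℤ

def Store.setVar (s : Store) (i : ℕ) (z : ℤ) : Store :=
  { s with var := Function.update s.var i z }

def Store.setArr (s : Store) (a : ℕ) (p z : ℤ) : Store :=
  { s with arr := Function.update s.arr a (Function.update (s.arr a) p z) }

/-- Binary encoding length of an integer, with one bit for the sign. -/
def bitLen (z : ℤ) : ℕ := Nat.size z.natAbs + 1

inductive Expr
  | lit (z : ℤ)
  | var (i : ℕ)
  | arr (a : ℕ) (e : Expr)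
  | op (o : ArithOp) (e f : Expr)

namespace Expr

def eval (s : Store) : Expr → ℤ
  | lit z => z
  | var i => s.var i
  | arr a e => s.arr a (e.eval s)
  | op o e f => o.eval (e.eval s) (f.eval s)

def cost : Expr → ℕ
  | lit _ => 1
  | var _ => 1
  | arr _ e => e.cost + 1
  | op _ e f => e.cost + f.cost + 1

/-- All integers that occur in the evaluation of the expression have at most `B` bits. -/
def Fits (B : ℕ) (s : Store) : Expr → Prop
  | lit z => bitLen z ≤ B
  | var i => bitLen (s.var i) ≤ B
  | arr a e => e.Fits B s ∧ bitLen (s.arr a (e.eval s)) ≤ B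
  | op o e f => e.Fits B s ∧ f.Fits B s ∧ bitLen (o.eval (e.eval s) (f.eval s)) ≤ B

end Expr

inductive Test
  | le (e f : Expr)
  | eq (e f : Expr)
  | not (g : Test)
  | and (g h : Test)

namespace Test

def Holds (s : Store) : Test → Prop
  | le e f => e.eval s ≤ f.eval s
  | eq e f => e.eval s = f.eval s
  | not g => ¬ g.Holds s
  | and g h => g.Holds s ∧ h.Holds s

def cost : Test → ℕ
  | le e f => e.cost + f.cost + 1
  | eq e f => e.cost + f.cost + 1
  | not g => g.cost + 1
  | and g h => g.cost + h.cost + 1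

def Fits (B : ℕ) (s : Store) : Test → Prop
  | le e f => e.Fits B s ∧ f.Fits B s
  | eq e f => e.Fits B s ∧ f.Fits B s
  | not g => g.Fits B s
  | and g h => g.Fits B s ∧ h.Fits B s

end Test

inductive Cmd
  | skip
  | assign (i : ℕ) (e : Expr)
  | write (a : ℕ) (p e : Expr)
  | seq (c d : Cmd)
  | ite (g : Test) (c d : Cmd)
  | loop (g : Test) (c : Cmd)

/-- `Exec B c s t s'`: started in the store `s`, the program `c` halts in the store `s'` after `t`
units of time, and all integers that occur in this run have at most `B` bits. -/
inductive Exec (B : ℕ) : Cmd → Store → ℕ → Store → Prop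
  | skip (s : Store) : Exec B .skip s 1 s
  | assign (i : ℕ) (e : Expr) (s : Store) (he : e.Fits B s) :
      Exec B (.assign i e) s (e.cost + 1) (s.setVar i (e.eval s))
  | write (a : ℕ) (p e : Expr) (s : Store) (hp : p.Fits B s) (he : e.Fits B s) :
      Exec B (.write a p e) s (p.cost + e.cost + 1) (s.setArr a (p.eval s) (e.eval s))
  | seq {c d : Cmd} {s s' s'' : Store} {t t' : ℕ}
      (hc : Exec B c s t s') (hd : Exec B d s' t' s'') :
      Exec B (.seq c d) s (t + t') s''
  | ite_true {g : Test} {c d : Cmd} {s s' : Store} {t : ℕ}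
      (hg : g.Fits B s) (h : g.Holds s) (hc : Exec B c s t s') :
      Exec B (.ite g c d) s (g.cost + t) s'
  | ite_false {g : Test} {c d : Cmd} {s s' : Store} {t : ℕ}
      (hg : g.Fits B s) (h : ¬ g.Holds s) (hd : Exec B d s t s') :
      Exec B (.ite g c d) s (g.cost + t) s'
  | loop_false {g : Test} {c : Cmd} {s : Store}
      (hg : g.Fits B s) (h : ¬ g.Holds s) :
      Exec B (.loop g c) s g.cost s
  | loop_true {g : Test} {c : Cmd} {s s' s'' : Store} {t t' : ℕ}
      (hg : g.Fits B s) (h : g.Holds s)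
      (hc : Exec B c s t s') (hl : Exec B (.loop g c) s' t' s'') :
      Exec B (.loop g c) s (g.cost + t + t') s''

/-! ### Strongly polynomial algorithms -/

namespace RCCTU

variable {k n : ℕ}

/-- The store `s` holds the instance `P` and the vectors `x₀`, `y` as input: `T` row by row, and
the elements of `R` as a list in some order.  The rest of the store is arbitrary. -/
structure IsInput (P : RCCTU k n) (x₀ y : Fin n → ℤ) (s : Store) : Prop where
  rows : s.var 0 = k
  cols : s.var 1 = n
  modulus : s.var 2 = P.m
  card : s.var 3 = P.R.card
  T : ∀ (i : Fin k) (j : Fin n), s.arr 0 ((i : ℤ) * (n : ℤ) + (j : ℤ)) = P.T i j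
  b : ∀ i : Fin k, s.arr 1 (i : ℤ) = P.b i
  c : ∀ j : Fin n, s.arr 2 (j : ℤ) = P.c j
  γ : ∀ j : Fin n, s.arr 3 (j : ℤ) = P.γ j
  R : (Finset.range P.R.card).image (fun l : ℕ => s.arr 4 (l : ℤ)) =
    P.R.image (fun r : ℕ => (r : ℤ))
  x₀ : ∀ j : Fin n, s.arr 5 (j : ℤ) = x₀ j
  y : ∀ j : Fin n, s.arr 6 (j : ℤ) = y j

/-- The vector that a program returns. -/
def output (n : ℕ) (s : Store) : Fin n → ℤ := fun j => s.arr 7 (j : ℤ)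

/-- The number of integers in the input. -/
def numInputs (P : RCCTU k n) : ℕ := k * n + k + 4 * n + P.R.card + 4

/-- The total binary encoding length of the input. -/
def inputBits (P : RCCTU k n) (x₀ y : Fin n → ℤ) : ℕ :=
  bitLen k + bitLen n + bitLen P.m + bitLen P.R.card
    + (∑ i, ∑ j, bitLen (P.T i j)) + (∑ i, bitLen (P.b i))
    + (∑ j, bitLen (P.c j)) + (∑ j, bitLen (P.γ j)) + (∑ r ∈ P.R, bitLen r)
    + (∑ j, bitLen (x₀ j)) + (∑ j, bitLen (y j))

/-- One program computes, from every input `(P, x₀, y)` that satisfies `Pre`, a vector `x` that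
satisfies `Post`, in strongly polynomial time: the number of elementary steps is bounded by a
polynomial in the number of input integers and the encoding length of the modulus alone
(independently of the size of `b`, `c`, `γ`, `x₀`, `y`), and all integers that occur have encoding
length polynomial in that of the input.  The encoding length of the modulus cannot be left out:
with boundedly many operations `+, -, *, /, mod, <` one cannot compute inverses modulo `m`. -/
def StronglyPolynomial
    (Pre : ∀ {k n : ℕ}, RCCTU k n → (Fin n → ℤ) → (Fin n → ℤ) → Prop)
    (Post : ∀ {k n : ℕ}, RCCTU k n → (Fin n → ℤ) → (Fin n → ℤ) → Prop) : Prop :=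
  ∃ (prog : Cmd) (p q : Polynomial ℕ),
    ∀ (k n : ℕ) (P : RCCTU k n) (x₀ y : Fin n → ℤ), Pre P x₀ y →
      ∀ s : Store, P.IsInput x₀ y s →
        ∃ (t : ℕ) (s' : Store),
          Exec (q.eval (P.inputBits x₀ y)) prog s t s' ∧
          t ≤ p.eval (P.numInputs + bitLen P.m) ∧
          Post P x₀ (output n s')

end RCCTU

/-! Fix a relaxed solution `x₀` and a feasible `y`. The difference `y - x₀` is a nonnegative
integral combination `∑ λ_p u_p` of elementary vectors: each `u_p` changes every TU-appendable
direction by at most one, and no row of `T` sees `u_p` with the sign opposite to that of `y - x₀`.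
Such vectors are columns of inverses of unimodular submatrices of `[T; I]`, and the bound by one is
Cramer's rule (`IsTableau.isElementary`). By sign compatibility every `x₀ + ∑ μ_p u_p` with `0 ≤ μ ≤
λ` satisfies `Tx ≤ b`. If `x₀` is optimal for the relaxation, then `cᵀu_p ≥ 0` whenever `λ_p > 0`,
because `x₀ + u_p` is feasible for the relaxation; hence such a point costs at most as much as `y`.

Only the residues `γᵀu_p` now matter. Choose `μ ≤ λ` such that `x₀ + ∑ μ_p u_p` satisfies the
congruence and no proper part of `μ` does. Build `μ` up from `0` by unit steps. The residues met
before the last one lie outside `R`, since a part of `μ` would otherwise be a solution, and they are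
pairwise distinct, since the steps between two equal residues could be left out. So `∑ μ_p + |R| ≤
m` (`sum_add_card_le_of_minimal`), and as every `u_p` moves a TU-appendable direction by at most
one, this is the proximity bound. An optimal solution near `x₀` exists because only finitely many
integer points are near `x₀`, and every feasible point is matched in cost by a near one.

The algorithmic claim makes both choices constructive. For the decomposition, a walk subtracts
multiples of tableau columns that vanish where the current vector does. Each step kills an entry,
and after polynomially many steps a column conformal to the remaining vector appears and is split
off (`IsWalk.advance`, `IsWalk.record`).

The minimal `μ` is harder, because `m` may be exponential in the allowed running time, so that the
reachable residues cannot be listed. Multiplicities are first reduced modulo the order of their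
residue, which makes them independent of the size of `y`. If their sum is already at most `m - |R|`,
nothing is left to do. Otherwise the largest one, `κ_a`, is at least about `(m - |R|) / N`, where
`N` is the number of vectors. The reachable residues are then a union of long intervals, of length
`κ_a + 1` in direction `γᵀu_a`. After `ℤ/m` is cut into `O(N + |R|)` buckets that are shorter than
such an interval, it suffices to keep the two extreme starting points in each bucket
(`cover_between`, `IsTable.insert`). Such a table decides whether a solution below given
multiplicities exists (`oracle_run`), bisection lowers all multiplicities except `κ_a`, and `κ_a` is
then read off from a coordinate.

Running time and number size are handled by a small program logic: `Run` bounds the time by a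
syntactic function of a common bound `X` on the loop lengths, and the bit lengths by a fixed
multiple of that of a bound `H` on the numbers stored. Existence in (i) and (ii) is deduced from the
correctness of the program. -/

/-! ### Bounded evaluation of expressions -/

/-- `z` has absolute value at most `H`. -/
def Within (H : ℕ) (z : ℤ) : Prop := -(H : ℤ) ≤ z ∧ z ≤ H

/-- The variables in use hold small integers. -/
structure Store.VarsOk (H : ℕ) (s : Store) : Prop where
  two_le : 2 ≤ H
  small : ∀ i, i < 64 → Within H (s.var i)

namespace Store

@[simp] theorem var_setVar (s : Store) (i j : ℕ) (z : ℤ) :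
    (s.setVar i z).var j = if j = i then z else s.var j := by
  simp [setVar, Function.update_apply]

@[simp] theorem arr_setVar (s : Store) (i : ℕ) (z : ℤ) : (s.setVar i z).arr = s.arr := rfl

@[simp] theorem var_setArr (s : Store) (a : ℕ) (p z : ℤ) : (s.setArr a p z).var = s.var := rfl

@[simp] theorem arr_setArr (s : Store) (a a' : ℕ) (p z : ℤ) :
    (s.setArr a p z).arr a' =
      if a' = a then fun p' => if p' = p then z else s.arr a p' else s.arr a' := by
  by_cases h : a' = a
  · subst h; funext p'; simp [setArr, Function.update_apply]
  · simp [setArr, h]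

end Store

namespace Expr

instance : Add Expr := ⟨op .add⟩
instance : Sub Expr := ⟨op .sub⟩
instance : Mul Expr := ⟨op .mul⟩
instance : Div Expr := ⟨op .div⟩
instance : Mod Expr := ⟨op .mod⟩
instance (k : ℕ) : OfNat Expr k := ⟨lit k⟩

@[simp] theorem eval_lit (s : Store) (z : ℤ) : (lit z).eval s = z := rfl
@[simp] theorem eval_var (s : Store) (i : ℕ) : (var i).eval s = s.var i := rfl
@[simp] theorem eval_arr (s : Store) (a : ℕ) (e : Expr) :
    (arr a e).eval s = s.arr a (e.eval s) := rfl
@[simp] theorem eval_add (s : Store) (e f : Expr) : (e + f).eval s = e.eval s + f.eval s := rfl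
@[simp] theorem eval_sub (s : Store) (e f : Expr) : (e - f).eval s = e.eval s - f.eval s := rfl
@[simp] theorem eval_mul (s : Store) (e f : Expr) : (e * f).eval s = e.eval s * f.eval s := rfl
@[simp] theorem eval_div (s : Store) (e f : Expr) : (e / f).eval s = e.eval s / f.eval s := rfl
@[simp] theorem eval_mod (s : Store) (e f : Expr) : (e % f).eval s = e.eval s % f.eval s := rfl
@[simp] theorem eval_zero (s : Store) : (0 : Expr).eval s = 0 := rfl
@[simp] theorem eval_one (s : Store) : (1 : Expr).eval s = 1 := rfl
@[simp] theorem eval_two (s : Store) : (2 : Expr).eval s = 2 := rfl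

/-- Literals are tiny, the variables in use are among the first ones, and all array cells that the
evaluation reads hold small integers. -/
def Ok (H : ℕ) (s : Store) : Expr → Prop
  | lit z => -2 ≤ z ∧ z ≤ 2
  | var i => i < 64
  | arr a e => e.Ok H s ∧ Within H (s.arr a (e.eval s))
  | op _ e f => e.Ok H s ∧ f.Ok H s

section
variable {H : ℕ} {s : Store} {e f : Expr}

@[simp] theorem ok_lit {z : ℤ} : (lit z).Ok H s ↔ -2 ≤ z ∧ z ≤ 2 := Iff.rfl
@[simp] theorem ok_var {i : ℕ} : (var i).Ok H s ↔ i < 64 := Iff.rfl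
@[simp] theorem ok_arr {a : ℕ} : (arr a e).Ok H s ↔ e.Ok H s ∧ Within H (s.arr a (e.eval s)) :=
  Iff.rfl
@[simp] theorem ok_add : (e + f).Ok H s ↔ e.Ok H s ∧ f.Ok H s := Iff.rfl
@[simp] theorem ok_sub : (e - f).Ok H s ↔ e.Ok H s ∧ f.Ok H s := Iff.rfl
@[simp] theorem ok_mul : (e * f).Ok H s ↔ e.Ok H s ∧ f.Ok H s := Iff.rfl
@[simp] theorem ok_div : (e / f).Ok H s ↔ e.Ok H s ∧ f.Ok H s := Iff.rfl
@[simp] theorem ok_mod : (e % f).Ok H s ↔ e.Ok H s ∧ f.Ok H s := Iff.rfl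
@[simp] theorem ok_zero : (0 : Expr).Ok H s := by change (-2 : ℤ) ≤ 0 ∧ (0 : ℤ) ≤ 2; norm_num
@[simp] theorem ok_one : (1 : Expr).Ok H s := by change (-2 : ℤ) ≤ 1 ∧ (1 : ℤ) ≤ 2; norm_num
@[simp] theorem ok_two : (2 : Expr).Ok H s := by change (-2 : ℤ) ≤ 2 ∧ (2 : ℤ) ≤ 2; norm_num

end

/-- The exponents add up in the same way as the cost of expressions; the additional factor `H ≥ 2`
absorbs the factor two of a sum or difference. -/
theorem natAbs_arith_le (o : ArithOp) (x y : ℤ) {H a b : ℕ} (hH : 2 ≤ H)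
    (hx : x.natAbs ≤ H ^ a) (hy : y.natAbs ≤ H ^ b) : (o.eval x y).natAbs ≤ H ^ (a + b + 1) := by
  have ha : 1 ≤ H ^ a := Nat.one_le_pow _ _ (by omega)
  have hb : 1 ≤ H ^ b := Nat.one_le_pow _ _ (by omega)
  have h1 : 2 * (H ^ a * H ^ b) ≤ H ^ (a + b + 1) := by
    rw [pow_succ, pow_add, mul_comm]
    exact Nat.mul_le_mul_left _ hH
  have h2 : H ^ a + H ^ b ≤ 2 * (H ^ a * H ^ b) := by nlinarith
  cases o with
  | add =>
    have : (x + y).natAbs ≤ x.natAbs + y.natAbs := Int.natAbs_add_le x y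
    simp only [ArithOp.eval]; omega
  | sub =>
    have : (x - y).natAbs ≤ x.natAbs + y.natAbs := Int.natAbs_sub_le x y
    simp only [ArithOp.eval]; omega
  | mul =>
    simp only [ArithOp.eval, Int.natAbs_mul]
    have := Nat.mul_le_mul hx hy
    omega
  | div =>
    simp only [ArithOp.eval]
    have : (x / y).natAbs ≤ x.natAbs := Int.natAbs_ediv_le_natAbs x y
    omega
  | mod =>
    simp only [ArithOp.eval]
    have : (x % y).natAbs ≤ x.natAbs + y.natAbs := by
      rcases eq_or_ne y 0 with rfl | hy0
      · simp
      · have h3 := Int.emod_nonneg x hy0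
        have h4 := Int.emod_lt_abs x hy0
        rw [Int.abs_eq_natAbs] at h4
        omega
    omega

theorem natAbs_eval_le {H : ℕ} {s : Store} (hs : s.VarsOk H) (e : Expr) (he : e.Ok H s) :
    (e.eval s).natAbs ≤ H ^ e.cost := by
  have h2 := hs.two_le
  have key : ∀ z, Within H z → ∀ c, 1 ≤ c → z.natAbs ≤ H ^ c := by
    intro z hz c hc
    have h3 : z.natAbs ≤ H := by unfold Within at hz; omega
    exact h3.trans (Nat.le_self_pow (by omega) H)
  induction e with
  | lit z =>
    refine key z ?_ _ le_rfl
    have : -2 ≤ z ∧ z ≤ 2 := he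
    unfold Within; omega
  | var i => exact key _ (hs.small i he) _ le_rfl
  | arr a e ih => exact key _ he.2 _ (by simp [cost])
  | op o e f ihe ihf => exact natAbs_arith_le o _ _ h2 (ihe he.1) (ihf he.2)

/-- A program contains only expressions of cost at most 64, so one fixed power of `H` bounds all
intermediate results. Large intermediate results therefore do no harm as long as what goes back into
a variable is again at most `H`. -/
theorem bitLen_eval_le {H : ℕ} {s : Store} (hs : s.VarsOk H) (e : Expr) (he : e.Ok H s)
    (hc : e.cost ≤ 64) : bitLen (e.eval s) ≤ 64 * H.size + 2 := by
  have h1 := natAbs_eval_le hs e he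
  have h2 : H ^ e.cost ≤ H ^ 64 := Nat.pow_le_pow_right (by have := hs.two_le; omega) hc
  have h3 : H ^ 64 < 2 ^ (64 * H.size) := by
    rw [mul_comm, pow_mul]
    exact Nat.pow_lt_pow_left (Nat.lt_size_self H) (by norm_num)
  have h4 : (e.eval s).natAbs.size ≤ 64 * H.size := Nat.size_le.2 (by omega)
  unfold bitLen
  omega

theorem fits_of_ok {H : ℕ} {s : Store} (hs : s.VarsOk H) (e : Expr) (he : e.Ok H s)
    (hc : e.cost ≤ 64) : e.Fits (64 * H.size + 2) s := by
  have h0 := bitLen_eval_le hs e he hc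
  induction e with
  | lit z => exact h0
  | var i => exact h0
  | arr a e ih =>
    have : e.cost ≤ 64 := by simp only [cost] at hc; omega
    exact ⟨ih he.1 this (bitLen_eval_le hs e he.1 this), h0⟩
  | op o e f ihe ihf =>
    have h1 : e.cost ≤ 64 := by simp only [cost] at hc; omega
    have h2 : f.cost ≤ 64 := by simp only [cost] at hc; omega
    exact ⟨ihe he.1 h1 (bitLen_eval_le hs e he.1 h1), ihf he.2 h2 (bitLen_eval_le hs f he.2 h2), h0⟩

end Expr

namespace Test

def lt (e f : Expr) : Test := .not (.le f e)

def Ok (H : ℕ) (s : Store) : Test → Prop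
  | le e f => e.Ok H s ∧ f.Ok H s
  | eq e f => e.Ok H s ∧ f.Ok H s
  | not g => g.Ok H s
  | and g h => g.Ok H s ∧ h.Ok H s

section
variable {H : ℕ} {s : Store} {e f : Expr} {g h : Test}

@[simp] theorem ok_le : (le e f).Ok H s ↔ e.Ok H s ∧ f.Ok H s := Iff.rfl
@[simp] theorem ok_lt : (lt e f).Ok H s ↔ f.Ok H s ∧ e.Ok H s := Iff.rfl
@[simp] theorem ok_eq : (eq e f).Ok H s ↔ e.Ok H s ∧ f.Ok H s := Iff.rfl
@[simp] theorem ok_not : (not g).Ok H s ↔ g.Ok H s := Iff.rfl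
@[simp] theorem ok_and : (and g h).Ok H s ↔ g.Ok H s ∧ h.Ok H s := Iff.rfl
@[simp] theorem holds_le : (le e f).Holds s ↔ e.eval s ≤ f.eval s := Iff.rfl
@[simp] theorem holds_lt : (lt e f).Holds s ↔ e.eval s < f.eval s := not_le
@[simp] theorem holds_eq : (eq e f).Holds s ↔ e.eval s = f.eval s := Iff.rfl
@[simp] theorem holds_not : (not g).Holds s ↔ ¬ g.Holds s := Iff.rfl
@[simp] theorem holds_and : (and g h).Holds s ↔ g.Holds s ∧ h.Holds s := Iff.rfl

end

theorem fits_of_ok {H : ℕ} {s : Store} (hs : s.VarsOk H) (g : Test) (hg : g.Ok H s)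
    (hc : g.cost ≤ 64) : g.Fits (64 * H.size + 2) s := by
  induction g with
  | le e f =>
    simp only [cost] at hc
    exact ⟨e.fits_of_ok hs hg.1 (by omega), f.fits_of_ok hs hg.2 (by omega)⟩
  | eq e f =>
    simp only [cost] at hc
    exact ⟨e.fits_of_ok hs hg.1 (by omega), f.fits_of_ok hs hg.2 (by omega)⟩
  | not g ih =>
    simp only [cost] at hc
    exact ih hg (by omega)
  | and g h ihg ihh =>
    simp only [cost] at hc
    exact ⟨ihg hg.1 (by omega), ihh hg.2 (by omega)⟩

end Test

/-! ### Program logic -/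

namespace Cmd

/-- The program never assigns to the variable `j`. -/
def keepsVar (j : ℕ) : Cmd → Bool
  | skip => true
  | assign i _ => j != i
  | write _ _ _ => true
  | seq c d => c.keepsVar j && d.keepsVar j
  | ite _ c d => c.keepsVar j && d.keepsVar j
  | loop _ c => c.keepsVar j

/-- The program never writes to the array `a`. -/
def keepsArr (a : ℕ) : Cmd → Bool
  | skip => true
  | assign _ _ => true
  | write a' _ _ => a != a'
  | seq c d => c.keepsArr a && d.keepsArr a
  | ite _ c d => c.keepsArr a && d.keepsArr a
  | loop _ c => c.keepsArr a

/-- The running time when every loop is run through at most `X` times. -/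
def time (X : ℕ) : Cmd → ℕ
  | skip => 1
  | assign _ e => e.cost + 1
  | write _ p e => p.cost + e.cost + 1
  | seq c d => c.time X + d.time X
  | ite g c d => g.cost + (c.time X + d.time X)
  | loop g c => X * (g.cost + c.time X) + g.cost

/-- `for i := 0` to `var b - 1`. -/
def forLoop (i b : ℕ) (c : Cmd) : Cmd :=
  seq (assign i 0) (loop (.lt (.var i) (.var b)) (seq c (assign i (.var i + 1))))

end Cmd

infixr:50 " ;; " => Cmd.seq

/-- The stores `s` and `s'` agree wherever `c` does not write. -/
structure Frame (c : Cmd) (s s' : Store) : Prop where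
  var : ∀ i, c.keepsVar i = true → s'.var i = s.var i
  arr : ∀ a, c.keepsArr a = true → s'.arr a = s.arr a

theorem Frame.rfl' {c : Cmd} {s : Store} : Frame c s s := ⟨fun _ _ => rfl, fun _ _ => rfl⟩

theorem Frame.trans {c : Cmd} {s s' s'' : Store} (h : Frame c s s') (h' : Frame c s' s'') :
    Frame c s s'' :=
  ⟨fun i hi => (h'.var i hi).trans (h.var i hi), fun a ha => (h'.arr a ha).trans (h.arr a ha)⟩

theorem Frame.mono {c d : Cmd} {s s' : Store} (h : Frame c s s')
    (hv : ∀ i, d.keepsVar i = true → c.keepsVar i = true)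
    (ha : ∀ a, d.keepsArr a = true → c.keepsArr a = true) : Frame d s s' :=
  ⟨fun i hi => h.var i (hv i hi), fun a h' => h.arr a (ha a h')⟩

/-- `keepsVar` and `keepsArr` compute, so that what a concrete subprogram leaves alone is found by
`rfl` and invariants need to mention only what changes. -/
theorem Exec.frame {B : ℕ} {c : Cmd} {s s' : Store} {t : ℕ} (h : Exec B c s t s') :
    Frame c s s' := by
  induction h with
  | skip s => exact .rfl'
  | assign i e s he =>
    refine ⟨fun j hj => ?_, fun a _ => rfl⟩
    have : j ≠ i := by
      rintro rfl
      simp [Cmd.keepsVar] at hj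
    simp [this]
  | write a p e s hp he =>
    refine ⟨fun j hj => rfl, fun a' h => ?_⟩
    have : a' ≠ a := by
      rintro rfl
      simp [Cmd.keepsArr] at h
    simp [this]
  | seq hc hd ihc ihd =>
    refine (ihc.mono ?_ ?_).trans (ihd.mono ?_ ?_) <;> simp +contextual [Cmd.keepsVar, Cmd.keepsArr]
  | ite_true hg h hc ih =>
    refine ih.mono ?_ ?_ <;> simp +contextual [Cmd.keepsVar, Cmd.keepsArr]
  | ite_false hg h hc ih =>
    refine ih.mono ?_ ?_ <;> simp +contextual [Cmd.keepsVar, Cmd.keepsArr]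
  | loop_false hg h => exact .rfl'
  | loop_true hg h hc hl ihc ihl => exact Frame.trans ⟨ihc.var, ihc.arr⟩ ihl

/-- Started in `s`, in which the variables are small, the program halts in a store that satisfies
`Q`; the run is short if no loop is run through more than `X` times, which has to be the case, and
all integers in it are at most a fixed power of `H`. -/
def Run (H X : ℕ) (c : Cmd) (s : Store) (Q : Store → Prop) : Prop :=
  s.VarsOk H → ∃ t s', Exec (64 * H.size + 2) c s t s' ∧ t ≤ c.time X ∧ s'.VarsOk H ∧ Q s'

namespace Run

variable {H X : ℕ} {c d : Cmd} {s : Store} {P Q : Store → Prop}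

theorem mono (h : Run H X c s P) (hPQ : ∀ s', Frame c s s' → P s' → Q s') : Run H X c s Q := by
  intro hs
  obtain ⟨t, s', h1, h2, h3, h4⟩ := h hs
  exact ⟨t, s', h1, h2, h3, hPQ s' h1.frame h4⟩

/-- Smallness of the variables is a premise inside `Run`, so it may be used for free. In this way
bounds such as `m ≤ H` are read off from the store. -/
theorem of_small (h : 2 ≤ H → (∀ i, i < 64 → Within H (s.var i)) → Run H X c s Q) :
    Run H X c s Q :=
  fun hs => h hs.two_le hs.small hs

theorem skip (h : Q s) : Run H X .skip s Q :=
  fun hs => ⟨_, _, .skip s, le_rfl, hs, h⟩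

theorem assign {i : ℕ} {e : Expr} (hc : e.cost ≤ 64) (he : e.Ok H s)
    (hv : Within H (e.eval s)) (hQ : Q (s.setVar i (e.eval s))) : Run H X (.assign i e) s Q := by
  intro hs
  refine ⟨_, _, .assign i e s (e.fits_of_ok hs he hc), le_rfl, ⟨hs.two_le, fun j hj => ?_⟩, hQ⟩
  rw [Store.var_setVar]
  split
  · exact hv
  · exact hs.small j hj

theorem write {a : ℕ} {p e : Expr} (hcp : p.cost ≤ 64) (hce : e.cost ≤ 64) (hp : p.Ok H s)
    (he : e.Ok H s) (hQ : Q (s.setArr a (p.eval s) (e.eval s))) : Run H X (.write a p e) s Q := by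
  intro hs
  exact ⟨_, _, .write a p e s (p.fits_of_ok hs hp hcp) (e.fits_of_ok hs he hce), le_rfl,
    ⟨hs.two_le, hs.small⟩, hQ⟩

theorem seq (hc : Run H X c s (fun s' => Run H X d s' Q)) : Run H X (c ;; d) s Q := by
  intro hs
  obtain ⟨t, s', h1, h2, h3, h4⟩ := hc hs
  obtain ⟨t', s'', h1', h2', h3', h4'⟩ := h4 h3
  exact ⟨_, _, .seq h1 h1', Nat.add_le_add h2 h2', h3', h4'⟩

theorem seq_of (hc : Run H X c s P) (hd : ∀ s', Frame c s s' → P s' → Run H X d s' Q) :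
    Run H X (c ;; d) s Q :=
  seq (hc.mono hd)

theorem ite {g : Test} (hc : g.cost ≤ 64) (hg : g.Ok H s) (h1 : g.Holds s → Run H X c s Q)
    (h2 : ¬ g.Holds s → Run H X d s Q) : Run H X (.ite g c d) s Q := by
  intro hs
  by_cases h : g.Holds s
  · obtain ⟨t, s', h1, h2, h3, h4⟩ := h1 h hs
    refine ⟨_, _, .ite_true (g.fits_of_ok hs hg hc) h h1, ?_, h3, h4⟩
    simp only [Cmd.time]; omega
  · obtain ⟨t, s', h1, h2, h3, h4⟩ := h2 h hs
    refine ⟨_, _, .ite_false (g.fits_of_ok hs hg hc) h h1, ?_, h3, h4⟩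
    simp only [Cmd.time]; omega

/-- Induction on a bound `r` for the number of remaining rounds. When `r = 0` the round number has
reached `K`, and `hlt` forces the test to fail. -/
theorem loop_aux {g : Test} (hc : g.cost ≤ 64) (K : ℕ) (I : ℕ → Store → Prop)
    (hg : ∀ j s, s.VarsOk H → I j s → g.Ok H s)
    (hlt : ∀ j s, s.VarsOk H → I j s → g.Holds s → j < K)
    (step : ∀ j s, s.VarsOk H → I j s → g.Holds s → Run H X c s (I (j + 1)))
    (hQ : ∀ j s, s.VarsOk H → I j s → ¬ g.Holds s → Q s) :
    ∀ r j s, s.VarsOk H → I j s → K - j ≤ r → ∃ t s', Exec (64 * H.size + 2) (.loop g c) s t s' ∧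
      t ≤ r * (g.cost + c.time X) + g.cost ∧ s'.VarsOk H ∧ Q s' := by
  intro r
  induction r with
  | zero =>
    intro j s hs hI hr
    have h : ¬ g.Holds s := fun h => by have := hlt j s hs hI h; omega
    exact ⟨_, _, .loop_false (g.fits_of_ok hs (hg j s hs hI) hc) h, by simp, hs, hQ j s hs hI h⟩
  | succ r ih =>
    intro j s hs hI hr
    by_cases h : g.Holds s
    · obtain ⟨t, s', h1, h2, h3, h4⟩ := step j s hs hI h hs
      obtain ⟨t', s'', h1', h2', h3', h4'⟩ := ih (j + 1) s' h3 h4 (by omega)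
      refine ⟨_, _, .loop_true (g.fits_of_ok hs (hg j s hs hI) hc) h h1 h1', ?_, h3', h4'⟩
      rw [Nat.succ_mul]; omega
    · exact ⟨_, _, .loop_false (g.fits_of_ok hs (hg j s hs hI) hc) h, by simp, hs, hQ j s hs hI h⟩

/-- A loop with invariant `I` (indexed by the number of iterations) that is run through at most `K`
times. -/
theorem loop {g : Test} (hc : g.cost ≤ 64) (K : ℕ) (hK : K ≤ X) (I : ℕ → Store → Prop) (h0 : I 0 s)
    (hg : ∀ j s', Frame c s s' → I j s' → g.Ok H s')
    (hlt : ∀ j s', Frame c s s' → I j s' → g.Holds s' → j < K)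
    (step : ∀ j s', Frame c s s' → I j s' → g.Holds s' → Run H X c s' (I (j + 1)))
    (hQ : ∀ j s', Frame c s s' → I j s' → ¬ g.Holds s' → Q s') :
    Run H X (.loop g c) s Q := by
  intro hs
  obtain ⟨t, s', h1, h2, h3, h4⟩ := loop_aux (X := X) (c := c) (H := H) (Q := Q) hc K
    (fun j s' => Frame c s s' ∧ I j s')
    (fun j s' _ h => hg j s' h.1 h.2) (fun j s' _ h => hlt j s' h.1 h.2)
    (fun j s' _ h h' => (step j s' h.1 h.2 h').mono fun s'' hF hI => ⟨h.1.trans hF, hI⟩)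
    (fun j s' _ h => hQ j s' h.1 h.2) K 0 s hs ⟨.rfl', h0⟩ (by omega)
  refine ⟨t, s', h1, h2.trans ?_, h3, h4⟩
  simp only [Cmd.time]
  gcongr

/-- A counting loop with invariant `I` (indexed by the value of the counter). -/
theorem forLoop {i b : ℕ} (N : ℕ) (hb : s.var b = N) (hN : N ≤ X)
    (hi : i < 64) (hb' : b < 64) (hci : c.keepsVar i = true) (hcb : c.keepsVar b = true)
    (hib : b ≠ i) (I : ℕ → Store → Prop) (h0 : I 0 (s.setVar i 0))
    (step : ∀ j, j < N → ∀ s', Frame (.forLoop i b c) s s' → s'.var i = j → I j s' →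
      Run H X c s' (fun s'' => I (j + 1) (s''.setVar i ((j + 1 : ℕ) : ℤ))))
    (hQ : ∀ s', Frame (.forLoop i b c) s s' → I N s' → Q s') :
    Run H X (.forLoop i b c) s Q := by
  refine of_small fun h2 hsm => ?_
  have hNH : (N : ℤ) ≤ H := hb ▸ (hsm b hb').2
  have hfr : ∀ s', Frame (c ;; .assign i (.var i + 1)) (s.setVar i 0) s' →
      Frame (.forLoop i b c) s s' := by
    intro s' hF
    refine ⟨fun l hl => ?_, fun a ha => ?_⟩
    · simp only [Cmd.forLoop, Cmd.keepsVar, Bool.and_eq_true] at hl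
      rw [hF.var l (by simp only [Cmd.keepsVar, Bool.and_eq_true]; exact hl.2)]
      have : l ≠ i := by
        rintro rfl
        simp at hl
      simp [this]
    · simp only [Cmd.forLoop, Cmd.keepsArr, Bool.and_eq_true] at ha
      rw [hF.arr a (by simp only [Cmd.keepsArr, Bool.and_eq_true]; exact ha.2)]
      rfl
  have hbk : (Cmd.seq c (.assign i (.var i + 1))).keepsVar b = true := by
    simp [Cmd.keepsVar, hcb, hib]
  have hvb : ∀ s', Frame (c ;; .assign i (.var i + 1)) (s.setVar i 0) s' → s'.var b = N := by
    intro s' hF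
    rw [hF.var b hbk]
    simp [hib, hb]
  refine seq (assign (Nat.le_of_ble_eq_true rfl) Expr.ok_zero (by simp [Within]) ?_)
  refine loop (Nat.le_of_ble_eq_true rfl) N hN (fun j s' => s'.var i = j ∧ j ≤ N ∧ I j s') ⟨?_, by omega, h0⟩
    ?_ ?_ ?_ ?_
  · simp
  · intro j s' _ _
    simp [hi, hb']
  · rintro j s' hF ⟨h1, -, -⟩ h
    have := hvb s' hF
    simp only [Test.holds_lt, Expr.eval_var, h1, this] at h
    omega
  · rintro j s' hF ⟨h1, h2, h3⟩ h
    have hb2 := hvb s' hF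
    simp only [Test.holds_lt, Expr.eval_var, h1, hb2] at h
    refine seq_of (step j (by omega) s' (hfr s' hF) h1 h3) fun s'' hF' hI => ?_
    have hi'' : s''.var i = j := by rw [hF'.var i hci, h1]
    refine assign (Nat.le_of_ble_eq_true rfl) (by simp [hi]) ?_ ?_
    · simp only [Expr.eval_add, Expr.eval_var, Expr.eval_one, hi'', Within]; omega
    · simp only [Expr.eval_add, Expr.eval_var, Expr.eval_one, hi'']
      refine ⟨by simp, by omega, ?_⟩
      simpa using hI
  · rintro j s' hF ⟨h1, h2, h3⟩ h
    have hb2 := hvb s' hF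
    simp only [Test.holds_lt, Expr.eval_var, h1, hb2] at h
    obtain rfl : j = N := by omega
    exact hQ s' (hfr s' hF) h3

end Run

/-! ### Elementary vectors of a totally unimodular matrix -/

section Tableau

variable {k n : ℕ}

/-- The rows of `T`, followed by the unit vectors. -/
def stackRow (T : Matrix (Fin k) (Fin n) ℤ) (i : ℕ) : Fin n → ℤ :=
  if h : i < k then T ⟨i, h⟩ else fun l => if i = k + l then 1 else 0

theorem stackRow_of_lt (T : Matrix (Fin k) (Fin n) ℤ) (i : Fin k) : stackRow T i = T i := by
  simp [stackRow]

theorem stackRow_add (T : Matrix (Fin k) (Fin n) ℤ) (l : Fin n) :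
    stackRow T (k + l) = Pi.single l 1 := by
  funext j
  simp [stackRow, Pi.single_apply, Fin.ext_iff, eq_comm]

theorem stackRow_cases (T : Matrix (Fin k) (Fin n) ℤ) {i : ℕ} (hi : i < k + n) :
    (∃ i' : Fin k, stackRow T i = T i') ∨ ∃ l : Fin n, stackRow T i = Pi.single l 1 := by
  by_cases h : i < k
  · exact .inl ⟨⟨i, h⟩, stackRow_of_lt T ⟨i, h⟩⟩
  · refine .inr ⟨⟨i - k, by omega⟩, ?_⟩
    rw [← stackRow_add T]
    congr 1
    simp only
    omega

/-- Through this the bound in the maximum norm becomes a case of the bound for TU-appendable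
directions. -/
theorem tuAppendable_single {T : Matrix (Fin k) (Fin n) ℤ} (hT : T.IsTotallyUnimodular)
    (l : Fin n) : TUAppendable T (Pi.single l 1) :=
  hT.fromRows_unitlike fun _ _ => ⟨l, 1, by funext; simp [Matrix.replicateRow_apply]⟩

theorem tuAppendable_stackRow {T : Matrix (Fin k) (Fin n) ℤ} (hT : T.IsTotallyUnimodular)
    {i : ℕ} (hi : i < k + n) : TUAppendable T (stackRow T i) := by
  rcases stackRow_cases T hi with ⟨i', h⟩ | ⟨l, h⟩
  · rw [h, TUAppendable]
    have : Matrix.fromRows T (Matrix.replicateRow Unit (T i')) =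
        T.submatrix (Sum.elim id fun _ => i') id := by
      ext (a | a) b <;> simp
    rw [this]
    exact hT.submatrix _ _
  · rw [h]
    exact tuAppendable_single hT l

/-- `u` changes by at most one in the direction of every TU-appendable vector. -/
def IsElementary (T : Matrix (Fin k) (Fin n) ℤ) (u : Fin n → ℤ) : Prop :=
  ∀ d, TUAppendable T d → |dotProduct d u| ≤ 1

/-- `A = [T; I] U` for an integral matrix `U` and contains the identity matrix in the rows `lab`. -/
structure IsTableau (T : Matrix (Fin k) (Fin n) ℤ) (A : ℕ → Fin n → ℤ) (lab : Fin n → ℕ) :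
    Prop where
  eq_sum : ∀ i, i < k + n → ∀ j, A i j = ∑ l : Fin n, stackRow T i l * A (k + l) j
  lab_lt : ∀ l, lab l < k + n
  unit : ∀ l j, A (lab l) j = if l = j then 1 else 0

namespace IsTableau

variable {T : Matrix (Fin k) (Fin n) ℤ} {A : ℕ → Fin n → ℤ} {lab : Fin n → ℕ}

theorem mul_eq_one (h : IsTableau T A lab) :
    (Matrix.of fun l j => stackRow T (lab l) j) * (Matrix.of fun (l j : Fin n) => A (k + l) j)
      = 1 := by
  ext l j
  simp only [Matrix.mul_apply, Matrix.of_apply, ← h.eq_sum _ (h.lab_lt l), h.unit,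
    Matrix.one_apply]

/-- Cramer's rule: with `N` the rows `lab` of `[T; I]` and `U = N⁻¹`, the product of `d` with column
`j` of `U` is the determinant of `N` with row `j` replaced by `d`, divided by `det N = ±1`. That
determinant is a minor of the totally unimodular matrix `[T; d; I]`, up to repeated rows. -/
theorem isElementary (h : IsTableau T A lab) (j : Fin n) :
    IsElementary T fun l => A (k + l) j := by
  intro d hd
  set N : Matrix (Fin n) (Fin n) ℤ := Matrix.of fun l j => stackRow T (lab l) j with hN
  set U : Matrix (Fin n) (Fin n) ℤ := Matrix.of fun (l j : Fin n) => A (k + l) j with hU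
  have hNU : N * U = 1 := h.mul_eq_one
  have hdet : |U.det| = 1 := by
    have h1 := congrArg Matrix.det hNU
    rw [Matrix.det_mul, Matrix.det_one, mul_comm] at h1
    exact Int.isUnit_iff_abs_eq.1 (IsUnit.of_mul_eq_one _ h1)
  have hprod : N.updateRow j d * U = (1 : Matrix (Fin n) (Fin n) ℤ).updateRow j (Matrix.vecMul d U) := by
    rw [← hNU, Matrix.updateRow_mul]
  have hdet2 : ((1 : Matrix (Fin n) (Fin n) ℤ).updateRow j (Matrix.vecMul d U)).det
      = dotProduct d fun l => A (k + l) j := by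
    rw [← Matrix.cramer_transpose_apply, Matrix.transpose_one, Matrix.cramer_one]
    rfl
  have hTU : |(N.updateRow j d).det| ≤ 1 := by
    have h1 : (Matrix.fromRows (Matrix.fromRows T (Matrix.replicateRow Unit d))
      (1 : Matrix (Fin n) (Fin n) ℤ)).IsTotallyUnimodular := hd.fromRows_one
    -- The rows need not be distinct: total unimodularity in the form of
    -- `Matrix.isTotallyUnimodular_iff` allows any selection of rows.
    have h2 : ∀ l : Fin n, ∃ a : (Fin k ⊕ Unit) ⊕ Fin n, N.updateRow j d l =
        (Matrix.fromRows (Matrix.fromRows T (Matrix.replicateRow Unit d))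
          (1 : Matrix (Fin n) (Fin n) ℤ)) a := by
      intro l
      by_cases hl : l = j
      · subst hl
        exact ⟨.inl (.inr ()), by funext; simp⟩
      · rw [Matrix.updateRow_ne hl]
        rcases stackRow_cases T (h.lab_lt l) with ⟨i, hi⟩ | ⟨i, hi⟩
        · exact ⟨.inl (.inl i), by funext b; simp [hN, hi]⟩
        · exact ⟨.inr i, by funext b; simp [hN, hi, Matrix.one_apply, Pi.single_apply, eq_comm]⟩
    choose f hf using h2
    have h3 := (Matrix.isTotallyUnimodular_iff _).1 h1 n f id
    have h4 : (Matrix.fromRows (Matrix.fromRows T (Matrix.replicateRow Unit d))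
        (1 : Matrix (Fin n) (Fin n) ℤ)).submatrix f id = N.updateRow j d := by
      ext a b
      rw [hf a]
      rfl
    rw [h4] at h3
    obtain ⟨σ, hσ⟩ := h3
    rw [← hσ]
    cases σ <;> simp
  have h5 := congrArg Matrix.det hprod
  rw [Matrix.det_mul, hdet2] at h5
  rw [← h5, abs_mul, hdet, mul_one]
  exact hTU

theorem abs_le_one (hT : T.IsTotallyUnimodular) (h : IsTableau T A lab) {i : ℕ} (hi : i < k + n)
    (j : Fin n) : |A i j| ≤ 1 := by
  rw [h.eq_sum i hi]
  exact h.isElementary j _ (tuAppendable_stackRow hT hi)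

/-- The rows `lab` form a basis, so the products of a vector with these rows determine its products
with all rows. -/
theorem eq_sum_lab (h : IsTableau T A lab) {v : ℕ → ℤ}
    (hv : ∀ i, i < k + n → v i = ∑ l : Fin n, stackRow T i l * v (k + l)) {i : ℕ}
    (hi : i < k + n) : v i = ∑ j, A i j * v (lab j) := by
  set N : Matrix (Fin n) (Fin n) ℤ := Matrix.of fun l j => stackRow T (lab l) j with hN
  set U : Matrix (Fin n) (Fin n) ℤ := Matrix.of fun (l j : Fin n) => A (k + l) j with hU
  have hUN : U * N = 1 := mul_eq_one_comm.1 h.mul_eq_one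
  have h1 : (fun j => v (lab j)) = N.mulVec fun l : Fin n => v (k + l) := by
    funext j
    rw [hv _ (h.lab_lt j)]
    rfl
  have h2 : A i = Matrix.vecMul (stackRow T i) U := by
    funext j
    rw [h.eq_sum i hi]
    rfl
  calc v i = dotProduct (stackRow T i) fun l : Fin n => v (k + l) := hv i hi
    _ = dotProduct (stackRow T i) (U.mulVec (N.mulVec fun l : Fin n => v (k + l))) := by
      rw [Matrix.mulVec_mulVec, hUN, Matrix.one_mulVec]
    _ = dotProduct (A i) fun j => v (lab j) := by
      rw [Matrix.dotProduct_mulVec, h1, h2]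

/-- Pivoting on the entry in row `i` and column `p`. -/
theorem pivot (hT : T.IsTotallyUnimodular) (h : IsTableau T A lab) {i : ℕ} (hi : i < k + n)
    {p : Fin n} (hp : A i p ≠ 0) {A' : ℕ → Fin n → ℤ}
    (hA' : ∀ r, r < k + n → ∀ j, A' r j =
      if j = p then A r p * A i p else A r j - A i j * (A r p * A i p)) :
    IsTableau T A' (Function.update lab p i) := by
  -- The pivot entry is `±1`, so multiplying by it is dividing by it, and the tableau stays
  -- integral.
  have hsq : A i p * A i p = 1 := by
    have := h.abs_le_one hT hi p
    have h1 : A i p = 1 ∨ A i p = -1 := by rw [abs_le] at this; omega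
    rcases h1 with h1 | h1 <;> rw [h1] <;> norm_num
  refine ⟨fun r hr j => ?_, fun l => ?_, fun l j => ?_⟩
  · rw [hA' r hr]
    simp only [hA' (k + _) (Nat.add_lt_add_left (Fin.is_lt _) k)]
    split_ifs
    · rw [h.eq_sum r hr p, Finset.sum_mul]
      simp only [mul_assoc]
    · rw [h.eq_sum r hr p, h.eq_sum r hr j]
      simp only [mul_sub, Finset.sum_sub_distrib]
      rw [Finset.sum_mul, Finset.mul_sum]
      congr 1
      refine Finset.sum_congr rfl fun l _ => ?_
      ring
  · by_cases hl : l = p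
    · subst hl; simpa using hi
    · simpa [hl] using h.lab_lt l
  · by_cases hl : l = p
    · subst hl
      simp only [Function.update_self]
      rw [hA' i hi]
      by_cases hj : j = l
      · simp [hj, hsq]
      · rw [if_neg hj, if_neg (Ne.symm hj), hsq]; ring
    · simp only [Function.update_of_ne hl]
      rw [hA' _ (h.lab_lt l), h.unit l p, if_neg hl, h.unit]
      by_cases hj : j = p
      · subst hj; simp [hl]
      · simp [hj]

theorem exists_ne_zero (h : IsTableau T A lab) (q : Fin n) : ∃ i, i < k + n ∧ A i q ≠ 0 :=
  ⟨lab q, h.lab_lt q, by rw [h.unit]; simp⟩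

end IsTableau

/-- The initial tableau: `U` is the identity and the basis consists of the unit rows. -/
theorem isTableau_stackRow (T : Matrix (Fin k) (Fin n) ℤ) :
    IsTableau T (stackRow T) fun l => k + l := by
  refine ⟨fun i _ j => ?_, fun l => by omega, fun l j => ?_⟩
  · simp [stackRow_add, Pi.single_apply]
  · simp [stackRow_add, Pi.single_apply, eq_comm]

/-! ### Steps of the conformal decomposition -/

/-- `a` does not have the sign opposite to `b`, and vanishes if `b` does. -/
def SignLE (a b : ℤ) : Prop := (0 ≤ b → 0 ≤ a) ∧ (b ≤ 0 → a ≤ 0)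

theorem SignLE.trans {a b c : ℤ} (h : SignLE a b) (h' : SignLE b c) : SignLE a c :=
  ⟨fun hc => h.1 (h'.1 hc), fun hc => h.2 (h'.2 hc)⟩

theorem SignLE.refl (a : ℤ) : SignLE a a := ⟨id, id⟩

/-- The columns in `F` belong to rows in which `v` vanishes, and each of the first `r` rows in which
`v` vanishes is zero in the other columns. -/
structure IsFrozen (A : ℕ → Fin n → ℤ) (lab : Fin n → ℕ) (v : ℕ → ℤ) (F : Fin n → Prop) (r : ℕ) :
    Prop where
  lab_eq : ∀ j, F j → v (lab j) = 0
  zero : ∀ i, i < r → v i = 0 → ∀ j, ¬ F j → A i j = 0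

variable {T : Matrix (Fin k) (Fin n) ℤ} {A : ℕ → Fin n → ℤ} {lab : Fin n → ℕ} {v : ℕ → ℤ}
  {F : Fin n → Prop}

theorem IsFrozen.succ_of_zero {r : ℕ} (h : IsFrozen A lab v F r)
    (hr : v r = 0 → ∀ j, ¬ F j → A r j = 0) : IsFrozen A lab v F (r + 1) := by
  refine ⟨h.lab_eq, fun i hi => ?_⟩
  rcases Nat.lt_succ_iff_lt_or_eq.1 hi with hi | rfl
  · exact h.zero i hi
  · exact hr

/-- An earlier row in which `v` vanishes is zero in all columns that are not frozen, in particular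
in the pivot column, so the pivot step does not disturb it there. Row `r` itself becomes a unit row
whose only nonzero entry lies in the newly frozen column `p`. -/
theorem IsFrozen.pivot {r : ℕ} (h : IsFrozen A lab v F r) (ht : IsTableau T A lab)
    (hT : T.IsTotallyUnimodular) (hr : r < k + n) (hv : v r = 0) {p : Fin n} (hF : ¬ F p)
    (hp : A r p ≠ 0) {A' : ℕ → Fin n → ℤ} {F' : Fin n → Prop}
    (hA' : ∀ i, i < k + n → ∀ j, A' i j =
      if j = p then A i p * A r p else A i j - A r j * (A i p * A r p))
    (hF' : ∀ j, F' j ↔ j = p ∨ F j) :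
    IsFrozen A' (Function.update lab p r) v F' (r + 1) := by
  have ht' := ht.pivot hT hr hp hA'
  refine ⟨fun j hj => ?_, fun i hi hvi j hj => ?_⟩
  · by_cases hjp : j = p
    · subst hjp; simpa using hv
    · simpa [hjp] using h.lab_eq j (((hF' j).1 hj).resolve_left hjp)
  · rw [hF', not_or] at hj
    rcases Nat.lt_succ_iff_lt_or_eq.1 hi with hi | rfl
    · rw [hA' i (by omega), if_neg hj.1, h.zero i hi hvi j hj.2, h.zero i hi hvi p hF]
      ring
    · have := ht'.unit p j
      rw [Function.update_self, if_neg (Ne.symm hj.1)] at this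
      exact this

/-- If all columns are frozen, `v` vanishes on the basis rows `lab` and hence everywhere. Conversely
a nonzero `v` leaves a column that is not frozen, which serves as a direction. -/
theorem IsFrozen.eq_zero (h : IsFrozen A lab v F (k + n)) (ht : IsTableau T A lab)
    (hv : ∀ i, i < k + n → v i = ∑ l : Fin n, stackRow T i l * v (k + l)) (hF : ∀ j, F j) {i : ℕ}
    (hi : i < k + n) : v i = 0 := by
  rw [ht.eq_sum_lab hv hi]
  exact Finset.sum_eq_zero fun j _ => by rw [h.lab_eq j (hF j), mul_zero]

/-- Number of the first `K` entries that do not vanish. -/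
def suppCard (K : ℕ) (v : ℕ → ℤ) : ℕ := ((Finset.range K).filter fun i => v i ≠ 0).card

theorem suppCard_le (K : ℕ) (v : ℕ → ℤ) : suppCard K v ≤ K :=
  (Finset.card_filter_le _ _).trans (by simp)

theorem suppCard_lt {K : ℕ} {v v' : ℕ → ℤ} (h : ∀ i, i < K → v i = 0 → v' i = 0) {i : ℕ}
    (hi : i < K) (hv : v i ≠ 0) (hv' : v' i = 0) : suppCard K v' < suppCard K v := by
  refine Finset.card_lt_card ((Finset.ssubset_iff_of_subset fun j hj => ?_).2 ⟨i, ?_, ?_⟩)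
  · simp only [Finset.mem_filter, Finset.mem_range] at hj ⊢
    exact ⟨hj.1, fun h0 => hj.2 (h j hj.1 h0)⟩
  · simp [hi, hv]
  · simp [hv']

theorem suppCard_eq_zero {K : ℕ} {v : ℕ → ℤ} (h : suppCard K v = 0) {i : ℕ} (hi : i < K) :
    v i = 0 := by
  by_contra hv
  have : i ∈ (Finset.range K).filter fun i => v i ≠ 0 := by simp [hi, hv]
  rw [suppCard, Finset.card_eq_zero] at h
  rw [h] at this
  simp at this

/-- `t` is the least positive one among the first `K` numbers `a i`. -/
structure IsLeastPos (K : ℕ) (a : ℕ → ℤ) (t : ℤ) : Prop where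
  exists_eq : ∃ i, i < K ∧ a i = t
  pos : 0 < t
  le : ∀ i, i < K → 0 < a i → t ≤ a i

section Step

variable {K : ℕ} {a v v' : ℕ → ℤ} {t : ℤ}

/-- Subtracting a multiple of a vector with entries `a i` in `{-1, 0, 1}`. -/
theorem IsLeastPos.signLE (ht : IsLeastPos K (fun i => a i * v i) t) (ha : ∀ i, i < K → |a i| ≤ 1)
    (h0 : ∀ i, i < K → v i = 0 → a i = 0) (hv' : ∀ i, i < K → v' i = v i - t * a i) {i : ℕ}
    (hi : i < K) : SignLE (v' i) (v i) := by
  have h1 := ht.pos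
  have h2 := ht.le i hi
  have h3 : a i = -1 ∨ a i = 0 ∨ a i = 1 := by have := abs_le.1 (ha i hi); omega
  have h4 := h0 i hi
  rw [hv' i hi]
  unfold SignLE
  rcases h3 with h3 | h3 | h3 <;> rw [h3] at h2 h4 ⊢
  · constructor
    · intro h; have : v i ≠ 0 := fun h => by simpa using h4 h
      omega
    · intro h; have : v i ≠ 0 := fun h => by simpa using h4 h
      omega
  · omega
  · constructor
    · intro h; have : v i ≠ 0 := fun h => by simpa using h4 h
      omega
    · intro h; have : v i ≠ 0 := fun h => by simpa using h4 h
      omega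

/-- At a row that attains the minimum, `a i = ±1` and `a i * v i = t`, so `v i = t * a i` and the
entry is cancelled; zeros persist because `a` vanishes where `v` does. -/
theorem IsLeastPos.suppCard_lt (ht : IsLeastPos K (fun i => a i * v i) t)
    (ha : ∀ i, i < K → |a i| ≤ 1) (h0 : ∀ i, i < K → v i = 0 → a i = 0)
    (hv' : ∀ i, i < K → v' i = v i - t * a i) : suppCard K v' < suppCard K v := by
  obtain ⟨i, hi, hit⟩ := ht.exists_eq
  have hpos := ht.pos
  have h3 : a i = -1 ∨ a i = 0 ∨ a i = 1 := by have := abs_le.1 (ha i hi); omega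
  refine _root_.suppCard_lt (i := i) (fun j hj h => ?_) hi ?_ ?_
  · rw [hv' j hj, h, h0 j hj h]; ring
  · rintro h; rw [h] at hit; omega
  · rw [hv' i hi]
    rcases h3 with h3 | h3 | h3 <;> rw [h3] at hit ⊢ <;> omega

theorem IsLeastPos.le_of_bound (ht : IsLeastPos K (fun i => a i * v i) t)
    (ha : ∀ i, i < K → |a i| ≤ 1) {V : ℤ} (hV : ∀ i, i < K → |v i| ≤ V) : t ≤ V := by
  obtain ⟨i, hi, hit⟩ := ht.exists_eq
  have h1 := hV i hi
  rw [← hit]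
  calc a i * v i ≤ |a i * v i| := le_abs_self _
    _ = |a i| * |v i| := abs_mul _ _
    _ ≤ 1 * |v i| := by gcongr; exact ha i hi
    _ ≤ V := by omega

/-- Entries where `a` and `v` have opposite signs grow, but by `t` at most, and `t` is itself the
absolute value of an entry. This doubling causes the factor `2 ^ r` in the invariant of the walk. -/
theorem IsLeastPos.abs_le (ht : IsLeastPos K (fun i => a i * v i) t)
    (ha : ∀ i, i < K → |a i| ≤ 1) (hv' : ∀ i, i < K → v' i = v i - t * a i) {V : ℤ}
    (hV : ∀ i, i < K → |v i| ≤ V) {i : ℕ} (hi : i < K) : |v' i| ≤ 2 * V := by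
  have h1 := ht.le_of_bound ha hV
  have h2 := ht.pos
  have h3 : a i = -1 ∨ a i = 0 ∨ a i = 1 := by have := _root_.abs_le.1 (ha i hi); omega
  have h4 := _root_.abs_le.1 (hV i hi)
  rw [hv' i hi, _root_.abs_le]
  rcases h3 with h3 | h3 | h3 <;> rw [h3] <;> omega

/-- If the subtracted vector is conformal, no entry grows. -/
theorem IsLeastPos.abs_le_of_nonneg (ht : IsLeastPos K (fun i => a i * v i) t)
    (ha : ∀ i, i < K → |a i| ≤ 1) (h0 : ∀ i, i < K → v i = 0 → a i = 0)
    (hpos : ∀ i, i < K → 0 ≤ a i * v i) (hv' : ∀ i, i < K → v' i = v i - t * a i) {i : ℕ}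
    (hi : i < K) : |v' i| ≤ |v i| := by
  have h1 := ht.le i hi
  have h2 := ht.pos
  have h3 : a i = -1 ∨ a i = 0 ∨ a i = 1 := by have := _root_.abs_le.1 (ha i hi); omega
  have h4 := hpos i hi
  have h5 := h0 i hi
  rw [hv' i hi]
  rcases h3 with h3 | h3 | h3 <;> rw [h3] at h1 h4 h5 ⊢
  · have : v i ≠ 0 := fun h => by simpa using h5 h
    rw [abs_of_nonpos (by omega), abs_of_nonpos (by omega)]; omega
  · simp
  · have : v i ≠ 0 := fun h => by simpa using h5 h
    rw [abs_of_nonneg (by omega), abs_of_nonneg (by omega)]; omega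

end Step

end Tableau

/-! ### Conformal decompositions and proximity -/

section Decomposition

variable {k n : ℕ}

/-- `z` is a nonnegative combination of elementary vectors that are conformal to it. -/
structure IsDecomposition (T : Matrix (Fin k) (Fin n) ℤ) (z : Fin n → ℤ) (N : ℕ) (lam : ℕ → ℤ)
    (u : ℕ → Fin n → ℤ) : Prop where
  sum : ∀ j, z j = ∑ p ∈ Finset.range N, lam p * u p j
  nonneg : ∀ p, p < N → 0 ≤ lam p
  elementary : ∀ p, p < N → IsElementary T (u p)
  sign : ∀ p, p < N → ∀ i, SignLE (dotProduct (T i) (u p)) (dotProduct (T i) z)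

/-- The vector `x₀ + ∑ μ_p u_p`. -/
def combine (x₀ : Fin n → ℤ) (N : ℕ) (μ : ℕ → ℤ) (u : ℕ → Fin n → ℤ) : Fin n → ℤ :=
  fun j => x₀ j + ∑ p ∈ Finset.range N, μ p * u p j

theorem dotProduct_combine (d x₀ : Fin n → ℤ) (N : ℕ) (μ : ℕ → ℤ) (u : ℕ → Fin n → ℤ) :
    dotProduct d (combine x₀ N μ u) =
      dotProduct d x₀ + ∑ p ∈ Finset.range N, μ p * dotProduct d (u p) := by
  simp only [dotProduct, combine, mul_add, Finset.sum_add_distrib, Finset.mul_sum]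
  rw [Finset.sum_comm]
  congr 1
  refine Finset.sum_congr rfl fun p _ => Finset.sum_congr rfl fun j _ => ?_
  ring

namespace IsDecomposition

variable {P : RCCTU k n} {x₀ y : Fin n → ℤ} {N : ℕ} {lam μ : ℕ → ℤ} {u : ℕ → Fin n → ℤ}

theorem combine_eq (h : IsDecomposition P.T (y - x₀) N lam u) : combine x₀ N lam u = y := by
  funext j
  simp only [combine, ← h.sum j, Pi.sub_apply]
  ring

/-- In each row the summands all have the sign of the total change. If that sign is positive, a part
changes the row by at most as much as the whole, which leads to the feasible `y`; if it is negative,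
a part can only decrease the row below its value at `x₀`. -/
theorem relaxFeasible (h : IsDecomposition P.T (y - x₀) N lam u) (hx₀ : P.RelaxFeasible x₀)
    (hy : P.RelaxFeasible y) (hμ : ∀ p, p < N → 0 ≤ μ p ∧ μ p ≤ lam p) :
    P.RelaxFeasible (combine x₀ N μ u) := by
  intro i
  have h1 : dotProduct (P.T i) x₀ ≤ P.b i := hx₀ i
  have h2 : dotProduct (P.T i) y ≤ P.b i := hy i
  change dotProduct (P.T i) (combine x₀ N μ u) ≤ P.b i
  rw [dotProduct_combine]
  have h3 : dotProduct (P.T i) y = dotProduct (P.T i) x₀ +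
      ∑ p ∈ Finset.range N, lam p * dotProduct (P.T i) (u p) := by
    rw [← dotProduct_combine, h.combine_eq]
  rcases le_total 0 (dotProduct (P.T i) (y - x₀)) with h0 | h0
  · have : ∑ p ∈ Finset.range N, μ p * dotProduct (P.T i) (u p) ≤
        ∑ p ∈ Finset.range N, lam p * dotProduct (P.T i) (u p) := by
      refine Finset.sum_le_sum fun p hp => ?_
      have hp := Finset.mem_range.1 hp
      exact mul_le_mul_of_nonneg_right (hμ p hp).2 ((h.sign p hp i).1 h0)
    linarith
  · have : ∑ p ∈ Finset.range N, μ p * dotProduct (P.T i) (u p) ≤ 0 := by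
      refine Finset.sum_nonpos fun p hp => ?_
      have hp := Finset.mem_range.1 hp
      exact mul_nonpos_of_nonneg_of_nonpos (hμ p hp).1 ((h.sign p hp i).2 h0)
    linarith

/-- Each `u p` that is used costs at least nothing, so dropping copies of it from `y` does not
increase the cost. -/
theorem cost_le (h : IsDecomposition P.T (y - x₀) N lam u) (hx₀ : P.RelaxOptimal x₀)
    (hy : P.RelaxFeasible y) (hμ : ∀ p, p < N → 0 ≤ μ p ∧ μ p ≤ lam p) :
    dotProduct P.c (combine x₀ N μ u) ≤ dotProduct P.c y := by
  have h1 : dotProduct P.c y = dotProduct P.c (combine x₀ N lam u) := by rw [h.combine_eq]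
  rw [h1, dotProduct_combine, dotProduct_combine]
  refine add_le_add_right (Finset.sum_le_sum fun p hp => ?_) _
  have hp := Finset.mem_range.1 hp
  rcases eq_or_lt_of_le (h.nonneg p hp) with h0 | h0
  · have := hμ p hp
    rw [show μ p = lam p by omega]
  · refine mul_le_mul_of_nonneg_right (hμ p hp).2 ?_
    -- Here `lam p ≥ 1`, so `x₀ + u p` is a partial combination; optimality of `x₀` against it gives
    -- `cᵀ(u p) ≥ 0`.
    have h2 := hx₀.2 _ (h.relaxFeasible (μ := fun q => if q = p then 1 else 0) hx₀.1 hy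
      fun q hq => by
        have := h.nonneg q hq
        by_cases hqp : q = p
        · subst hqp; simp only [if_true]; omega
        · simp [hqp, this])
    rw [dotProduct_combine] at h2
    simpa [hp] using h2

/-- Each unit of multiplicity moves a TU-appendable direction by at most one, so the total
multiplicity bounds the distance. -/
theorem near (h : IsDecomposition P.T (y - x₀) N lam u) (hμ : ∀ p, p < N → 0 ≤ μ p)
    (hsum : ∑ p ∈ Finset.range N, μ p ≤ (P.m : ℤ) - P.R.card) :
    P.Near x₀ (combine x₀ N μ u) := by
  have key : ∀ d, TUAppendable P.T d →
      |dotProduct d (combine x₀ N μ u - x₀)| ≤ (P.m : ℤ) - P.R.card := by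
    intro d hd
    rw [dotProduct_sub, dotProduct_combine, add_sub_cancel_left]
    refine (Finset.abs_sum_le_sum_abs _ _).trans (le_trans (Finset.sum_le_sum fun p hp => ?_) hsum)
    have hp := Finset.mem_range.1 hp
    rw [abs_mul, abs_of_nonneg (hμ p hp)]
    have := h.elementary p hp d hd
    nlinarith [hμ p hp]
  refine ⟨?_, fun d hd => (le_abs_self _).trans (key d hd)⟩
  have h0 : (0 : ℤ) ≤ (P.m : ℤ) - P.R.card :=
    (Finset.sum_nonneg fun p hp => hμ p (Finset.mem_range.1 hp)).trans hsum
  rw [pi_norm_le_iff_of_nonneg (by exact_mod_cast h0)]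
  intro j
  have h1 := key _ (tuAppendable_single P.isTotallyUnimodular j)
  rw [single_dotProduct, one_mul] at h1
  rw [Int.norm_eq_abs]
  exact_mod_cast h1

end IsDecomposition

end Decomposition

/-! ### Short solutions of congruences -/

section Residues

/-- A path from `0` to `κ` that adds one unit at a time: `f i` is the multiplicity vector after `i`
steps, the entries being filled up one after the other. -/
theorem exists_chain (N : ℕ) (κ : ℕ → ℕ) : ∃ f : ℕ → ℕ → ℕ, (∀ i p, f i p ≤ f (i + 1) p) ∧
    (∀ p, p < N → f (∑ p ∈ Finset.range N, κ p) p = κ p) ∧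
    ∀ i, i ≤ ∑ p ∈ Finset.range N, κ p → ∑ p ∈ Finset.range N, f i p = i := by
  induction N with
  | zero => exact ⟨fun _ _ => 0, by simp, by simp, by simp⟩
  | succ N ih =>
    obtain ⟨f, h1, h2, h3⟩ := ih
    have hmono : ∀ p, Monotone fun i => f i p := fun p => monotone_nat_of_le_succ fun i => h1 i p
    rw [Finset.sum_range_succ]
    set L := ∑ p ∈ Finset.range N, κ p with hL
    refine ⟨fun i p => if p = N then min (i - L) (κ N) else f (min i L) p, ?_, ?_, ?_⟩
    · intro i p
      dsimp only
      split_ifs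
      · omega
      · exact hmono p (by omega)
    · intro p hp
      dsimp only
      split_ifs with h
      · subst h; omega
      · rw [show min (L + κ N) L = L by omega]
        exact h2 p (by omega)
    · intro i hi
      rw [Finset.sum_range_succ]
      have : ∑ p ∈ Finset.range N, (if p = N then min (i - L) (κ N) else f (min i L) p) =
          ∑ p ∈ Finset.range N, f (min i L) p := by
        refine Finset.sum_congr rfl fun p hp => if_neg ?_
        have := Finset.mem_range.1 hp
        omega
      rw [this, h3 _ (by omega)]
      simp only [if_true]
      omega

variable {m : ℕ}

/-- A solution `κ` of `h + ∑ κ_p g_p ∈ S` no proper part of which is a solution has at most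
`m - |S|` summands. -/
theorem sum_add_card_le_of_minimal [NeZero m] (N : ℕ) (κ : ℕ → ℕ) (g : ℕ → ZMod m) (h : ZMod m)
    (S : Finset (ZMod m)) (hmem : h + ∑ p ∈ Finset.range N, (κ p : ZMod m) * g p ∈ S)
    (hmin : ∀ μ : ℕ → ℕ, (∀ p, p < N → μ p ≤ κ p) →
      h + ∑ p ∈ Finset.range N, (μ p : ZMod m) * g p ∈ S → ∀ p, p < N → μ p = κ p) :
    ∑ p ∈ Finset.range N, κ p + S.card ≤ m := by
  obtain ⟨f, h1, h2, h3⟩ := exists_chain N κ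
  have hmono : ∀ p, Monotone fun i => f i p := fun p => monotone_nat_of_le_succ fun i => h1 i p
  set L := ∑ p ∈ Finset.range N, κ p with hL
  set φ : ℕ → ZMod m := fun i => h + ∑ p ∈ Finset.range N, (f i p : ZMod m) * g p with hφ
  have hle : ∀ i, i ≤ L → ∀ p, p < N → f i p ≤ κ p := fun i hi p hp =>
    (hmono p hi).trans (h2 p hp).le
  -- A partial vector with residue in `S` would be a solution with a smaller sum.
  have hnot : ∀ i, i < L → φ i ∉ S := by
    intro i hi hS
    have h4 := hmin (f i) (hle i hi.le) hS
    have h5 := h3 i hi.le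
    have h6 : ∑ p ∈ Finset.range N, f i p = L :=
      Finset.sum_congr rfl fun p hp => h4 p (Finset.mem_range.1 hp)
    omega
  have hinj : ∀ i j, i < j → j < L → φ i ≠ φ j := by
    intro i j hij hj heq
    -- If the residues after `i` and `j` steps agree, leaving out the steps in between does not
    -- change the final residue and gives a smaller solution.
    have h4 := hmin (fun p => κ p - (f j p - f i p)) (fun p _ => Nat.sub_le _ _) (by
      have : h + ∑ p ∈ Finset.range N, ((κ p - (f j p - f i p) : ℕ) : ZMod m) * g p =
          (h + ∑ p ∈ Finset.range N, (κ p : ZMod m) * g p) - (φ j - φ i) := by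
        simp only [hφ, add_sub_add_left_eq_sub]
        rw [← Finset.sum_sub_distrib, add_sub_assoc, ← Finset.sum_sub_distrib]
        congr 1
        refine Finset.sum_congr rfl fun p hp => ?_
        have h5 := hle j hj.le p (Finset.mem_range.1 hp)
        have h6 : f i p ≤ f j p := hmono p hij.le
        rw [Nat.cast_sub (by omega), Nat.cast_sub h6]
        ring
      rw [this, heq, sub_self, sub_zero]
      exact hmem)
    have h5 := h3 i (by omega)
    have h6 := h3 j hj.le
    have h7 : ∑ p ∈ Finset.range N, f j p = ∑ p ∈ Finset.range N, f i p := by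
      refine Finset.sum_congr rfl fun p hp => ?_
      have h8 := h4 p (Finset.mem_range.1 hp)
      have h9 := hle j hj.le p (Finset.mem_range.1 hp)
      have h10 : f i p ≤ f j p := hmono p hij.le
      omega
    omega
  have hcard : ((Finset.range L).image φ).card = L := by
    rw [Finset.card_image_of_injOn, Finset.card_range]
    intro i hi j hj hij
    simp only [Finset.coe_range, Set.mem_Iio] at hi hj
    rcases lt_trichotomy i j with h4 | h4 | h4
    · exact absurd hij (hinj i j h4 hj)
    · exact h4
    · exact absurd hij.symm (hinj j i h4 hi)
  have hdisj : Disjoint ((Finset.range L).image φ) S := by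
    rw [Finset.disjoint_left]
    intro x hx
    obtain ⟨i, hi, rfl⟩ := Finset.mem_image.1 hx
    exact hnot i (Finset.mem_range.1 hi)
  -- The first `L` residues of the path are distinct and avoid `S`, and all of them lie in a set of
  -- `m` elements.
  have := Finset.card_le_univ ((Finset.range L).image φ ∪ S)
  rw [Finset.card_union_of_disjoint hdisj, hcard, ZMod.card] at this
  exact this

/-! ### Coordinates with respect to a multiple of one residue -/

/-- `d` is the greatest common divisor of `g` and `m`, `e` its coefficient, `o` the order of `g`. -/
structure IsGcd (m : ℕ) (g d e o : ℤ) : Prop where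
  d_pos : 0 < d
  mul_eq : d * o = m
  e_nonneg : 0 ≤ e
  e_le : e ≤ m
  dvd : d ∣ g
  eq : (e : ZMod m) * g = d

/-- The multiple of `g` in the residue `r`, up to a remainder modulo `d`. -/
def coord (d e o r : ℤ) : ℤ := (r / d * e) % o

namespace IsGcd

variable {g d e o : ℤ}

theorem o_pos [NeZero m] (h : IsGcd m g d e o) : 0 < o := by
  have h1 : (0 : ℤ) < d * o := by
    rw [h.mul_eq]
    exact_mod_cast Nat.pos_of_ne_zero (NeZero.ne m)
  exact pos_of_mul_pos_right h1 h.d_pos.le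

theorem o_le [NeZero m] (h : IsGcd m g d e o) : o ≤ m := by
  rw [← h.mul_eq]
  nlinarith [h.o_pos, h.d_pos]

theorem coord_nonneg [NeZero m] (h : IsGcd m g d e o) (r : ℤ) : 0 ≤ coord d e o r :=
  Int.emod_nonneg _ h.o_pos.ne'

theorem coord_lt [NeZero m] (h : IsGcd m g d e o) (r : ℤ) : coord d e o r < o :=
  Int.emod_lt_of_pos _ h.o_pos

theorem o_mul (h : IsGcd m g d e o) : (o : ZMod m) * g = 0 := by
  obtain ⟨g', rfl⟩ := h.dvd
  have : o * (d * g') = m * g' := by rw [← h.mul_eq]; ring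
  have h2 := congrArg (Int.cast : ℤ → ZMod m) this
  push_cast at h2 ⊢
  rw [h2]
  simp

/-- Write `r = r % d + d * (r / d)` and replace `d` by `e * g`; reducing the resulting multiple of
`g` modulo `o` is harmless because `o * g = 0`. -/
theorem coord_eq (h : IsGcd m g d e o) (r : ℤ) :
    (r : ZMod m) = ((r % d : ℤ) : ZMod m) + (coord d e o r : ZMod m) * g := by
  have h1 : r = r % d + d * (r / d) := (Int.emod_add_mul_ediv r d).symm
  have h2 : coord d e o r = r / d * e - o * (r / d * e / o) := by
    have := Int.emod_add_mul_ediv (r / d * e) o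
    unfold coord
    linarith
  have h3 := congrArg (Int.cast : ℤ → ZMod m) h1
  rw [h2]
  push_cast at h3 ⊢
  linear_combination h3 - ((r / d : ℤ) : ZMod m) * h.eq
    + ((r / d * e / o : ℤ) : ZMod m) * h.o_mul

/-- With `g = d * g'`, the coefficient `e` is an inverse of `g'` modulo `o`, so the multiplier of
`g` is recovered modulo `o`. -/
theorem coord_unique [NeZero m] (h : IsGcd m g d e o) {c x : ℤ} (hc : (c : ZMod m) = x * g) :
    c % d = 0 ∧ coord d e o c = x % o := by
  obtain ⟨g', rfl⟩ := h.dvd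
  have hm : (0 : ℤ) < m := by exact_mod_cast Nat.pos_of_ne_zero (NeZero.ne m)
  have h1 : (m : ℤ) ∣ c - x * (d * g') := by
    rw [← ZMod.intCast_zmod_eq_zero_iff_dvd]
    push_cast at hc ⊢
    rw [hc]
    ring
  have h2 : (m : ℤ) ∣ e * (d * g') - d := by
    rw [← ZMod.intCast_zmod_eq_zero_iff_dvd]
    have := h.eq
    push_cast at this ⊢
    rw [this]
    ring
  obtain ⟨t, ht⟩ := h1
  obtain ⟨t', ht'⟩ := h2
  rw [← h.mul_eq] at ht ht'
  have hc' : c = d * (x * g' + o * t) := by linarith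
  have he : e * g' = 1 + o * t' := by
    have : d * (e * g' - 1 - o * t') = 0 := by linarith
    rcases mul_eq_zero.1 this with h0 | h0
    · have := h.d_pos; omega
    · linarith
  refine ⟨by rw [hc']; simp, ?_⟩
  rw [coord, hc', Int.mul_ediv_cancel_left _ h.d_pos.ne']
  have : (x * g' + o * t) * e = x + o * (x * t' + t * e) := by linear_combination x * he
  rw [this, Int.add_mul_emod_self_left]

end IsGcd

/-! ### Tables of starting points -/

/-- The bucket of the residue `r`: equal remainders modulo `d`, and coordinates that differ by less
than `l`. -/
def bucket (d e o l W r : ℤ) : ℤ := r % d * W + coord d e o r / l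

/-- Every bucket of the table is empty (`Lo` negative) or holds two members of `Y`, the intervals of
length `l` (in direction `g`) that start at the stored members cover the same residues as those
that start at the members of `Y`. -/
structure IsTable (m : ℕ) (g d e o l W Z : ℤ) (Y : Set (ZMod m)) (Lo Hi : ℤ → ℤ) : Prop where
  mem : ∀ i, 0 ≤ i → i < Z → 0 ≤ Lo i → (Lo i : ZMod m) ∈ Y ∧ (Hi i : ZMod m) ∈ Y
  cover : ∀ y ∈ Y, ∀ c : ℤ, 0 ≤ c → c < l → ∃ i, 0 ≤ i ∧ i < Z ∧ 0 ≤ Lo i ∧ ∃ c', 0 ≤ c' ∧ c' < l ∧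
    (y + c * g = Lo i + c' * g ∨ y + c * g = Hi i + c' * g)
  lo_lt : ∀ i, 0 ≤ i → i < Z → Lo i < m
  neg_one_le : ∀ i, 0 ≤ i → i < Z → -1 ≤ Lo i
  hi_nonneg : ∀ i, 0 ≤ i → i < Z → -1 ≤ Hi i
  hi_lt : ∀ i, 0 ≤ i → i < Z → Hi i < m
  lo_bucket : ∀ i, 0 ≤ i → i < Z → 0 ≤ Lo i → bucket d e o l W (Lo i) = i
  hi_bucket : ∀ i, 0 ≤ i → i < Z → 0 ≤ Lo i → bucket d e o l W (Hi i) = i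
  le : ∀ i, 0 ≤ i → i < Z → 0 ≤ Lo i → coord d e o (Lo i) ≤ coord d e o (Hi i)

variable {g d e o l W Z : ℤ}

theorem bucket_bounds [NeZero m] (h : IsGcd m g d e o) (hl : 0 < l) (hW : W = o / l + 1)
    (r : ℤ) : 0 ≤ bucket d e o l W r ∧ bucket d e o l W r < d * W := by
  have h1 := Int.emod_nonneg r h.d_pos.ne'
  have h2 := Int.emod_lt_of_pos r h.d_pos
  have h3 : 0 ≤ coord d e o r / l := Int.ediv_nonneg (h.coord_nonneg r) hl.le
  have h4 : coord d e o r / l < W := by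
    have := Int.ediv_le_ediv hl (h.coord_lt r).le
    omega
  unfold bucket
  constructor
  · nlinarith
  · nlinarith

/-- The offset `coord / l` is less than `W`, so the bucket number is a two-digit number from which
both digits can be recovered. -/
theorem bucket_eq [NeZero m] (h : IsGcd m g d e o) (hl : 0 < l) (hW : W = o / l + 1) {r r' : ℤ}
    (hr : bucket d e o l W r = bucket d e o l W r') :
    r % d = r' % d ∧ coord d e o r < coord d e o r' + l := by
  have h4 : ∀ r, 0 ≤ coord d e o r / l ∧ coord d e o r / l < W := by
    intro r
    have := Int.ediv_le_ediv hl (h.coord_lt r).le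
    exact ⟨Int.ediv_nonneg (h.coord_nonneg r) hl.le, by omega⟩
  have hW0 : 0 < W := by have := h4 0; omega
  unfold bucket at hr
  have h5 : coord d e o r / l = coord d e o r' / l := by
    have := congrArg (· % W) hr
    simp only [add_comm (_ * W), Int.add_mul_emod_self_right] at this
    rwa [Int.emod_eq_of_lt (h4 r).1 (h4 r).2, Int.emod_eq_of_lt (h4 r').1 (h4 r').2] at this
  refine ⟨?_, ?_⟩
  · rw [h5] at hr
    exact mul_right_cancel₀ hW0.ne' (add_right_cancel hr)
  · have h6 := Int.emod_add_mul_ediv (coord d e o r) l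
    have h7 := Int.emod_add_mul_ediv (coord d e o r') l
    have h8 := Int.emod_lt_of_pos (coord d e o r) hl
    have h9 := Int.emod_nonneg (coord d e o r') hl.ne'
    rw [h5] at h6
    omega

/-- An interval between two intervals of the same length is covered by them if they overlap. -/
theorem cover_between [NeZero m] (h : IsGcd m g d e o) (hl : 0 < l) (hW : W = o / l + 1)
    {lo r hi : ℤ} (h1 : bucket d e o l W lo = bucket d e o l W r)
    (h2 : bucket d e o l W hi = bucket d e o l W r)
    (h3 : coord d e o lo ≤ coord d e o r) (h4 : coord d e o r ≤ coord d e o hi) {c : ℤ}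
    (hc : 0 ≤ c) (hcl : c < l) : ∃ c', 0 ≤ c' ∧ c' < l ∧
      ((r : ZMod m) + c * g = lo + c' * g ∨ (r : ZMod m) + c * g = hi + c' * g) := by
  have h5 := (bucket_eq h hl hW h1).1
  have h6 := (bucket_eq h hl hW h2).1
  have h7 := (bucket_eq h hl hW (h2.trans h1.symm)).2
  have e1 := h.coord_eq lo
  have e2 := h.coord_eq r
  have e3 := h.coord_eq hi
  rw [h5] at e1
  rw [h6] at e3
  -- The point is either still within reach of the lower interval or, since the two extreme starting
  -- points differ by less than `l`, already past the upper one.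
  by_cases hlt : coord d e o r - coord d e o lo + c < l
  · refine ⟨coord d e o r - coord d e o lo + c, by omega, hlt, .inl ?_⟩
    push_cast
    linear_combination e2 - e1
  · refine ⟨coord d e o r + c - coord d e o hi, by omega, by omega, .inr ?_⟩
    push_cast
    linear_combination e2 - e3

namespace IsTable

variable {Y Y' : Set (ZMod m)} {Lo Hi Lo' Hi' : ℤ → ℤ}

/-- A table remains valid for a larger set as long as the intervals that start in the larger set
reach no new residues. -/
theorem mono (h : IsTable m g d e o l W Z Y Lo Hi) (hY : Y ⊆ Y')
    (hcov : ∀ y ∈ Y', ∀ c : ℤ, 0 ≤ c → c < l → ∃ y' ∈ Y, ∃ c' : ℤ, 0 ≤ c' ∧ c' < l ∧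
      y + c * g = y' + c' * g) : IsTable m g d e o l W Z Y' Lo Hi :=
  { h with
    mem := fun i h0 h1 h2 => ⟨hY (h.mem i h0 h1 h2).1, hY (h.mem i h0 h1 h2).2⟩
    cover := fun y hy c hc hcl => by
      obtain ⟨y', hy', c', h0, h1, h2⟩ := hcov y hy c hc hcl
      rw [h2]
      exact h.cover y' hy' c' h0 h1 }

/-- Only the extreme coordinates of a bucket are kept. The new extremes enclose `r` as well as the
old extremes, so by `cover_between` the intervals of all discarded starting points stay covered. -/
theorem insert [NeZero m] (h : IsTable m g d e o l W Z Y Lo Hi) (hg : IsGcd m g d e o) (hl : 0 < l)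
    (hW : W = o / l + 1) (hZ : Z = d * W) {r : ℤ} (hr0 : 0 ≤ r) (hrm : r < m)
    (hLo : ∀ i, Lo' i = if i = bucket d e o l W r ∧
      (Lo i < 0 ∨ coord d e o r < coord d e o (Lo i)) then r else Lo i)
    (hHi : ∀ i, Hi' i = if i = bucket d e o l W r ∧
      (Lo i < 0 ∨ coord d e o (Hi i) < coord d e o r) then r else Hi i) :
    IsTable m g d e o l W Z (Insert.insert (r : ZMod m) Y) Lo' Hi' := by
  obtain ⟨hβ0, hβ1⟩ := bucket_bounds hg hl hW r
  rw [← hZ] at hβ1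
  set β := bucket d e o l W r with hβ
  have hne : ∀ i, i ≠ β → Lo' i = Lo i ∧ Hi' i = Hi i := fun i hi => by
    rw [hLo, hHi]; simp [hi]
  have hLβ := hLo β
  have hHβ := hHi β
  simp only [true_and] at hLβ hHβ
  -- the new bucket of `r`
  have hnew : 0 ≤ Lo' β ∧ (Lo' β = r ∨ 0 ≤ Lo β ∧ Lo' β = Lo β) ∧
      (Hi' β = r ∨ 0 ≤ Lo β ∧ Hi' β = Hi β) ∧ coord d e o (Lo' β) ≤ coord d e o r ∧
      coord d e o r ≤ coord d e o (Hi' β) ∧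
      (0 ≤ Lo β → coord d e o (Lo' β) ≤ coord d e o (Lo β) ∧
        coord d e o (Hi β) ≤ coord d e o (Hi' β)) := by
    by_cases h0 : Lo β < 0
    · rw [if_pos (.inl h0)] at hLβ hHβ
      rw [hLβ, hHβ]
      exact ⟨hr0, .inl rfl, .inl rfl, le_rfl, le_rfl, fun h => by omega⟩
    · simp only [h0, false_or] at hLβ hHβ
      push Not at h0
      split_ifs at hLβ hHβ with h1 h2 h2 <;> rw [hLβ, hHβ] <;> simp [hr0, h0] <;> omega
  obtain ⟨n1, n2, n3, n4, n5, n6⟩ := hnew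
  have b1 : bucket d e o l W (Lo' β) = β := by
    rcases n2 with n2 | ⟨n0, n2⟩ <;> rw [n2]
    exact h.lo_bucket β hβ0 hβ1 n0
  have b2 : bucket d e o l W (Hi' β) = β := by
    rcases n3 with n3 | ⟨n0, n3⟩ <;> rw [n3]
    exact h.hi_bucket β hβ0 hβ1 n0
  have case : ∀ {p : ℤ → Prop}, p β → (∀ i, i ≠ β → p i) → ∀ i, p i := fun {p} h1 h2 i => by
    by_cases hi : i = β
    · rw [hi]; exact h1
    · exact h2 i hi
  refine ⟨?_, ?_, ?_, ?_, ?_, ?_, ?_, ?_, ?_⟩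
  · refine case (fun _ _ _ => ⟨?_, ?_⟩) fun i hi h0 h1 h2 => ?_
    · rcases n2 with n2 | ⟨n0, n2⟩ <;> rw [n2]
      · exact .inl rfl
      · exact .inr (h.mem β hβ0 hβ1 n0).1
    · rcases n3 with n3 | ⟨n0, n3⟩ <;> rw [n3]
      · exact .inl rfl
      · exact .inr (h.mem β hβ0 hβ1 n0).2
    · rw [(hne i hi).1, (hne i hi).2] at *
      exact ⟨.inr (h.mem i h0 h1 h2).1, .inr (h.mem i h0 h1 h2).2⟩
  · rintro y (rfl | hy) c hc hcl
    · obtain ⟨c', h0, h1, h2⟩ := cover_between hg hl hW b1 b2 n4 n5 hc hcl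
      exact ⟨β, hβ0, hβ1, n1, c', h0, h1, h2⟩
    · obtain ⟨i, h0, h1, h2, c', h3, h4, h5⟩ := h.cover y hy c hc hcl
      by_cases hi : i = β
      · subst hi
        have hLH := h.le _ h0 h1 h2
        rcases h5 with h5 | h5 <;> rw [h5]
        · obtain ⟨c'', g0, g1, g2⟩ := cover_between hg hl hW
            (b1.trans (h.lo_bucket _ h0 h1 h2).symm) (b2.trans (h.lo_bucket _ h0 h1 h2).symm)
            (n6 h2).1 (hLH.trans (n6 h2).2) h3 h4
          exact ⟨_, h0, h1, n1, c'', g0, g1, g2⟩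
        · obtain ⟨c'', g0, g1, g2⟩ := cover_between hg hl hW
            (b1.trans (h.hi_bucket _ h0 h1 h2).symm) (b2.trans (h.hi_bucket _ h0 h1 h2).symm)
            ((n6 h2).1.trans hLH) (n6 h2).2 h3 h4
          exact ⟨_, h0, h1, n1, c'', g0, g1, g2⟩
      · refine ⟨i, h0, h1, by rw [(hne i hi).1]; exact h2, c', h3, h4, ?_⟩
        rw [(hne i hi).1, (hne i hi).2]
        exact h5
  · refine case (fun _ _ => ?_) fun i hi => by rw [(hne i hi).1]; exact h.lo_lt i
    rcases n2 with n2 | ⟨n0, n2⟩ <;> rw [n2]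
    · exact hrm
    · exact h.lo_lt β hβ0 hβ1
  · refine case (fun _ _ => by omega) fun i hi => by rw [(hne i hi).1]; exact h.neg_one_le i
  · refine case (fun _ _ => ?_) fun i hi => by rw [(hne i hi).2]; exact h.hi_nonneg i
    rcases n3 with n3 | ⟨n0, n3⟩ <;> rw [n3]
    · omega
    · exact h.hi_nonneg β hβ0 hβ1
  · refine case (fun _ _ => ?_) fun i hi => by rw [(hne i hi).2]; exact h.hi_lt i
    rcases n3 with n3 | ⟨n0, n3⟩ <;> rw [n3]
    · exact hrm
    · exact h.hi_lt β hβ0 hβ1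
  · exact case (fun _ _ _ => b1) fun i hi => by rw [(hne i hi).1]; exact h.lo_bucket i
  · exact case (fun _ _ _ => b2) fun i hi => by
      rw [(hne i hi).1, (hne i hi).2]; exact h.hi_bucket i
  · exact case (fun _ _ _ => n4.trans n5) fun i hi => by
      rw [(hne i hi).1, (hne i hi).2]; exact h.le i

end IsTable

end Residues

/-! ### Loop schemes -/

namespace Cmd

/-- `acc := ∑ e`, where the counter `i` runs from `0` to `var b - 1`. -/
def sum (acc i b : ℕ) (e : Expr) : Cmd :=
  assign acc 0 ;; forLoop i b (assign acc (.var acc + e))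

/-- Puts a value of the counter `i` that passes the test `g` into `t`, or `var b` if there is
none. -/
def find (t i b : ℕ) (g : Test) : Cmd :=
  assign t (.var b) ;; forLoop i b (ite g (assign t (.var i)) skip)

/-- Lowers `t` to the least value of `e` at a value of the counter `i` that passes the test `g`. -/
def minimize (t i b : ℕ) (g : Test) (e : Expr) : Cmd :=
  forLoop i b (ite (.and g (.lt e (.var t))) (assign t e) skip)

end Cmd

namespace Run

variable {H X : ℕ} {s : Store}

/-- Injectivity of the positions keeps later writes from destroying earlier ones. The premise about
cells not yet written permits updates in place, where `e` reads the array being filled. -/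
theorem fill {i b a : ℕ} {pos e : Expr} (N : ℕ) (hb : s.var b = N) (hN : N ≤ X)
    (hi : i < 64) (hb' : b < 64) (hib : b ≠ i) (hcp : pos.cost ≤ 64) (hce : e.cost ≤ 64)
    (π f : ℕ → ℤ) (hπ : ∀ j, j < N → ∀ j', j' < N → π j = π j' → j = j')
    (h : ∀ j, j < N → ∀ s', Frame (.forLoop i b (.write a pos e)) s s' → s'.var i = j →
      (∀ p, (∀ j', j' < j → p ≠ π j') → s'.arr a p = s.arr a p) →
      pos.Ok H s' ∧ e.Ok H s' ∧ pos.eval s' = π j ∧ e.eval s' = f j) :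
    Run H X (.forLoop i b (.write a pos e)) s fun s' => (∀ j, j < N → s'.arr a (π j) = f j) ∧
      ∀ p, (∀ j, j < N → p ≠ π j) → s'.arr a p = s.arr a p := by
  refine forLoop N hb hN hi hb' rfl rfl hib (fun j s' => (∀ j', j' < j → s'.arr a (π j') = f j') ∧
    ∀ p, (∀ j', j' < j → p ≠ π j') → s'.arr a p = s.arr a p) (by simp) ?_ fun s' _ h => h
  rintro j hj s' hF hij ⟨h1, h2⟩
  obtain ⟨o1, o2, e1, e2⟩ := h j hj s' hF hij h2
  refine write hcp hce o1 o2 ?_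
  simp only [Store.arr_setVar, Store.arr_setArr, if_true, e1, e2]
  refine ⟨fun j' hj' => ?_, fun p hp => ?_⟩
  · split_ifs with hπj
    · rw [hπ j' (by omega) j hj hπj]
    · refine h1 j' ?_
      have : j' ≠ j := fun h => hπj (by rw [h])
      omega
  · rw [if_neg (hp j (by omega))]
    exact h2 p fun j' hj' => hp j' (by omega)

/-- The accumulator is a variable and so has to stay within `H`; `N * M` bounds every partial sum.
-/
theorem sum {acc i b : ℕ} {e : Expr} (N : ℕ) (hb : s.var b = N) (hN : N ≤ X)
    (hi : i < 64) (hb' : b < 64) (ha : acc < 64) (hib : b ≠ i) (hai : i ≠ acc) (hab : b ≠ acc)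
    (hce : e.cost ≤ 62) (f : ℕ → ℤ) (M : ℤ) (hM : ∀ j, j < N → |f j| ≤ M) (hNM : N * M ≤ H)
    (h : ∀ j, j < N → ∀ s', Frame (.sum acc i b e) s s' → s'.var i = j →
      e.Ok H s' ∧ e.eval s' = f j) :
    Run H X (.sum acc i b e) s fun s' => s'.var acc = ∑ j ∈ Finset.range N, f j := by
  have hka : Cmd.keepsVar i (.assign acc (.var acc + e)) = true := by simp [Cmd.keepsVar, hai]
  have hkb : Cmd.keepsVar b (.assign acc (.var acc + e)) = true := by simp [Cmd.keepsVar, hab]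
  refine seq (assign (Nat.le_of_ble_eq_true rfl) Expr.ok_zero (by simp [Within]) ?_)
  refine forLoop N (by simp [hab, hb]) hN hi hb' hka hkb hib
    (fun j s' => s'.var acc = ∑ j ∈ Finset.range j, f j) ?_ ?_ fun s' _ h => h
  · simp [Ne.symm hai]
  · intro j hj s' hF hij hI
    have hF' : Frame (.sum acc i b e) s s' := by
      refine ⟨fun l hl => ?_, fun a ha => hF.arr a ?_⟩
      · simp only [Cmd.sum, Cmd.keepsVar, Bool.and_eq_true] at hl
        have hla : l ≠ acc := by simpa using hl.1
        rw [hF.var l hl.2]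
        simp [hla]
      · simpa only [Cmd.sum, Cmd.keepsArr, Bool.and_eq_true, true_and] using ha
    obtain ⟨o, e1⟩ := h j hj s' hF' hij
    have hpart : |∑ j ∈ Finset.range (j + 1), f j| ≤ H := by
      have hM0 : 0 ≤ M := (abs_nonneg _).trans (hM j hj)
      calc |∑ j ∈ Finset.range (j + 1), f j| ≤ ∑ j ∈ Finset.range (j + 1), |f j| :=
            Finset.abs_sum_le_sum_abs _ _
        _ ≤ ∑ j ∈ Finset.range (j + 1), M := Finset.sum_le_sum fun l hl =>
            hM l (by have := Finset.mem_range.1 hl; omega)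
        _ = (j + 1 : ℕ) * M := by simp
        _ ≤ N * M := by gcongr; exact_mod_cast hj
        _ ≤ H := hNM
    have hval : (Expr.var acc + e).eval s' = ∑ j ∈ Finset.range (j + 1), f j := by
      rw [Expr.eval_add, Expr.eval_var, hI, e1, Finset.sum_range_succ]
    refine assign ?_ ⟨ha, o⟩ ?_ ?_
    · change 1 + e.cost + 1 ≤ 64
      omega
    · rw [hval]
      exact abs_le.1 hpart
    · rw [hval]
      simp [Ne.symm hai]

theorem find {t i b : ℕ} {g : Test} (N : ℕ) (hb : s.var b = N) (hN : N ≤ X)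
    (hi : i < 64) (hb' : b < 64) (hib : b ≠ i) (hti : i ≠ t) (htb : b ≠ t)
    (hcg : g.cost ≤ 64) (φ : ℕ → Prop)
    (h : ∀ j, j < N → ∀ s', Frame (.find t i b g) s s' → s'.var i = j →
      g.Ok H s' ∧ (g.Holds s' ↔ φ j)) :
    Run H X (.find t i b g) s fun s' => (s'.var t = N ∧ ∀ j, j < N → ¬ φ j) ∨
      ∃ j, j < N ∧ s'.var t = j ∧ φ j := by
  refine of_small fun h2 hsm => ?_
  have hNH : (N : ℤ) ≤ H := hb ▸ (hsm b hb').2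
  have hki : Cmd.keepsVar i (.ite g (.assign t (.var i)) .skip) = true := by
    simp [Cmd.keepsVar, hti]
  have hkb : Cmd.keepsVar b (.ite g (.assign t (.var i)) .skip) = true := by
    simp [Cmd.keepsVar, htb]
  refine seq (assign (Nat.le_of_ble_eq_true rfl) hb' (hsm b hb') ?_)
  refine forLoop N (by simp [htb, hb]) hN hi hb' hki hkb hib
    (fun j s' => (s'.var t = N ∧ ∀ j', j' < j → ¬ φ j') ∨ ∃ j', j' < j ∧ s'.var t = j' ∧ φ j')
    ?_ ?_ fun s' _ h => h
  · left
    simp [Ne.symm hti, hb]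
  · intro j hj s' hF hij hI
    have hF' : Frame (.find t i b g) s s' := by
      refine ⟨fun l hl => ?_, fun a ha => hF.arr a ?_⟩
      · simp only [Cmd.find, Cmd.keepsVar, Bool.and_eq_true] at hl
        have hla : l ≠ t := by simpa using hl.1
        rw [hF.var l hl.2]
        simp [hla]
      · simpa only [Cmd.find, Cmd.keepsArr, Bool.and_eq_true, true_and] using ha
    obtain ⟨o, hφ⟩ := h j hj s' hF' hij
    refine ite hcg o (fun hg => ?_) fun hg => skip ?_
    · refine assign (Nat.le_of_ble_eq_true rfl) hi ?_ (.inr ⟨j, by omega, ?_, hφ.1 hg⟩)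
      · rw [Expr.eval_var, hij]
        constructor <;> omega
      · simp [Ne.symm hti, hij]
    · rw [hφ] at hg
      rcases hI with ⟨h1, h2⟩ | ⟨j', h1, h2, h3⟩
      · refine .inl ⟨by simp [Ne.symm hti, h1], fun j' hj' => ?_⟩
        rcases Nat.lt_succ_iff_lt_or_eq.1 hj' with h | rfl
        · exact h2 j' h
        · exact hg
      · exact .inr ⟨j', by omega, by simp [Ne.symm hti, h2], h3⟩

theorem minimize {t i b : ℕ} {g : Test} {e : Expr} (N : ℕ) (hb : s.var b = N) (hN : N ≤ X)
    (hi : i < 64) (hb' : b < 64) (ht : t < 64) (hib : b ≠ i) (hti : i ≠ t) (htb : b ≠ t)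
    (hcg : (Test.and g (.lt e (.var t))).cost ≤ 64) (hce : e.cost ≤ 64) (φ : ℕ → Prop) (f : ℕ → ℤ)
    (hf : ∀ j, j < N → Within H (f j))
    (h : ∀ j, j < N → ∀ s', Frame (.minimize t i b g e) s s' → s'.var i = j →
      g.Ok H s' ∧ (g.Holds s' ↔ φ j) ∧ e.Ok H s' ∧ e.eval s' = f j) :
    Run H X (.minimize t i b g e) s fun s' => s'.var t ≤ s.var t ∧
      (∀ j, j < N → φ j → s'.var t ≤ f j) ∧
      (s'.var t = s.var t ∨ ∃ j, j < N ∧ φ j ∧ s'.var t = f j) := by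
  have hki : Cmd.keepsVar i (.ite (.and g (.lt e (.var t))) (.assign t e) .skip) = true := by
    simp [Cmd.keepsVar, hti]
  have hkb : Cmd.keepsVar b (.ite (.and g (.lt e (.var t))) (.assign t e) .skip) = true := by
    simp [Cmd.keepsVar, htb]
  refine forLoop N hb hN hi hb' hki hkb hib
    (fun j s' => s'.var t ≤ s.var t ∧ (∀ j', j' < j → φ j' → s'.var t ≤ f j') ∧
      (s'.var t = s.var t ∨ ∃ j', j' < j ∧ φ j' ∧ s'.var t = f j')) ?_ ?_ fun s' _ h => h
  · simp [Ne.symm hti]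
  · rintro j hj s' hF hij ⟨h1, h2, h3⟩
    obtain ⟨o1, hφ, o2, hfe⟩ := h j hj s' hF hij
    refine ite hcg ⟨o1, ht, o2⟩ (fun hg => ?_) fun hg => skip ?_
    · have hg2 := hg.2
      rw [Test.holds_lt, hfe, Expr.eval_var] at hg2
      refine assign hce o2 (hfe ▸ hf j hj) ?_
      simp only [Store.var_setVar, if_neg (Ne.symm hti), if_true, hfe]
      refine ⟨by omega, fun j' hj' hφ' => ?_, .inr ⟨j, by omega, hφ.1 hg.1, rfl⟩⟩
      rcases Nat.lt_succ_iff_lt_or_eq.1 hj' with h | rfl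
      · have := h2 j' h hφ'
        omega
      · rfl
    · simp only [Test.holds_and, Test.holds_lt, hfe, Expr.eval_var, hφ] at hg
      simp only [Store.var_setVar, if_neg (Ne.symm hti)]
      refine ⟨h1, fun j' hj' hφ' => ?_, h3.imp_right fun ⟨j', h4, h5⟩ => ⟨j', by omega, h5⟩⟩
      rcases Nat.lt_succ_iff_lt_or_eq.1 hj' with h | rfl
      · exact h2 j' h hφ'
      · by_contra hc
        exact hg ⟨hφ', by omega⟩

end Run

/-! ### The program: conformal decomposition

Variables: `0` and `1` numbers of rows and columns, `4` their sum, `5` number of vectors found,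
`8`, `9`, `10` counters, `11` pivot column, `12` column of the direction, `13` its sign, `14` row
that shows that it is not conformal, `15` step length.
Arrays: `8` tableau, `9` remaining vector (its products with all rows), `10` point of the walk,
`11` frozen columns, `12` vectors found, `13` their multiplicities, `19` pivot row. -/

theorem Within.of_abs_le {H : ℕ} {z M : ℤ} (h : |z| ≤ M) (hM : M ≤ H) : Within H z :=
  abs_le.1 (h.trans hM)

theorem flat_inj {n i i' j j' : ℕ} (hj : j < n) (hj' : j' < n) :
    (i : ℤ) * n + j = i' * n + j' ↔ i = i' ∧ j = j' := by
  constructor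
  · intro h
    have h : i * n + j = i' * n + j' := by exact_mod_cast h
    have h1 : (i * n + j) / n = (i' * n + j') / n := by rw [h]
    have h2 : (i * n + j) % n = (i' * n + j') % n := by rw [h]
    rw [mul_comm i, mul_comm i', Nat.mul_add_div (by omega), Nat.mul_add_div (by omega),
      Nat.div_eq_of_lt hj, Nat.div_eq_of_lt hj'] at h1
    rw [mul_comm i, mul_comm i', Nat.mul_add_mod, Nat.mul_add_mod, Nat.mod_eq_of_lt hj,
      Nat.mod_eq_of_lt hj'] at h2
    exact ⟨by omega, h2⟩
  · rintro ⟨rfl, rfl⟩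
    rfl

/-- The matrix with `n` columns that is stored row by row in an array. -/
def mat (n : ℕ) (f : ℤ → ℤ) : ℕ → Fin n → ℤ := fun i j => f ((i : ℤ) * n + ((j : ℕ) : ℤ))

namespace Proximity

/-- The entry of a matrix in the row `var i` and the column `var j`. -/
abbrev cell (a i j : ℕ) : Expr := .arr a (.var i * .var 1 + .var j)

/-- Row `var 8` is copied to array 19, as it is itself overwritten during the update. In the copy
the pivot entry is lowered by one: since it is `±1`, the update formula of the other columns then
gives the right result in the pivot column too, and no case distinction is needed. -/
def pivot : Cmd :=
  .assign 18 (cell 8 8 11) ;;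
  .forLoop 9 1 (.write 19 (.var 9) (cell 8 8 9)) ;;
  .write 19 (.var 11) (.var 18 - 1) ;;
  .forLoop 10 4
    (.assign 17 (cell 8 10 11 * .var 18) ;;
      .forLoop 9 1 (.write 8 (.var 10 * .var 1 + .var 9)
        (cell 8 10 9 - .arr 19 (.var 9) * .var 17)))

def freezeRow : Cmd :=
  .ite (.eq (.arr 10 (.var 8)) 0)
    (.find 11 9 1 (.and (.eq (.arr 11 (.var 9)) 0) (.not (.eq (cell 8 8 9) 0))) ;;
      .ite (.lt (.var 11) (.var 1)) (pivot ;; .write 11 (.var 11) 1) .skip)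
    .skip

def freeze : Cmd :=
  .forLoop 9 1 (.write 11 (.var 9) 0) ;; .forLoop 8 4 freezeRow

structure Dims (k n : ℕ) (s : Store) : Prop where
  rows : s.var 0 = k
  cols : s.var 1 = n
  height : s.var 4 = ((k + n : ℕ) : ℤ)

theorem Dims.of_frame {k n : ℕ} {c : Cmd} {s s' : Store} (h : Dims k n s) (hF : Frame c s s')
    (h0 : c.keepsVar 0 = true) (h1 : c.keepsVar 1 = true) (h4 : c.keepsVar 4 = true) :
    Dims k n s' :=
  ⟨(hF.var 0 h0).trans h.rows, (hF.var 1 h1).trans h.cols, (hF.var 4 h4).trans h.height⟩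

variable {H X k n : ℕ} {s : Store}

theorem pivot_run (hd : Dims k n s) (hX : k + n ≤ X) {i : ℕ} (hi : i < k + n) {p : Fin n}
    (h8 : s.var 8 = i) (h11 : s.var 11 = (p : ℕ))
    (hA : ∀ r, r < k + n → ∀ j, |mat n (s.arr 8) r j| ≤ 1) (hp : mat n (s.arr 8) i p ≠ 0) :
    Run H X pivot s fun s' => ∀ r, r < k + n → ∀ j, mat n (s'.arr 8) r j =
      if j = p then mat n (s.arr 8) r p * mat n (s.arr 8) i p
      else mat n (s.arr 8) r j - mat n (s.arr 8) i j *
        (mat n (s.arr 8) r p * mat n (s.arr 8) i p) := by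
  refine Run.of_small fun h2 _ => ?_
  have hW : ∀ r, r < k + n → ∀ j, Within H (mat n (s.arr 8) r j) := fun r hr j =>
    .of_abs_le (hA r hr j) (by omega)
  set A := mat n (s.arr 8) with hAdef
  have hA' : ∀ (r : ℕ) (j : Fin n), s.arr 8 (r * n + ((j : ℕ) : ℤ)) = A r j := fun _ _ => rfl
  have hmulW : ∀ r, r < k + n → Within H (A r p * A i p) := by
    intro r hr
    refine .of_abs_le (M := 1) ?_ (by omega)
    rw [abs_mul]
    exact mul_le_one₀ (hA r hr p) (abs_nonneg _) (hA i hi p)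
  have hsq : A i p * A i p = 1 := by
    have := hA i hi p
    have h1 : A i p = 1 ∨ A i p = -1 := by rw [abs_le] at this; omega
    rcases h1 with h1 | h1 <;> rw [h1] <;> norm_num
  refine Run.seq (Run.assign (by decide) ?_ ?_ ?_)
  · simp [h8, h11, hd.cols, hA', hW i hi p]
  · simp [h8, h11, hd.cols, hA', hW i hi p]
  have hs1 : (cell 8 8 11).eval s = A i p := by simp [h8, h11, hd.cols, hA']
  rw [hs1]
  refine Run.seq_of (Run.fill (N := n) (by simp [hd.cols]) (by omega) (by decide) (by decide)
    (by decide) (by decide) (by decide) (fun j => (j : ℤ))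
    (fun j => s.arr 8 (i * n + j)) (fun j _ j' _ h => by exact_mod_cast h) ?_) ?_
  · intro j hj s' hF hj9 _
    have e8 := hF.arr 8 rfl
    have v8 := hF.var 8 rfl
    have v1 := hF.var 1 rfl
    simp only [Store.var_setVar, Store.arr_setVar] at e8 v8 v1
    simp [e8, v8, v1, hj9, h8, hd.cols]
    exact hW i hi ⟨j, hj⟩
  rintro s1 hF1 ⟨hrow, -⟩
  have e8 := hF1.arr 8 rfl
  have v18 := hF1.var 18 rfl
  have v11 := hF1.var 11 rfl
  simp only [Store.var_setVar, Store.arr_setVar] at e8 v18 v11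
  simp only [if_true] at v18
  refine Run.seq (Run.write (by decide) (by decide) (by simp) (by simp) ?_)
  have hev : (Expr.var 18 - 1).eval s1 = A i p - 1 := by simp [v18]
  rw [hev, show (Expr.var 11).eval s1 = (p : ℕ) by simp [v11, h11]]
  have hrow' : ∀ j : Fin n, (s1.setArr 19 (p : ℕ) (A i p - 1)).arr 19 (j : ℕ) =
      if j = p then A i p - 1 else A i j := by
    intro j
    simp only [Store.arr_setArr, if_true, Nat.cast_inj, Fin.val_inj]
    split_ifs
    · rfl
    · exact hrow j j.2
  set s2 := s1.setArr 19 (p : ℕ) (A i p - 1) with hs2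
  have c8 : s2.arr 8 = s.arr 8 := by simp [hs2, e8]
  have c18 : s2.var 18 = A i p := by simp [hs2, v18]
  have c11 : s2.var 11 = (p : ℕ) := by simp [hs2, v11, h11]
  have hrowW : ∀ j : Fin n, Within H (s2.arr 19 (j : ℕ)) := by
    intro j
    rw [hrow' j]
    have := abs_le.1 (hA i hi p)
    split_ifs
    · constructor <;> omega
    · exact hW i hi j
  have d2 : Dims k n s2 := ⟨by simpa [hs2, hd.rows] using hF1.var 0 rfl,
    by simpa [hs2, hd.cols] using hF1.var 1 rfl, by simpa [hs2, hd.height] using hF1.var 4 rfl⟩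
  clear_value s2
  clear hs2 hrow e8 v18 v11 hF1 hev
  refine Run.forLoop (k + n) d2.height (by omega) (by decide) (by decide) rfl rfl (by decide)
    (fun r s' => ∀ r', r' < k + n → ∀ j, mat n (s'.arr 8) r' j = if r' < r then
      (if j = p then A r' p * A i p else A r' j - A i j * (A r' p * A i p)) else A r' j) ?_ ?_ ?_
  · intro r' _ j
    simp [mat, c8, A]
  · intro r hr s' hF hr10 hI
    have d' := d2.of_frame hF rfl rfl rfl
    have b18 := (hF.var 18 rfl).trans c18
    have b11 := (hF.var 11 rfl).trans c11
    have b19 := hF.arr 19 rfl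
    have hrj : ∀ j : Fin n, s'.arr 8 (r * n + ((j : ℕ) : ℤ)) = A r j := fun j => by
      have := hI r hr j
      rwa [if_neg (lt_irrefl r)] at this
    refine Run.seq (Run.assign (by decide) ?_ ?_ ?_)
    · simp [hr10, b11, d'.cols, hrj, hW r hr p]
    · simp only [Expr.eval_mul, Expr.eval_arr, Expr.eval_add, Expr.eval_var, hr10, b11, d'.cols,
        hrj, b18]
      exact hmulW r hr
    have hcv : (cell 8 10 11 * Expr.var 18).eval s' = A r p * A i p := by
      simp [hr10, b11, d'.cols, hrj, b18]
    rw [hcv]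
    refine (Run.fill (N := n) (by simp [d'.cols]) (by omega) (by decide) (by decide)
      (by decide) (by decide) (by decide) (fun j => (r : ℤ) * n + j)
      (fun j => if h : j < n then (if (⟨j, h⟩ : Fin n) = p then A r p * A i p
        else A r ⟨j, h⟩ - A i ⟨j, h⟩ * (A r p * A i p)) else 0)
      (fun j _ j' _ h => by omega) ?_).mono ?_
    · intro j hj s'' hF' hj9 hold
      have v10 := hF'.var 10 rfl
      have v1 := hF'.var 1 rfl
      have v17 := hF'.var 17 rfl
      have a19 := hF'.arr 19 rfl
      simp only [Store.var_setVar, Store.arr_setVar] at v10 v1 v17 a19 hold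
      simp only [if_true] at v17
      have hcell : s''.arr 8 (r * n + (j : ℤ)) = A r ⟨j, hj⟩ := by
        rw [hold]
        · exact hrj ⟨j, hj⟩
        · intro j' hj'
          omega
      have h19 := hrow' ⟨j, hj⟩
      have h19W := hrowW ⟨j, hj⟩
      simp [v10, v1, v17, a19, hj9, hr10, d'.cols, hcell, b19, hj]
      refine ⟨⟨hW r hr _, h19W⟩, ?_⟩
      simp only at h19
      rw [h19]
      split_ifs with hjp
      · rw [hjp]
        -- With `ε = A i p` and `ε² = 1`: `A r p - (ε - 1) * (A r p * ε) = A r p * ε`.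
        linear_combination (-(A r p)) * hsq
      · rfl
    · rintro s'' hF' ⟨hnew, hold⟩ r' hr' j
      simp only [mat, Store.arr_setVar] at hI ⊢
      by_cases hrr : r' = r
      · subst hrr
        have := hnew j j.2
        rw [this]
        simp
      · have h1 : r' < r + 1 ↔ r' < r := by omega
        simp only [h1]
        rw [← hI r' hr' j]
        simp only [Store.arr_setVar] at hold
        exact hold _ fun j' hj' h => hrr ((flat_inj j.2 hj').1 h).1
  · intro s' _ hI r hr j
    rw [hI r hr j, if_pos hr]

/-- The columns that are marked in the array `11`. -/
def frozen (n : ℕ) (s : Store) : Fin n → Prop := fun j => s.arr 11 ((j : ℕ) : ℤ) ≠ 0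

/-- One pass over the rows brings into the basis as many rows as possible in which the vector in
array 10 vanishes; every column still free afterwards vanishes in all such rows. -/
theorem freeze_run {T : Matrix (Fin k) (Fin n) ℤ} (hT : T.IsTotallyUnimodular) (hd : Dims k n s)
    (hX : k + n ≤ X) {lab : Fin n → ℕ} (ht : IsTableau T (mat n (s.arr 8)) lab)
    (hv : ∀ i : ℕ, i < k + n → Within H (s.arr 10 i)) :
    Run H X freeze s fun s' => ∃ lab', IsTableau T (mat n (s'.arr 8)) lab' ∧
      IsFrozen (mat n (s'.arr 8)) lab' (fun i => s'.arr 10 i) (frozen n s') (k + n) ∧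
      ∀ j : Fin n, Within H (s'.arr 11 (j : ℕ)) := by
  refine Run.of_small fun h2 _ => ?_
  refine Run.seq_of (Run.fill (N := n) hd.cols (by omega) (by decide) (by decide)
    (by decide) (by decide) (by decide) (fun j => (j : ℤ))
    (fun _ => 0) (fun j _ j' _ h => by exact_mod_cast h) ?_) ?_
  · intro j hj s' _ hj9 _
    simp [hj9]
  rintro s1 hF1 ⟨hz, -⟩
  have d1 := hd.of_frame hF1 rfl rfl rfl
  have a8 := hF1.arr 8 rfl
  have a10 := hF1.arr 10 rfl
  refine Run.forLoop (k + n) d1.height (by omega) (by decide) (by decide) rfl rfl (by decide)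
    (fun r s' => ∃ lab', IsTableau T (mat n (s'.arr 8)) lab' ∧
      IsFrozen (mat n (s'.arr 8)) lab' (fun i => s'.arr 10 i) (frozen n s') r ∧
      ∀ j : Fin n, Within H (s'.arr 11 (j : ℕ))) ?_ ?_ fun s' _ h => h
  · refine ⟨lab, ?_, ⟨fun j hj => absurd (hz j j.2) hj, fun i hi => by omega⟩, fun j => ?_⟩
    · simpa [a8] using ht
    · simp only [Store.arr_setVar, hz j j.2]
      constructor <;> omega
  · rintro r hr s' hF h8 ⟨lab', ht', hf', h11⟩
    have d' := d1.of_frame hF rfl rfl rfl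
    have b10 : s'.arr 10 = s.arr 10 := (hF.arr 10 rfl).trans a10
    have hAW : ∀ r, r < k + n → ∀ j, |mat n (s'.arr 8) r j| ≤ 1 := fun r hr j =>
      ht'.abs_le_one hT hr j
    refine Run.ite (by decide) ?_ (fun h0 => ?_) fun h0 => Run.skip ⟨lab', ?_⟩
    · simp [h8, b10, hv r hr]
    · simp only [Test.holds_eq, Expr.eval_arr, Expr.eval_var, Expr.eval_zero, h8] at h0
      refine Run.seq_of (Run.find n d'.cols (by omega) (by decide) (by decide) (by decide)
        (by decide) (by decide) (by decide)
        (fun j => s'.arr 11 j = 0 ∧ s'.arr 8 (r * n + j) ≠ 0) ?_) ?_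
      · intro j hj s'' hF' hj9
        have w8 := hF'.var 8 rfl
        have w1 := hF'.var 1 rfl
        have c8 := hF'.arr 8 rfl
        have c11 := hF'.arr 11 rfl
        simp [w8, w1, c8, c11, hj9, h8, d'.cols]
        exact ⟨h11 ⟨j, hj⟩, .of_abs_le (hAW r hr ⟨j, hj⟩) (by omega)⟩
      · intro s2 hF2 hcase
        have d2 := d'.of_frame hF2 rfl rfl rfl
        have c8 := hF2.arr 8 rfl
        have c10 := hF2.arr 10 rfl
        have c11 := hF2.arr 11 rfl
        have w8 := (hF2.var 8 rfl).trans h8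
        refine Run.ite (by decide) (by simp) (fun hlt => ?_) fun hlt => Run.skip ?_
        · simp only [Test.holds_lt, Expr.eval_var, d2.cols] at hlt
          obtain ⟨p, hp, hp11, hp0, hpA⟩ : ∃ j : ℕ, j < n ∧ s2.var 11 = j ∧ s'.arr 11 j = 0 ∧
              s'.arr 8 (r * n + j) ≠ 0 := by
            rcases hcase with ⟨h, -⟩ | h
            · omega
            · exact h
          refine Run.seq_of (pivot_run (p := ⟨p, hp⟩) d2 hX hr w8 hp11 (by rw [c8]; exact hAW)
            (by rw [c8]; exact hpA)) ?_
          intro s3 hF3 hA3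
          rw [c8] at hA3
          have w11 := (hF3.var 11 rfl).trans hp11
          have e10 := (hF3.arr 10 rfl).trans c10
          have e11 := (hF3.arr 11 rfl).trans c11
          refine Run.write (by decide) (by decide) (by simp) (by simp) ?_
          have hfz : frozen n ((s3.setArr 11 ((Expr.var 11).eval s3) (Expr.eval s3 1)).setVar 8
              ((r + 1 : ℕ) : ℤ)) = fun j => j = ⟨p, hp⟩ ∨ frozen n s' j := by
            funext j
            simp only [frozen, Store.arr_setVar, Store.arr_setArr, if_true, Expr.eval_var, w11,
              Nat.cast_inj, Expr.eval_one, e11, eq_iff_iff, Fin.ext_iff]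
            by_cases hj : (j : ℕ) = p <;> simp [hj]
          rw [hfz]
          refine ⟨Function.update lab' ⟨p, hp⟩ r, ?_, ?_, ?_⟩
          · simpa using ht'.pivot hT hr (p := ⟨p, hp⟩) hpA hA3
          · simpa [e10] using hf'.pivot ht' hT hr h0 (p := ⟨p, hp⟩) (fun h => h hp0) hpA hA3
              (F' := fun j => j = ⟨p, hp⟩ ∨ frozen n s' j) fun _ => Iff.rfl
          · intro j
            simp only [Store.arr_setVar, Store.arr_setArr, if_true, Expr.eval_var, w11,
              Expr.eval_one, e11]
            split_ifs
            · constructor <;> omega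
            · exact h11 j
        · simp only [Test.holds_lt, Expr.eval_var, d2.cols] at hlt
          have hnone : ∀ j : ℕ, j < n → ¬ (s'.arr 11 j = 0 ∧ s'.arr 8 (r * n + j) ≠ 0) := by
            rcases hcase with ⟨-, h⟩ | ⟨j, h, h', -⟩
            · exact h
            · omega
          refine ⟨lab', by simpa [c8] using ht', ?_, by simpa [c11] using h11⟩
          have : frozen n (s2.setVar 8 ((r + 1 : ℕ) : ℤ)) = frozen n s' := by
            funext j; simp [frozen, c11]
          rw [this]
          simp only [Store.arr_setVar, c8, c10]
          refine hf'.succ_of_zero fun _ j hj => ?_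
          have := hnone j j.2
          simp only [frozen, not_not] at hj
          by_contra hne
          exact this ⟨hj, hne⟩
    · simp only [Test.holds_eq, Expr.eval_arr, Expr.eval_var, Expr.eval_zero, h8] at h0
      exact ⟨ht', hf'.succ_of_zero fun h => absurd h h0, h11⟩

end Proximity

section Walk

variable {k n : ℕ}

/-- Invariant of the decomposition of `z`: `w` holds the products of the remaining vector with all
rows, `v` those of a nonzero vector that is conformal to it, and `N` vectors have been split off. -/
structure IsWalk (T : Matrix (Fin k) (Fin n) ℤ) (z : Fin n → ℤ) (V : ℤ) (r : ℕ) (w v : ℕ → ℤ)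
    (N : ℕ) (lam : ℕ → ℤ) (u : ℕ → Fin n → ℤ) : Prop where
  w_rows : ∀ i, i < k + n → w i = ∑ l : Fin n, stackRow T i l * w (k + l)
  v_rows : ∀ i, i < k + n → v i = ∑ l : Fin n, stackRow T i l * v (k + l)
  w_sign : ∀ i, i < k + n → SignLE (w i) (dotProduct (stackRow T i) z)
  v_sign : ∀ i, i < k + n → SignLE (v i) (w i)
  v_ne : (∃ i, i < k + n ∧ w i ≠ 0) → ∃ i, i < k + n ∧ v i ≠ 0
  w_le : ∀ i, i < k + n → |w i| ≤ V
  v_le : ∀ i, i < k + n → |v i| ≤ 2 ^ r * V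
  progress : (∀ i, i < k + n → w i = 0) ∨
    (k + n + 1) * suppCard (k + n) w + suppCard (k + n) v + r ≤ (k + n + 1) * (k + n + 1)
  count : N ≤ r
  lam_mem : ∀ p, p < N → 0 ≤ lam p ∧ lam p ≤ V
  elementary : ∀ p, p < N → IsElementary T (u p)
  sign : ∀ p, p < N → ∀ i, i < k + n →
    SignLE (dotProduct (stackRow T i) (u p)) (dotProduct (stackRow T i) z)
  sum : ∀ j : Fin n, z j = w (k + j) + ∑ p ∈ Finset.range N, lam p * u p j

/-- `a` holds the products with all rows of an elementary vector that vanishes where `v` does. -/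
structure IsDirection (T : Matrix (Fin k) (Fin n) ℤ) (v a : ℕ → ℤ) : Prop where
  rows : ∀ i, i < k + n → a i = ∑ l : Fin n, stackRow T i l * a (k + l)
  elementary : IsElementary T fun l => a (k + l)
  zero : ∀ i, i < k + n → v i = 0 → a i = 0

variable {T : Matrix (Fin k) (Fin n) ℤ} {z : Fin n → ℤ} {V t : ℤ} {r N : ℕ} {w v a w' v' : ℕ → ℤ}
  {lam lam' : ℕ → ℤ} {u u' : ℕ → Fin n → ℤ}

theorem IsDirection.abs_le_one (h : IsDirection T v a) (hT : T.IsTotallyUnimodular) {i : ℕ}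
    (hi : i < k + n) : |a i| ≤ 1 := by
  rw [h.rows i hi]
  exact h.elementary _ (tuAppendable_stackRow hT hi)

/-- A column that is not frozen is zero in all rows where `v` vanishes, and it is elementary as a
column of the tableau; changing its sign affects neither. -/
theorem IsTableau.isDirection {A : ℕ → Fin n → ℤ} {lab : Fin n → ℕ} {F : Fin n → Prop}
    (h : IsTableau T A lab) (hf : IsFrozen A lab v F (k + n)) {q : Fin n} (hq : ¬ F q) {σ : ℤ}
    (hσ : σ = 1 ∨ σ = -1) : IsDirection T v fun i => σ * A i q := by
  refine ⟨fun i hi => ?_, fun d hd => ?_, fun i hi h0 => by rw [hf.zero i hi h0 q hq, mul_zero]⟩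
  · rw [h.eq_sum i hi, Finset.mul_sum]
    refine Finset.sum_congr rfl fun l _ => ?_
    ring
  · have h1 := h.isElementary q d hd
    have h2 : (dotProduct d fun l : Fin n => σ * A (k + l) q) =
        σ * dotProduct d fun l : Fin n => A (k + l) q := by
      simp only [dotProduct, Finset.mul_sum]
      refine Finset.sum_congr rfl fun l _ => ?_
      ring
    rw [h2, abs_mul]
    rcases hσ with rfl | rfl <;> simpa using h1

theorem rows_sub (hv : ∀ i, i < k + n → v i = ∑ l : Fin n, stackRow T i l * v (k + l))
    (ha : ∀ i, i < k + n → a i = ∑ l : Fin n, stackRow T i l * a (k + l))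
    (hv' : ∀ i, i < k + n → v' i = v i - t * a i) {i : ℕ} (hi : i < k + n) :
    v' i = ∑ l : Fin n, stackRow T i l * v' (k + l) := by
  rw [hv' i hi, hv i hi, ha i hi, Finset.mul_sum, ← Finset.sum_sub_distrib]
  refine Finset.sum_congr rfl fun l _ => ?_
  rw [hv' _ (by omega)]
  ring

/-- The loop has a fixed number of rounds, so it may go on after the decomposition is complete. By
`v_ne` the remaining vector is zero as soon as `v` is. -/
theorem IsWalk.idle (h : IsWalk T z V r w v N lam u) (hv : ∀ i, i < k + n → v i = 0) (hV : 0 ≤ V) :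
    IsWalk T z V (r + 1) w v N lam u := by
  refine { h with
    v_le := fun i hi => (h.v_le i hi).trans ?_
    progress := .inl fun i hi => ?_
    count := by have := h.count; omega }
  · exact mul_le_mul_of_nonneg_right (pow_le_pow_right₀ (by norm_num) (by omega)) hV
  · by_contra hw
    obtain ⟨j, hj, hvj⟩ := h.v_ne ⟨i, hi, hw⟩
    exact hvj (hv j hj)

/-- The direction is not yet conformal to `v`, so `v` is shortened along it. The support of `v`
shrinks, which pays for the round in `progress`, and the row where `a` and `v` have opposite signs
keeps the new vector from being zero. -/
theorem IsWalk.advance (h : IsWalk T z V r w v N lam u) (hT : T.IsTotallyUnimodular)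
    (ha : IsDirection T v a) (ht : IsLeastPos (k + n) (fun i => a i * v i) t)
    (hv' : ∀ i, i < k + n → v' i = v i - t * a i) (hneg : ∃ i, i < k + n ∧ a i * v i < 0) :
    IsWalk T z V (r + 1) w v' N lam u := by
  have ha1 : ∀ i, i < k + n → |a i| ≤ 1 := fun i hi => ha.abs_le_one hT hi
  have hw : ¬ ∀ i, i < k + n → w i = 0 := by
    intro hw
    obtain ⟨i, hi, hit⟩ := hneg
    have := h.v_sign i hi
    rw [hw i hi] at this
    have : v i = 0 := le_antisymm (this.2 le_rfl) (this.1 le_rfl)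
    rw [this] at hit
    omega
  refine { h with
    v_rows := fun i hi => rows_sub h.v_rows ha.rows hv' hi
    v_sign := fun i hi => (ht.signLE ha1 ha.zero hv' hi).trans (h.v_sign i hi)
    v_ne := fun _ => ?_
    v_le := fun i hi => ?_
    progress := .inr ?_
    count := by have := h.count; omega }
  · obtain ⟨i, hi, hit⟩ := hneg
    refine ⟨i, hi, ?_⟩
    have h3 : a i = -1 ∨ a i = 0 ∨ a i = 1 := by have := abs_le.1 (ha1 i hi); omega
    have := ht.pos
    rw [hv' i hi]
    rcases h3 with h3 | h3 | h3 <;> rw [h3] at hit ⊢ <;> omega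
  · rw [pow_succ, mul_comm _ (2 : ℤ), mul_assoc]
    exact ht.abs_le ha1 hv' h.v_le hi
  · have := ht.suppCard_lt ha1 ha.zero hv'
    have := h.progress.resolve_left hw
    omega

/-- Where `a` is nonzero so is `v`, and there `v` has the same strict sign as `w`; so a direction
conformal to `v` is conformal to `w`. -/
theorem IsWalk.pos_iff (h : IsWalk T z V r w v N lam u) (ha : IsDirection T v a)
    (hpos : ∀ i, i < k + n → 0 ≤ a i * v i) {i : ℕ} (hi : i < k + n) : 0 ≤ a i * w i := by
  have h1 := h.v_sign i hi
  have h2 := hpos i hi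
  have h3 := ha.zero i hi
  rcases lt_trichotomy (v i) 0 with h4 | h4 | h4
  · have : a i ≤ 0 := by nlinarith
    have : w i < 0 := by by_contra hc; have := h1.1 (by omega); omega
    nlinarith
  · rw [h3 h4, zero_mul]
  · have : 0 ≤ a i := by nlinarith
    have : 0 < w i := by by_contra hc; have := h1.2 (by omega); omega
    nlinarith

/-- A conformal direction is split off from `w` with the largest possible multiplicity, and `v`
restarts at the new `w`. The support of `w` drops by at least one, which gains `k + n + 1` in
`progress`; this pays for the round and for the support of `v`, which is at most `k + n` again. -/
theorem IsWalk.record (h : IsWalk T z V r w v N lam u) (hT : T.IsTotallyUnimodular)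
    (ha : IsDirection T v a) (hpos : ∀ i, i < k + n → 0 ≤ a i * v i)
    (ht : IsLeastPos (k + n) (fun i => a i * w i) t)
    (hw' : ∀ i, i < k + n → w' i = w i - t * a i) (hv' : ∀ i, i < k + n → v' i = w i - t * a i)
    (hlam : ∀ p, p < N → lam' p = lam p) (hlamN : lam' N = t)
    (hu : ∀ p, p < N → u' p = u p) (huN : u' N = fun l : Fin n => a (k + l)) :
    IsWalk T z V (r + 1) w' v' (N + 1) lam' u' := by
  have ha1 : ∀ i, i < k + n → |a i| ≤ 1 := fun i hi => ha.abs_le_one hT hi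
  have hzero : ∀ i, i < k + n → w i = 0 → a i = 0 := by
    intro i hi h0
    have := h.v_sign i hi
    rw [h0] at this
    exact ha.zero i hi (le_antisymm (this.2 le_rfl) (this.1 le_rfl))
  have hnn : ∀ i, i < k + n → 0 ≤ a i * w i := fun i hi => h.pos_iff ha hpos hi
  have hvw : ∀ i, i < k + n → v' i = w' i := fun i hi => by rw [hv' i hi, hw' i hi]
  have hle : ∀ i, i < k + n → |w' i| ≤ V := fun i hi =>
    (ht.abs_le_of_nonneg ha1 hzero hnn hw' hi).trans (h.w_le i hi)
  have hw : ¬ ∀ i, i < k + n → w i = 0 := by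
    intro hw
    obtain ⟨i, hi, hit⟩ := ht.exists_eq
    have := ht.pos
    simp only [hw i hi] at hit
    omega
  have hsw : ∀ i, i < k + n → SignLE (w' i) (w i) := fun i hi => ht.signLE ha1 hzero hw' hi
  have hrows : ∀ i, i < k + n → w' i = ∑ l : Fin n, stackRow T i l * w' (k + l) := fun i hi =>
    rows_sub h.w_rows ha.rows hw' hi
  refine
    { w_rows := hrows
      v_rows := fun i hi => rows_sub h.w_rows ha.rows hv' hi
      w_sign := fun i hi => (hsw i hi).trans (h.w_sign i hi)
      v_sign := fun i hi => by rw [hvw i hi]; exact .refl _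
      v_ne := fun ⟨i, hi, h0⟩ => ⟨i, hi, by rw [hvw i hi]; exact h0⟩
      w_le := hle
      v_le := fun i hi => ?_
      progress := .inr ?_
      count := by have := h.count; omega
      lam_mem := fun p hp => ?_
      elementary := fun p hp => ?_
      sign := fun p hp i hi => ?_
      sum := fun j => ?_ }
  · rw [hvw i hi]
    have hV : 0 ≤ V := (abs_nonneg _).trans (hle i hi)
    have h2 : (1 : ℤ) ≤ 2 ^ (r + 1) := one_le_pow₀ (by norm_num)
    nlinarith [hle i hi]
  · have h1 := ht.suppCard_lt ha1 hzero hw'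
    have h2 := h.progress.resolve_left hw
    have h3 : suppCard (k + n) v' ≤ k + n := suppCard_le _ _
    obtain ⟨c, hc⟩ : ∃ c, suppCard (k + n) w = suppCard (k + n) w' + 1 + c :=
      ⟨suppCard (k + n) w - suppCard (k + n) w' - 1, by omega⟩
    rw [hc] at h2
    nlinarith
  · rcases Nat.lt_succ_iff_lt_or_eq.1 hp with hp | rfl
    · rw [hlam p hp]
      exact h.lam_mem p hp
    · rw [hlamN]
      exact ⟨ht.pos.le, ht.le_of_bound ha1 h.w_le⟩
  · rcases Nat.lt_succ_iff_lt_or_eq.1 hp with hp | rfl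
    · rw [hu p hp]
      exact h.elementary p hp
    · rw [huN]
      exact ha.elementary
  · rcases Nat.lt_succ_iff_lt_or_eq.1 hp with hp | rfl
    · rw [hu p hp]
      exact h.sign p hp i hi
    · rw [huN]
      have h1 : (dotProduct (stackRow T i) fun l : Fin n => a (k + l)) = a i := (ha.rows i hi).symm
      rw [h1]
      refine SignLE.trans ?_ (h.w_sign i hi)
      have h2 := hnn i hi
      have h3 := hzero i hi
      refine ⟨fun h0 => ?_, fun h0 => ?_⟩
      · rcases h0.eq_or_lt with h0 | h0
        · rw [h3 h0.symm]
        · nlinarith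
      · rcases h0.eq_or_lt with h0 | h0
        · rw [h3 h0]
        · nlinarith
  · have hsum : ∑ p ∈ Finset.range N, lam' p * u' p j = ∑ p ∈ Finset.range N, lam p * u p j :=
      Finset.sum_congr rfl fun p hp => by
        rw [hlam p (Finset.mem_range.1 hp), hu p (Finset.mem_range.1 hp)]
    rw [Finset.sum_range_succ, hlamN, huN, hsum, h.sum j, hw' _ (by omega)]
    ring

/-- At `r = (k + n + 1)²` the inequality in `progress` leaves no room for a nonzero entry of `w`. -/
theorem IsWalk.isDecomposition (h : IsWalk T z V r w v N lam u)
    (hr : r = (k + n + 1) * (k + n + 1)) : IsDecomposition T z N lam u := by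
  have hw : ∀ i, i < k + n → w i = 0 := by
    rcases h.progress with hw | hp
    · exact hw
    · intro i hi
      refine suppCard_eq_zero ?_ hi
      by_contra h0
      have : 1 ≤ suppCard (k + n) w := by omega
      have : k + n + 1 ≤ (k + n + 1) * suppCard (k + n) w := by nlinarith
      omega
  refine ⟨fun j => ?_, fun p hp => (h.lam_mem p hp).1, h.elementary, fun p hp i => ?_⟩
  · rw [h.sum j, hw _ (by omega), zero_add]
  · have := h.sign p hp i (by omega)
    rwa [stackRow_of_lt] at this

end Walk

/-! ### Program for one step of the walk -/

namespace Proximity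

/-- The entry of the direction in the row `var 8`. -/
abbrev dirExpr : Expr := .var 13 * cell 8 8 12

/-- The sign is chosen such that the direction and the vector in array 10 agree strictly in at least
one row, which is kept in variable 17. Hence a positive step length exists. -/
def chooseSign : Cmd :=
  .find 17 8 4 (.not (.eq (cell 8 8 12) 0)) ;;
  .ite (.lt (cell 8 17 12 * .arr 10 (.var 17)) 0) (.assign 13 (.lit (-1))) (.assign 13 1)

/-- The step length starts at the positive product in row `var 17`, so the minimum over all positive
products needs no infinite initial value. -/
def advance : Cmd :=
  .assign 15 (.var 13 * cell 8 17 12 * .arr 10 (.var 17)) ;;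
  .minimize 15 8 4 (.lt 0 (dirExpr * .arr 10 (.var 8))) (dirExpr * .arr 10 (.var 8)) ;;
  .forLoop 8 4 (.write 10 (.var 8) (.arr 10 (.var 8) - .var 15 * dirExpr))

def record : Cmd :=
  .forLoop 8 4 (.write 9 (.var 8) (.arr 10 (.var 8))) ;;
  .forLoop 9 1 (.write 12 (.var 5 * .var 1 + .var 9)
    (.var 13 * .arr 8 ((.var 0 + .var 9) * .var 1 + .var 12))) ;;
  .write 13 (.var 5) (.var 15) ;;
  .assign 5 (.var 5 + 1)

/-- If no row contradicts conformality, the vector in array 10 is first reset to the remaining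
vector, so that `advance` computes the multiplicity with respect to the latter and `record` can copy
the result back. -/
def move : Cmd :=
  chooseSign ;;
  .find 14 8 4 (.lt (dirExpr * .arr 10 (.var 8)) 0) ;;
  .ite (.lt (.var 14) (.var 4)) advance
    (.forLoop 8 4 (.write 10 (.var 8) (.arr 9 (.var 8))) ;; advance ;; record)

variable {H X k n : ℕ} {s : Store}

theorem chooseSign_run (hd : Dims k n s) (hX : k + n ≤ X) {q : Fin n} (hq : s.var 12 = (q : ℕ))
    (hA : ∀ i, i < k + n → |mat n (s.arr 8) i q| ≤ 1) {V : ℤ} (hVH : V ≤ H)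
    (hv : ∀ i : ℕ, i < k + n → |s.arr 10 i| ≤ V)
    (hne : ∃ i, i < k + n ∧ mat n (s.arr 8) i q ≠ 0)
    (hzero : ∀ i : ℕ, i < k + n → s.arr 10 i = 0 → mat n (s.arr 8) i q = 0) :
    Run H X chooseSign s fun s' => (s'.var 13 = 1 ∨ s'.var 13 = -1) ∧
      ∃ i : ℕ, i < k + n ∧ s'.var 17 = i ∧
        0 < s'.var 13 * mat n (s.arr 8) i q * s.arr 10 i := by
  refine Run.of_small fun h2 _ => ?_
  refine Run.seq_of (Run.find (k + n) hd.height hX (by decide) (by decide) (by decide) (by decide)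
    (by decide) (by decide) (fun i => mat n (s.arr 8) i q ≠ 0) ?_) ?_
  · intro i hi s' hF h8
    simp [h8, hF.var 1 rfl, hF.var 12 rfl, hF.arr 8 rfl, hd.cols, hq]
    exact ⟨.of_abs_le (hA i hi) (by omega), Iff.rfl⟩
  · intro s1 hF1 hcase
    obtain ⟨i, hi, h17, hiA⟩ : ∃ j : ℕ, j < k + n ∧ s1.var 17 = j ∧ mat n (s.arr 8) j q ≠ 0 := by
      rcases hcase with ⟨-, h⟩ | h
      · obtain ⟨i, hi, h'⟩ := hne
        exact absurd h' (h i hi)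
      · exact h
    have hcell : s1.arr 8 (s1.var 17 * s1.var 1 + s1.var 12) = mat n (s.arr 8) i q := by
      rw [hF1.arr 8 rfl, h17, hF1.var 1 rfl, hF1.var 12 rfl, hd.cols, hq]; rfl
    have h10 : s1.arr 10 (s1.var 17) = s.arr 10 i := by rw [hF1.arr 10 rfl, h17]
    have hpos : mat n (s.arr 8) i q * s.arr 10 i ≠ 0 :=
      mul_ne_zero hiA fun h => hiA (hzero i hi h)
    refine Run.ite (by decide) ?_ (fun h => ?_) fun h => ?_
    · simp only [Test.ok_lt, Expr.ok_zero, Expr.ok_mul, Expr.ok_arr, Expr.ok_add, Expr.ok_var,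
        Expr.eval_add, Expr.eval_mul, Expr.eval_var, hcell, h10]
      exact ⟨trivial, ⟨by decide, .of_abs_le (hA i hi) (by omega)⟩, by decide,
        .of_abs_le (hv i hi) hVH⟩
    · simp only [Test.holds_lt, Expr.eval_mul, Expr.eval_arr, Expr.eval_add, Expr.eval_var,
        Expr.eval_zero, hcell, h10] at h
      refine Run.assign (by decide) (by simp) (by constructor <;> simp; omega) ⟨by simp, i, hi, ?_⟩
      simp [h17]
      exact h
    · simp only [Test.holds_lt, Expr.eval_mul, Expr.eval_arr, Expr.eval_add, Expr.eval_var,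
        Expr.eval_zero, hcell, h10] at h
      refine Run.assign (by decide) (by simp) (by constructor <;> simp; omega) ⟨by simp, i, hi, ?_⟩
      simp [h17]
      omega

theorem advance_run (hd : Dims k n s) (hX : k + n ≤ X) {q : Fin n} (hq : s.var 12 = (q : ℕ))
    {a : ℕ → ℤ} (ha : ∀ i, i < k + n → a i = s.var 13 * mat n (s.arr 8) i q)
    (hA : ∀ i, i < k + n → |mat n (s.arr 8) i q| ≤ 1) (hσ : s.var 13 = 1 ∨ s.var 13 = -1) {V : ℤ}
    (hVH : V ≤ H) (hv : ∀ i : ℕ, i < k + n → |s.arr 10 i| ≤ V) {i₀ : ℕ} (hi₀ : i₀ < k + n)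
    (h17 : s.var 17 = i₀) (hpos : 0 < a i₀ * s.arr 10 i₀) :
    Run H X advance s fun s' => ∃ t, s'.var 15 = t ∧
      IsLeastPos (k + n) (fun i => a i * s.arr 10 i) t ∧
      ∀ i : ℕ, i < k + n → s'.arr 10 i = s.arr 10 i - t * a i := by
  refine Run.of_small fun h2 _ => ?_
  have hAW : ∀ i, i < k + n → Within H (mat n (s.arr 8) i q) := fun i hi =>
    .of_abs_le (hA i hi) (by omega)
  have hvW : ∀ i : ℕ, i < k + n → Within H (s.arr 10 i) := fun i hi => .of_abs_le (hv i hi) hVH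
  have hmat : ∀ i : ℕ, s.arr 8 (i * n + ((q : ℕ) : ℤ)) = mat n (s.arr 8) i q := fun _ => rfl
  have ha1 : ∀ i, i < k + n → |a i| ≤ 1 := by
    intro i hi
    rw [ha i hi, abs_mul]
    have := hA i hi
    rcases hσ with h | h <;> rw [h] <;> simpa using this
  have havW : ∀ i : ℕ, i < k + n → Within H (a i * s.arr 10 i) := by
    intro i hi
    refine .of_abs_le (M := V) ?_ hVH
    rw [abs_mul]
    nlinarith [ha1 i hi, hv i hi, abs_nonneg (a i), abs_nonneg (s.arr 10 i)]
  refine Run.seq (Run.assign (by decide) ?_ ?_ ?_)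
  · simp [h17, hd.cols, hq, hmat, hAW i₀ hi₀, hvW i₀ hi₀]
  · simp only [Expr.eval_mul, Expr.eval_arr, Expr.eval_add, Expr.eval_var, h17, hd.cols, hq, hmat]
    rw [← ha i₀ hi₀]
    exact havW i₀ hi₀
  have hev : (Expr.var 13 * cell 8 17 12 * Expr.arr 10 (.var 17)).eval s = a i₀ * s.arr 10 i₀ := by
    simp only [Expr.eval_mul, Expr.eval_arr, Expr.eval_add, Expr.eval_var, h17, hd.cols, hq, hmat]
    rw [← ha i₀ hi₀]
  rw [hev]
  refine Run.seq_of (Run.minimize (k + n) (by simp [hd.height]) hX (by decide) (by decide)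
    (by decide) (by decide) (by decide) (by decide) (by decide) (by decide)
    (fun i => 0 < a i * s.arr 10 i) (fun i => a i * s.arr 10 i) havW ?_) ?_
  · intro i hi s' hF h8
    have v1 := hF.var 1 rfl
    have v12 := hF.var 12 rfl
    have v13 := hF.var 13 rfl
    have a8 := hF.arr 8 rfl
    have a10 := hF.arr 10 rfl
    simp at v1 v12 v13 a8 a10
    simp [h8, v1, v12, v13, a8, a10, hd.cols, hq, hmat, hAW i hi, hvW i hi, ha i hi]
  · rintro s1 hF1 ⟨h1, h3, h4⟩
    have v1 := hF1.var 1 rfl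
    have v4 := hF1.var 4 rfl
    have v12 := hF1.var 12 rfl
    have v13 := hF1.var 13 rfl
    have a8 := hF1.arr 8 rfl
    have a10 := hF1.arr 10 rfl
    simp at v1 v4 v12 v13 a8 a10 h1 h4
    have hleast : IsLeastPos (k + n) (fun i => a i * s.arr 10 i) (s1.var 15) := by
      rcases h4 with h4 | ⟨i, hi, h5, h6⟩
      · exact ⟨⟨i₀, hi₀, h4.symm⟩, by omega, fun i hi h => h3 i hi h⟩
      · exact ⟨⟨i, hi, h6.symm⟩, by omega, fun i hi h => h3 i hi h⟩
    refine (Run.fill (k + n) (v4.trans hd.height) hX (by decide) (by decide) (by decide)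
      (by decide) (by decide) (fun i => (i : ℤ)) (fun i => s.arr 10 i - s1.var 15 * a i)
      (fun j _ j' _ h => by exact_mod_cast h) ?_).mono ?_
    · intro i hi s' hF h8 hold
      have w1 := (hF.var 1 rfl).trans v1
      have w12 := (hF.var 12 rfl).trans v12
      have w13 := (hF.var 13 rfl).trans v13
      have w15 := hF.var 15 rfl
      have b8 := (hF.arr 8 rfl).trans a8
      have b10 : s'.arr 10 i = s.arr 10 i := by
        rw [hold _ fun j' hj' => by exact_mod_cast hj'.ne', a10]
      simp [h8, w1, w12, w13, w15, b8, b10, hd.cols, hq, hmat, hAW i hi, hvW i hi, ha i hi]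
    · rintro s2 hF2 ⟨h5, -⟩
      exact ⟨s1.var 15, hF2.var 15 rfl, hleast, h5⟩

theorem record_run (hd : Dims k n s) (hX : k + n ≤ X) {q : Fin n} (hq : s.var 12 = (q : ℕ))
    (hA : ∀ i, i < k + n → |mat n (s.arr 8) i q| ≤ 1)
    (hv : ∀ i : ℕ, i < k + n → Within H (s.arr 10 i)) {N : ℕ} (hN : s.var 5 = N) (hNH : N < H) :
    Run H X record s fun s' => (∀ i : ℕ, i < k + n → s'.arr 9 i = s.arr 10 i) ∧
      s'.var 5 = (N + 1 : ℕ) ∧ (∀ p, p < N → mat n (s'.arr 12) p = mat n (s.arr 12) p) ∧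
      mat n (s'.arr 12) N = (fun l : Fin n => s.var 13 * mat n (s.arr 8) (k + l) q) ∧
      (∀ p : ℕ, p < N → s'.arr 13 p = s.arr 13 p) ∧ s'.arr 13 N = s.var 15 := by
  refine Run.of_small fun h2 _ => ?_
  refine Run.seq_of (Run.fill (k + n) hd.height hX (by decide) (by decide) (by decide)
    (by decide) (by decide) (fun i => (i : ℤ)) (fun i => s.arr 10 i)
    (fun j _ j' _ h => by exact_mod_cast h) ?_) ?_
  · intro i hi s' hF h8 _
    simp [h8, hF.arr 10 rfl, hv i hi]
  rintro s1 hF1 ⟨h9, -⟩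
  have d1 := hd.of_frame hF1 rfl rfl rfl
  refine Run.seq_of (Run.fill n d1.cols (by omega) (by decide) (by decide) (by decide)
    (by decide) (by decide) (fun j => (N : ℤ) * n + j)
    (fun j => s.var 13 * s.arr 8 (((k + j : ℕ) : ℤ) * n + ((q : ℕ) : ℤ)))
    (fun j _ j' _ h => by omega) ?_) ?_
  · intro j hj s' hF h9' _
    have e1 := (hF.var 13 rfl).trans (hF1.var 13 rfl)
    have e2 := (hF.var 5 rfl).trans (hF1.var 5 rfl)
    have e3 := (hF.var 12 rfl).trans (hF1.var 12 rfl)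
    have e4 := (hF.arr 8 rfl).trans (hF1.arr 8 rfl)
    have d2 := d1.of_frame hF rfl rfl rfl
    simp [e1, e2, e3, e4, d2.cols, d2.rows, hN, hq, h9']
    have := hA (k + j) (by omega)
    simp only [mat, Nat.cast_add] at this
    exact .of_abs_le this (by omega)
  rintro s2 hF2 ⟨h12, h12'⟩
  have v5 := ((hF2.var 5 rfl).trans (hF1.var 5 rfl)).trans hN
  have v15 := (hF2.var 15 rfl).trans (hF1.var 15 rfl)
  have a13 := (hF2.arr 13 rfl).trans (hF1.arr 13 rfl)
  have a9 := hF2.arr 9 rfl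
  have a12 := hF1.arr 12 rfl
  refine Run.seq (Run.write (by decide) (by decide) (by simp) (by simp) ?_)
  refine Run.assign (by decide) (by simp) ?_ ?_
  · simp only [Expr.eval_add, Expr.eval_var, Store.var_setArr, v5, Expr.eval_one]
    constructor <;> omega
  · simp only [Expr.eval_add, Expr.eval_var, Store.var_setArr, v5, Expr.eval_one, Store.arr_setVar,
      Store.arr_setArr, Store.var_setVar, if_true, v15, a13]
    simp only [Nat.reduceEqDiff, if_false, a9]
    refine ⟨h9, by push_cast; rfl, fun p hp => ?_, ?_, fun p hp => ?_, trivial⟩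
    · funext j
      simp only [mat]
      rw [h12', a12]
      intro j' hj' h
      have := (flat_inj j.2 hj').1 h
      omega
    · funext j
      exact h12 j j.2
    · rw [if_neg]
      exact_mod_cast hp.ne

end Proximity

theorem IsTableau.congr {k n : ℕ} {T : Matrix (Fin k) (Fin n) ℤ} {A A' : ℕ → Fin n → ℤ}
    {lab : Fin n → ℕ} (h : IsTableau T A lab) (hA : ∀ i, i < k + n → ∀ j, A' i j = A i j) :
    IsTableau T A' lab := by
  refine ⟨fun i hi j => ?_, h.lab_lt, fun l j => ?_⟩
  · rw [hA i hi, h.eq_sum i hi]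
    exact Finset.sum_congr rfl fun l _ => by rw [hA _ (by omega)]
  · rw [hA _ (h.lab_lt l), h.unit]

theorem isWalk_init {k n : ℕ} {T : Matrix (Fin k) (Fin n) ℤ} {z : Fin n → ℤ} {V : ℤ} {w v : ℕ → ℤ}
    {lam : ℕ → ℤ} {u : ℕ → Fin n → ℤ} (hw : ∀ i, i < k + n → w i = dotProduct (stackRow T i) z)
    (hv : ∀ i, i < k + n → v i = dotProduct (stackRow T i) z)
    (hV : ∀ i, i < k + n → |dotProduct (stackRow T i) z| ≤ V) :
    IsWalk T z V 0 w v 0 lam u := by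
  have hz : ∀ l : Fin n, dotProduct (stackRow T (k + l)) z = z l := fun l => by
    rw [stackRow_add, single_dotProduct, one_mul]
  refine
    { w_rows := fun i hi => ?_
      v_rows := fun i hi => ?_
      w_sign := fun i hi => by rw [hw i hi]; exact .refl _
      v_sign := fun i hi => by rw [hv i hi, hw i hi]; exact .refl _
      v_ne := fun ⟨i, hi, h⟩ => ⟨i, hi, by rw [hv i hi, ← hw i hi]; exact h⟩
      w_le := fun i hi => by rw [hw i hi]; exact hV i hi
      v_le := fun i hi => by rw [hv i hi]; simpa using hV i hi
      progress := .inr ?_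
      count := le_rfl
      lam_mem := fun p hp => by omega
      elementary := fun p hp => by omega
      sign := fun p hp => by omega
      sum := fun j => ?_ }
  · rw [hw i hi]
    exact Finset.sum_congr rfl fun l _ => by rw [hw _ (by omega), hz]
  · rw [hv i hi]
    exact Finset.sum_congr rfl fun l _ => by rw [hv _ (by omega), hz]
  · have h1 := suppCard_le (k + n) w
    have h2 := suppCard_le (k + n) v
    nlinarith
  · rw [hw _ (by omega), hz]
    simp

/-! ### Program for the whole decomposition -/

namespace Proximity

variable {H X k n : ℕ} {s : Store}

def step : Cmd :=
  freeze ;;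
  .find 12 9 1 (.eq (.arr 11 (.var 9)) 0) ;;
  .ite (.lt (.var 12) (.var 1)) move .skip

/-- Writes the rows of `T` and the unit vectors. -/
def writeTableau : Cmd :=
  .forLoop 8 4 (.forLoop 9 1 (.ite (.lt (.var 8) (.var 0))
    (.write 8 (.var 8 * .var 1 + .var 9) (cell 0 8 9))
    (.ite (.eq (.var 8) (.var 0 + .var 9)) (.write 8 (.var 8 * .var 1 + .var 9) 1)
      (.write 8 (.var 8 * .var 1 + .var 9) 0))))

def writeProducts : Cmd :=
  .forLoop 8 4
    (.sum 16 9 1 (cell 8 8 9 * (.arr 6 (.var 9) - .arr 5 (.var 9))) ;;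
      .write 9 (.var 8) (.var 16) ;; .write 10 (.var 8) (.var 16))

def decompose : Cmd :=
  writeTableau ;; writeProducts ;; .assign 5 0 ;; .forLoop 7 6 step

/-- The store holds a tableau and the data of a walk. -/
structure WalkState (T : Matrix (Fin k) (Fin n) ℤ) (z : Fin n → ℤ) (V : ℤ) (r N : ℕ) (s : Store) :
    Prop where
  tableau : ∃ lab, IsTableau T (mat n (s.arr 8)) lab
  count : s.var 5 = N
  walk : IsWalk T z V r (fun i => s.arr 9 i) (fun i => s.arr 10 i) N (fun p => s.arr 13 p)
    (mat n (s.arr 12))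

variable {T : Matrix (Fin k) (Fin n) ℤ} {z : Fin n → ℤ} {V : ℤ} {r N : ℕ}

theorem move_run (hT : T.IsTotallyUnimodular) (hd : Dims k n s) (hX : k + n ≤ X)
    (hVH : 2 ^ r * V ≤ H) (hVH' : V ≤ H) (hrH : r < H) (hw : WalkState T z V r N s)
    {lab : Fin n → ℕ} (ht : IsTableau T (mat n (s.arr 8)) lab)
    (hf : IsFrozen (mat n (s.arr 8)) lab (fun i => s.arr 10 i) (frozen n s) (k + n)) {q : Fin n}
    (hqF : ¬ frozen n s q) (hq : s.var 12 = (q : ℕ)) :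
    Run H X move s fun s' => ∃ N', WalkState T z V (r + 1) N' s' := by
  refine Run.of_small fun h2 _ => ?_
  have hA : ∀ i, i < k + n → |mat n (s.arr 8) i q| ≤ 1 := fun i hi => ht.abs_le_one hT hi q
  refine Run.seq_of (chooseSign_run hd hX hq hA hVH hw.walk.v_le (ht.exists_ne_zero q)
    fun i hi h => hf.zero i hi h q hqF) ?_
  rintro s1 hF1 ⟨hσ, i₀, hi₀, h17, hpos⟩
  have d1 := hd.of_frame hF1 rfl rfl rfl
  have b12 := (hF1.var 12 rfl).trans hq
  have b5 := (hF1.var 5 rfl).trans hw.count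
  have b8 := hF1.arr 8 rfl
  have b9 := hF1.arr 9 rfl
  have b10 := hF1.arr 10 rfl
  have b12' := hF1.arr 12 rfl
  have b13 := hF1.arr 13 rfl
  have hdir := ht.isDirection hf hqF hσ
  set a : ℕ → ℤ := fun i => s1.var 13 * mat n (s.arr 8) i q with ha
  have hav : ∀ i : ℕ, i < k + n → |a i| ≤ 1 := fun i hi => hdir.abs_le_one hT hi
  have hWalk := hw.walk
  refine Run.seq_of (Run.find (k + n) d1.height hX (by decide) (by decide) (by decide) (by decide)
    (by decide) (by decide) (fun i => a i * s.arr 10 i < 0) ?_) ?_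
  · intro i hi s' hF h8
    have c1 := (d1.of_frame hF rfl rfl rfl).cols
    simp [h8, c1, hF.var 13 rfl, hF.var 12 rfl, hF.arr 8 rfl, hF.arr 10 rfl, b8, b10, b12]
    exact ⟨⟨.of_abs_le (hA i hi) (by omega), .of_abs_le (hWalk.v_le i hi) hVH⟩, Iff.rfl⟩
  intro s2 hF2 hcase
  have d2 := d1.of_frame hF2 rfl rfl rfl
  have c12 := (hF2.var 12 rfl).trans b12
  have c5 := (hF2.var 5 rfl).trans b5
  have c13v := hF2.var 13 rfl
  have c17 := (hF2.var 17 rfl).trans h17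
  have c8 := (hF2.arr 8 rfl).trans b8
  have c9 := (hF2.arr 9 rfl).trans b9
  have c10 := (hF2.arr 10 rfl).trans b10
  have c12' := (hF2.arr 12 rfl).trans b12'
  have c13 := (hF2.arr 13 rfl).trans b13
  refine Run.ite (by decide) (by simp) (fun h => ?_) fun h => ?_
  · simp only [Test.holds_lt, Expr.eval_var, d2.height] at h
    obtain ⟨i, hi, -, hneg⟩ : ∃ j : ℕ, j < k + n ∧ s2.var 14 = j ∧ a j * s.arr 10 j < 0 := by
      rcases hcase with ⟨h', -⟩ | h'
      · omega
      · exact h'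
    refine (advance_run d2 hX c12 (a := a) (fun i _ => by rw [ha, c8, c13v]) (by rw [c8]; exact hA)
      (by rw [c13v]; exact hσ) hVH (by rw [c10]; exact hWalk.v_le) hi₀ c17
      (by rw [c10]; exact hpos)).mono ?_
    rintro s3 hF3 ⟨t, -, ht', h10⟩
    rw [c10] at ht' h10
    refine ⟨N, ⟨lab, by rw [hF3.arr 8 rfl, c8]; exact ht⟩, (hF3.var 5 rfl).trans c5, ?_⟩
    rw [hF3.arr 9 rfl, hF3.arr 12 rfl, hF3.arr 13 rfl, c9, c12', c13]
    exact hWalk.advance hT hdir ht' h10 ⟨i, hi, hneg⟩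
  · simp only [Test.holds_lt, Expr.eval_var, d2.height] at h
    have hnn : ∀ i : ℕ, i < k + n → 0 ≤ a i * s.arr 10 i := by
      rcases hcase with ⟨-, h'⟩ | ⟨j, hj, hj', -⟩
      · exact fun i hi => not_lt.1 (h' i hi)
      · omega
    refine Run.seq_of (Run.fill (k + n) d2.height hX (by decide) (by decide) (by decide)
      (by decide) (by decide) (fun i => (i : ℤ)) (fun i => s.arr 9 i)
      (fun j _ j' _ h => by exact_mod_cast h) ?_) ?_
    · intro i hi s' hF h8 _
      simp [h8, hF.arr 9 rfl, c9]
      exact .of_abs_le (hWalk.w_le i hi) hVH'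
    rintro s3 hF3 ⟨h10, -⟩
    have d3 := d2.of_frame hF3 rfl rfl rfl
    have e8 := (hF3.arr 8 rfl).trans c8
    have e12 := (hF3.var 12 rfl).trans c12
    have e13 := (hF3.var 13 rfl).trans c13v
    -- The row found by `chooseSign` for `v` also serves for `w`: `v` is nonzero there and conformal
    -- to `w`, hence so is `w`.
    have hposw : 0 < a i₀ * s3.arr 10 i₀ := by
      rw [h10 i₀ hi₀]
      refine lt_of_le_of_ne (hWalk.pos_iff hdir hnn hi₀) fun h0 => ?_
      rcases mul_eq_zero.1 h0.symm with h0 | h0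
      · have : (0 : ℤ) < a i₀ * s.arr 10 i₀ := hpos
        rw [h0] at this
        omega
      · have h3 : (0 : ℤ) < a i₀ * s.arr 10 i₀ := hpos
        have h4 := hWalk.v_sign i₀ hi₀
        simp only [h0] at h4
        rw [le_antisymm (h4.2 le_rfl) (h4.1 le_rfl)] at h3
        omega
    refine Run.seq_of (advance_run d3 hX e12 (a := a) (fun i _ => by rw [ha, e8, e13])
      (by rw [e8]; exact hA) (by rw [e13]; exact hσ) hVH'
      (fun i hi => by rw [h10 i hi]; exact hWalk.w_le i hi) hi₀ ((hF3.var 17 rfl).trans c17)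
      hposw) ?_
    rintro s4 hF4 ⟨t, h15, ht', h10'⟩
    have d4 := d3.of_frame hF4 rfl rfl rfl
    have f8 := (hF4.arr 8 rfl).trans e8
    have f5 := ((hF4.var 5 rfl).trans (hF3.var 5 rfl)).trans c5
    have f12 := (hF4.var 12 rfl).trans e12
    have f13 := (hF4.var 13 rfl).trans e13
    have hleast : IsLeastPos (k + n) (fun i => a i * s.arr 9 i) t := by
      obtain ⟨⟨i, hi, hit⟩, g1, g2⟩ := ht'
      rw [h10 i hi] at hit
      exact ⟨⟨i, hi, hit⟩, g1, fun j hj hp => by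
        have := g2 j hj
        rw [h10 j hj] at this
        exact this hp⟩
    have h10w : ∀ i : ℕ, i < k + n → s4.arr 10 i = s.arr 9 i - t * a i := fun i hi => by
      rw [h10' i hi, h10 i hi]
    have hzero : ∀ i : ℕ, i < k + n → s.arr 9 i = 0 → a i = 0 := by
      intro i hi h0
      have := hWalk.v_sign i hi
      simp only [h0] at this
      exact hdir.zero i hi (le_antisymm (this.2 le_rfl) (this.1 le_rfl))
    refine (record_run d4 hX f12 (by rw [f8]; exact hA) (fun i hi => ?_) f5
      (by have := hWalk.count; omega)).mono ?_
    · exact .of_abs_le ((hleast.abs_le_of_nonneg hav hzero (fun i hi => hWalk.pos_iff hdir hnn hi)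
        h10w hi).trans (hWalk.w_le i hi)) hVH'
    rintro s5 hF5 ⟨g1, g2, g3, g4, g5, g6⟩
    refine ⟨N + 1, ⟨lab, by rw [hF5.arr 8 rfl, f8]; exact ht⟩, g2, ?_⟩
    have k12 := ((hF4.arr 12 rfl).trans (hF3.arr 12 rfl)).trans c12'
    have k13 := ((hF4.arr 13 rfl).trans (hF3.arr 13 rfl)).trans c13
    rw [k12] at g3
    rw [k13] at g5
    refine hWalk.record hT hdir hnn hleast (fun i hi => ?_) (fun i hi => ?_) g5
      (g6.trans h15) g3 (g4.trans ?_)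
    · rw [g1 i hi, h10w i hi]
    · rw [hF5.arr 10 rfl, h10w i hi]
    · rw [f13, f8]

theorem step_run (hT : T.IsTotallyUnimodular) (hd : Dims k n s) (hX : k + n ≤ X)
    (hVH : 2 ^ r * V ≤ H) (hV : 0 ≤ V) (hrH : r < H) (hw : WalkState T z V r N s) :
    Run H X step s fun s' => ∃ N', WalkState T z V (r + 1) N' s' := by
  have hVH' : V ≤ H := by
    have : (1 : ℤ) ≤ 2 ^ r := one_le_pow₀ (by norm_num)
    nlinarith
  obtain ⟨lab, ht⟩ := hw.tableau
  refine Run.seq_of (freeze_run hT hd hX ht fun i hi => .of_abs_le (hw.walk.v_le i hi) hVH) ?_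
  rintro s1 hF1 ⟨lab', ht', hf', h11⟩
  have d1 := hd.of_frame hF1 rfl rfl rfl
  have hw1 : WalkState T z V r N s1 := by
    refine ⟨⟨lab', ht'⟩, (hF1.var 5 rfl).trans hw.count, ?_⟩
    rw [hF1.arr 9 rfl, hF1.arr 10 rfl, hF1.arr 12 rfl, hF1.arr 13 rfl]
    exact hw.walk
  refine Run.seq_of (Run.find n d1.cols (by omega) (by decide) (by decide) (by decide)
    (by decide) (by decide) (by decide) (fun j => s1.arr 11 j = 0) ?_) ?_
  · intro j hj s' hF h9
    simp [h9, hF.arr 11 rfl, h11 ⟨j, hj⟩]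
  intro s2 hF2 hcase
  have d2 := d1.of_frame hF2 rfl rfl rfl
  have hw2 : WalkState T z V r N s2 := by
    refine ⟨⟨lab', by rw [hF2.arr 8 rfl]; exact ht'⟩, (hF2.var 5 rfl).trans hw1.count, ?_⟩
    rw [hF2.arr 9 rfl, hF2.arr 10 rfl, hF2.arr 12 rfl, hF2.arr 13 rfl]
    exact hw1.walk
  have hfz : frozen n s2 = frozen n s1 := by funext j; simp [frozen, hF2.arr 11 rfl]
  refine Run.ite (by decide) (by simp) (fun h => ?_) fun h => Run.skip ⟨N, hw2.tableau, hw2.count, ?_⟩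
  · simp only [Test.holds_lt, Expr.eval_var, d2.cols] at h
    obtain ⟨q, hq, h12, hq0⟩ : ∃ j : ℕ, j < n ∧ s2.var 12 = j ∧ s1.arr 11 j = 0 := by
      rcases hcase with ⟨h', -⟩ | h'
      · omega
      · exact h'
    refine move_run (q := ⟨q, hq⟩) hT d2 hX hVH hVH' hrH hw2 (lab := lab')
      (by rw [hF2.arr 8 rfl]; exact ht') ?_ (by rw [hfz]; exact fun h => h hq0) h12
    rw [hfz, hF2.arr 8 rfl, hF2.arr 10 rfl]
    exact hf'
  · simp only [Test.holds_lt, Expr.eval_var, d2.cols] at h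
    have hall : ∀ j, frozen n s1 j := by
      rcases hcase with ⟨-, h'⟩ | ⟨j, hj, hj', -⟩
      · exact fun j => h' j j.2
      · omega
    refine hw2.walk.idle (fun i hi => ?_) hV
    rw [hF2.arr 10 rfl]
    exact hf'.eq_zero ht' hw1.walk.v_rows hall hi

theorem writeTableau_run (hd : Dims k n s) (hX : k + n ≤ X) (hT : T.IsTotallyUnimodular)
    (h0 : ∀ (i : Fin k) (j : Fin n), s.arr 0 ((i : ℤ) * (n : ℤ) + (j : ℤ)) = T i j) :
    Run H X writeTableau s fun s' => ∀ i, i < k + n → ∀ j, mat n (s'.arr 8) i j = stackRow T i j := by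
  refine Run.of_small fun h2 _ => ?_
  refine Run.forLoop (k + n) hd.height hX (by decide) (by decide) rfl rfl (by decide)
    (fun r s' => ∀ i, i < r → ∀ j, mat n (s'.arr 8) i j = stackRow T i j) (by simp) ?_
    fun s' _ h => h
  intro i hi s' hF h8 hI
  have d' := hd.of_frame hF rfl rfl rfl
  have a0 := hF.arr 0 rfl
  refine Run.forLoop n d'.cols (by omega) (by decide) (by decide) rfl rfl (by decide)
    (fun r s' => ∀ i' (j : Fin n), i' < i ∨ i' = i ∧ (j : ℕ) < r → mat n (s'.arr 8) i' j = stackRow T i' j)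
    ?_ ?_ ?_
  · intro i' j h
    exact hI i' (by omega) j
  · intro j hj s2 hF2 h9 hI2
    have d2 := d'.of_frame hF2 rfl rfl rfl
    have b8 := (hF2.var 8 rfl).trans h8
    have b0 := (hF2.arr 0 rfl).trans a0
    have fin : ∀ val : ℤ, val = stackRow T i ⟨j, hj⟩ → ∀ i' (j' : Fin n),
        i' < i ∨ i' = i ∧ (j' : ℕ) < j + 1 →
        mat n (((s2.setArr 8 ((Expr.var 8 * Expr.var 1 + Expr.var 9).eval s2) val).setVar 9
          ((j + 1 : ℕ) : ℤ)).arr 8) i' j' = stackRow T i' j' := by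
      intro val hval i' j' h'
      simp only [mat, Store.arr_setVar, Store.arr_setArr, if_true, Expr.eval_add, Expr.eval_mul,
        Expr.eval_var, b8, h9, d2.cols, flat_inj j'.2 hj]
      split_ifs with hc
      · obtain ⟨rfl, hc⟩ := hc
        rw [hval]
        congr 1
        exact Fin.ext hc.symm
      · exact hI2 i' j' (by omega)
    refine Run.ite (by decide) (by simp) (fun h => ?_) fun h => ?_
    · simp only [Test.holds_lt, Expr.eval_var, b8, d2.rows] at h
      have hik : i < k := by omega
      have hcell : s2.arr 0 (i * n + (j : ℤ)) = T ⟨i, hik⟩ ⟨j, hj⟩ := by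
        rw [b0]
        exact h0 ⟨i, hik⟩ ⟨j, hj⟩
      refine Run.write (by decide) (by decide) (by simp) ?_ (fin _ ?_)
      · simp [b8, h9, d2.cols, hcell]
        obtain ⟨σ, hσ⟩ := hT.apply ⟨i, hik⟩ ⟨j, hj⟩
        refine .of_abs_le (M := 1) ?_ (by omega)
        rw [← hσ]
        cases σ <;> simp
      · simp [b8, h9, d2.cols, hcell, stackRow, hik]
    · simp only [Test.holds_lt, Expr.eval_var, b8, d2.rows] at h
      have hik : ¬ i < k := by omega
      refine Run.ite (by decide) (by simp) (fun h' => ?_) fun h' => ?_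
      · simp only [Test.holds_eq, Expr.eval_add, Expr.eval_var, b8, d2.rows, h9] at h'
        refine Run.write (by decide) (by decide) (by simp) (by simp) (fin _ ?_)
        have : i = k + j := by omega
        simp [stackRow, this]
      · simp only [Test.holds_eq, Expr.eval_add, Expr.eval_var, b8, d2.rows, h9] at h'
        refine Run.write (by decide) (by decide) (by simp) (by simp) (fin _ ?_)
        have : ¬ i = k + j := by omega
        simp [stackRow, hik, this]
  · intro s2 _ hI2 i' hi' j
    exact hI2 i' j (by have := j.2; omega)

theorem writeProducts_run (hd : Dims k n s) (hX : k + n ≤ X) (hT : T.IsTotallyUnimodular)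
    {x₀ y : Fin n → ℤ} (hx : ∀ j : Fin n, s.arr 5 (j : ℤ) = x₀ j)
    (hy : ∀ j : Fin n, s.arr 6 (j : ℤ) = y j)
    (h8 : ∀ i, i < k + n → ∀ j, mat n (s.arr 8) i j = stackRow T i j) {M : ℤ} (hM : M ≤ H)
    (hxM : ∀ j, |x₀ j| ≤ M) (hyM : ∀ j, |y j| ≤ M) (hnM : n * (2 * M) ≤ H) :
    Run H X writeProducts s fun s' =>
      (∀ i : ℕ, i < k + n → s'.arr 9 i = dotProduct (stackRow T i) (y - x₀)) ∧
      ∀ i : ℕ, i < k + n → s'.arr 10 i = dotProduct (stackRow T i) (y - x₀) := by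
  refine Run.of_small fun h2 _ => ?_
  have hst : ∀ i, i < k + n → ∀ j, |stackRow T i j| ≤ 1 := fun i hi j => by
    have := (isTableau_stackRow T).abs_le_one hT hi j
    exact this
  refine Run.forLoop (k + n) hd.height hX (by decide) (by decide) rfl rfl (by decide)
    (fun r s' => (∀ i : ℕ, i < r → s'.arr 9 i = dotProduct (stackRow T i) (y - x₀)) ∧
      ∀ i : ℕ, i < r → s'.arr 10 i = dotProduct (stackRow T i) (y - x₀)) (by simp) ?_
    fun s' _ h => h
  rintro i hi s' hF hi8 ⟨hI1, hI2⟩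
  have d' := hd.of_frame hF rfl rfl rfl
  have a5 := hF.arr 5 rfl
  have a6 := hF.arr 6 rfl
  have a8 := hF.arr 8 rfl
  refine Run.seq_of (Run.sum n d'.cols (by omega) (by decide) (by decide) (by decide) (by decide)
    (by decide) (by decide) (by decide)
    (fun j => if h : j < n then stackRow T i ⟨j, h⟩ * (y ⟨j, h⟩ - x₀ ⟨j, h⟩) else 0) (2 * M)
    (fun j hj => ?_) hnM ?_) ?_
  · rw [dif_pos hj, abs_mul]
    have h1 := hst i hi ⟨j, hj⟩
    have h3 := abs_sub (y ⟨j, hj⟩) (x₀ ⟨j, hj⟩)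
    have h4 := hxM ⟨j, hj⟩
    have h5 := hyM ⟨j, hj⟩
    nlinarith [abs_nonneg (y ⟨j, hj⟩ - x₀ ⟨j, hj⟩), abs_nonneg (stackRow T i ⟨j, hj⟩)]
  · intro j hj s2 hF2 h9
    have d2 := d'.of_frame hF2 rfl rfl rfl
    have b8 : s2.arr 8 (i * n + (j : ℤ)) = stackRow T i ⟨j, hj⟩ := by
      rw [hF2.arr 8 rfl, a8]
      exact h8 i hi ⟨j, hj⟩
    have b5 : s2.arr 5 j = x₀ ⟨j, hj⟩ := by
      rw [hF2.arr 5 rfl, a5]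
      exact hx ⟨j, hj⟩
    have b6 : s2.arr 6 j = y ⟨j, hj⟩ := by
      rw [hF2.arr 6 rfl, a6]
      exact hy ⟨j, hj⟩
    simp [(hF2.var 8 rfl).trans hi8, h9, d2.cols, b8, b5, b6, hj]
    exact ⟨.of_abs_le (hst i hi _) (by omega), .of_abs_le (hyM _) hM, .of_abs_le (hxM _) hM⟩
  · intro s2 hF2 h16
    have hsum : s2.var 16 = dotProduct (stackRow T i) (y - x₀) := by
      rw [h16, Finset.sum_range]
      simp [dotProduct]
    have b8 := (hF2.var 8 rfl).trans hi8
    refine Run.seq (Run.write (by decide) (by decide) (by simp) (by simp) ?_)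
    refine Run.write (by decide) (by decide) (by simp) (by simp) ?_
    simp only [Store.arr_setVar, Store.arr_setArr, if_true, Expr.eval_var, Store.var_setArr, b8,
      hsum]
    simp only [Nat.reduceEqDiff, if_false, hF2.arr 9 rfl, hF2.arr 10 rfl]
    refine ⟨fun i' hi' => ?_, fun i' hi' => ?_⟩ <;> split_ifs with h
    · rw [Nat.cast_inj.1 h]
    · exact hI1 i' (by omega)
    · rw [Nat.cast_inj.1 h]
    · exact hI2 i' (by omega)

/-- `n * (2 * M)` bounds the products of `y - x₀` with all rows. The walk can double its vector in
each of its `(k + n + 1)²` rounds, which makes the numbers exponentially large but their encoding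
length only polynomially larger. -/
theorem decompose_run (hd : Dims k n s) (h6 : s.var 6 = ((k + n + 1) * (k + n + 1) : ℕ))
    (hX : (k + n + 1) * (k + n + 1) ≤ X) (hT : T.IsTotallyUnimodular)
    (h0 : ∀ (i : Fin k) (j : Fin n), s.arr 0 ((i : ℤ) * (n : ℤ) + (j : ℤ)) = T i j)
    {x₀ y : Fin n → ℤ} (hx : ∀ j : Fin n, s.arr 5 (j : ℤ) = x₀ j)
    (hy : ∀ j : Fin n, s.arr 6 (j : ℤ) = y j) {M : ℤ} (hM0 : 0 ≤ M) (hM : M ≤ H)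
    (hxM : ∀ j, |x₀ j| ≤ M) (hyM : ∀ j, |y j| ≤ M)
    (hH : 2 ^ ((k + n + 1) * (k + n + 1)) * (n * (2 * M)) ≤ H) :
    Run H X decompose s fun s' => ∃ N : ℕ, s'.var 5 = N ∧ N ≤ (k + n + 1) * (k + n + 1) ∧
      IsDecomposition T (y - x₀) N (fun p => s'.arr 13 p) (mat n (s'.arr 12)) ∧
      ∀ p : ℕ, p < N → s'.arr 13 p ≤ H := by
  refine Run.of_small fun h2 hsm => ?_
  have hIT : (((k + n + 1) * (k + n + 1) : ℕ) : ℤ) ≤ H := h6 ▸ (hsm 6 (by decide)).2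
  have hKX : k + n ≤ X := by nlinarith
  have hV : (0 : ℤ) ≤ n * (2 * M) := by positivity
  have hpow : ∀ r, r ≤ (k + n + 1) * (k + n + 1) → 2 ^ r * (n * (2 * M)) ≤ H := fun r hr =>
    (mul_le_mul_of_nonneg_right (pow_le_pow_right₀ (by norm_num) hr) hV).trans hH
  have hVH : n * (2 * M) ≤ (H : ℤ) := by simpa using hpow 0 (by omega)
  refine Run.seq_of (writeTableau_run hd hKX hT h0) ?_
  intro s1 hF1 h8
  refine Run.seq_of (writeProducts_run (hd.of_frame hF1 rfl rfl rfl) hKX hT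
    (by rw [hF1.arr 5 rfl]; exact hx) (by rw [hF1.arr 6 rfl]; exact hy) h8 hM hxM hyM hVH) ?_
  rintro s2 hF2 ⟨h9, h10⟩
  refine Run.seq (Run.assign (by decide) (by simp) (by constructor <;> simp) ?_)
  have d3 : Dims k n (s2.setVar 5 0) := by
    have := (hd.of_frame hF1 rfl rfl rfl).of_frame hF2 rfl rfl rfl
    exact ⟨by simp [this.rows], by simp [this.cols], by simp [this.height]⟩
  refine Run.forLoop ((k + n + 1) * (k + n + 1)) ?_ hX (by decide) (by decide) rfl rfl (by decide)
    (fun r s' => ∃ N, WalkState T (y - x₀) (n * (2 * M)) r N s') ?_ ?_ ?_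
  · simp [hF2.var 6 rfl, hF1.var 6 rfl, h6]
  · refine ⟨0, ⟨_, (isTableau_stackRow T).congr ?_⟩, by simp, isWalk_init ?_ ?_ fun i hi => ?_⟩
    · simpa [hF2.arr 8 rfl] using h8
    · simpa using h9
    · simpa using h10
    · have hst : ∀ j, |stackRow T i j| ≤ 1 := fun j => (isTableau_stackRow T).abs_le_one hT hi j
      refine (Finset.abs_sum_le_sum_abs _ _).trans ?_
      refine (Finset.sum_le_card_nsmul _ _ (2 * M) fun j _ => ?_).trans (by simp)
      rw [abs_mul]
      have h3 := abs_sub (y j) (x₀ j)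
      simp only [Pi.sub_apply]
      nlinarith [hxM j, hyM j, hst j, abs_nonneg (y j - x₀ j), abs_nonneg (stackRow T i j)]
  · rintro r hr s' hF - ⟨N, hw⟩
    refine (step_run hT (d3.of_frame hF rfl rfl rfl) hKX (hpow r hr.le) hV (by omega) hw).mono ?_
    rintro s'' - ⟨N', hw'⟩
    exact ⟨N', hw'.tableau, by simpa using hw'.count, hw'.walk⟩
  · rintro s' hF ⟨N, hw⟩
    exact ⟨N, hw.count, hw.walk.count, hw.walk.isDecomposition rfl, fun p hp =>
      (hw.walk.lam_mem p hp).2.trans hVH⟩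

end Proximity

/-! ### Sets of reachable residues -/

section Reach

variable {m : ℕ}

/-- The residues `h + ∑ μ_p g_p` with `μ ≤ κ`. -/
def reach (N : ℕ) (κ : ℕ → ℕ) (g : ℕ → ZMod m) (h : ZMod m) : Set (ZMod m) :=
  {r | ∃ μ : ℕ → ℕ, (∀ p, p < N → μ p ≤ κ p) ∧ r = h + ∑ p ∈ Finset.range N, (μ p : ZMod m) * g p}

/-- The residues `y + c g` with `y ∈ Y` and `c ≤ C`. -/
def extend (Y : Set (ZMod m)) (g : ZMod m) (C : ℕ) : Set (ZMod m) :=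
  {r | ∃ y ∈ Y, ∃ c : ℕ, c ≤ C ∧ r = y + c * g}

theorem reach_zero (κ : ℕ → ℕ) (g : ℕ → ZMod m) (h : ZMod m) : reach 0 κ g h = {h} := by
  ext r
  simp only [reach, Finset.range_zero, Finset.sum_empty, add_zero, Set.mem_ofPred_eq,
    Set.mem_singleton_iff]
  exact ⟨fun ⟨_, _, h⟩ => h, fun h => ⟨fun _ => 0, by simp, h⟩⟩

theorem sum_update (N : ℕ) (μ : ℕ → ℕ) (g : ℕ → ZMod m) {a c : ℕ} (ha : a < N) :
    ∑ p ∈ Finset.range N, (Function.update μ a c p : ZMod m) * g p =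
      ∑ p ∈ Finset.range N, (Function.update μ a 0 p : ZMod m) * g p + c * g a := by
  have ha' : a ∈ Finset.range N := Finset.mem_range.2 ha
  rw [← Finset.add_sum_erase _ _ ha', ← Finset.add_sum_erase _ _ ha']
  have : ∀ c, ∑ p ∈ (Finset.range N).erase a, (Function.update μ a c p : ZMod m) * g p =
      ∑ p ∈ (Finset.range N).erase a, (μ p : ZMod m) * g p := fun c =>
    Finset.sum_congr rfl fun p hp => by rw [Function.update_of_ne (Finset.ne_of_mem_erase hp)]
  rw [this, this]
  simp only [Function.update_self, Nat.cast_zero]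
  ring

theorem reach_succ (N : ℕ) (κ : ℕ → ℕ) (g : ℕ → ZMod m) (h : ZMod m) :
    reach (N + 1) κ g h = extend (reach N κ g h) (g N) (κ N) := by
  ext r
  constructor
  · rintro ⟨μ, hμ, rfl⟩
    refine ⟨_, ⟨μ, fun p hp => hμ p (by omega), rfl⟩, μ N, hμ N (by omega), ?_⟩
    rw [Finset.sum_range_succ]
    ring
  · rintro ⟨y, ⟨μ, hμ, rfl⟩, c, hc, rfl⟩
    refine ⟨Function.update μ N c, fun p hp => ?_, ?_⟩
    · rcases Nat.lt_succ_iff_lt_or_eq.1 hp with hp | rfl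
      · rw [Function.update_of_ne hp.ne]
        exact hμ p hp
      · simpa using hc
    · rw [Finset.sum_range_succ, Function.update_self, add_assoc]
      congr 2
      exact Finset.sum_congr rfl fun p hp => by
        rw [Function.update_of_ne (Finset.mem_range.1 hp).ne]

theorem extend_zero (Y : Set (ZMod m)) (g : ZMod m) : extend Y g 0 = Y := by
  ext r
  constructor
  · rintro ⟨y, hy, c, hc, rfl⟩
    obtain rfl : c = 0 := by omega
    simpa using hy
  · exact fun hr => ⟨r, hr, 0, le_rfl, by simp⟩

/-- For `q ≤ C + 1` the intervals `[0, C]` and `[q, C + q]` together are `[0, C + q]`. A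
multiplicity is thus reached by doubling, with logarithmically many shifts. -/
theorem extend_add (Y : Set (ZMod m)) (g : ZMod m) {C q : ℕ} (hq : q ≤ C + 1) :
    extend Y g (C + q) = extend Y g C ∪ {r | ∃ y ∈ extend Y g C, r = y + q * g} := by
  ext r
  constructor
  · rintro ⟨y, hy, c, hc, rfl⟩
    by_cases hcC : c ≤ C
    · exact .inl ⟨y, hy, c, hcC, rfl⟩
    · refine .inr ⟨_, ⟨y, hy, c - q, by omega, rfl⟩, ?_⟩
      rw [Nat.cast_sub (by omega)]
      ring
  · rintro (⟨y, hy, c, hc, rfl⟩ | ⟨_, ⟨y, hy, c, hc, rfl⟩, rfl⟩)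
    · exact ⟨y, hy, c, by omega, rfl⟩
    · exact ⟨y, hy, c + q, by omega, by push_cast; ring⟩

/-- The vector `a` may be added last, although it is not the last in the order. This is what lets
its multiples be represented by intervals. -/
theorem extend_reach (N : ℕ) (κ : ℕ → ℕ) (g : ℕ → ZMod m) (h : ZMod m) {a : ℕ} (ha : a < N) :
    extend (reach N (Function.update κ a 0) g h) (g a) (κ a) = reach N κ g h := by
  ext r
  constructor
  · rintro ⟨y, ⟨μ, hμ, rfl⟩, c, hc, rfl⟩
    refine ⟨Function.update μ a c, fun p hp => ?_, ?_⟩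
    · by_cases hpa : p = a
      · subst hpa; simpa using hc
      · simpa [hpa] using hμ p hp
    · have h0 : Function.update μ a 0 = μ := by
        have := hμ a ha
        simp only [Function.update_self, Nat.le_zero] at this
        rw [← this, Function.update_eq_self]
      rw [sum_update N μ g ha, h0, add_assoc]
  · rintro ⟨μ, hμ, rfl⟩
    refine ⟨_, ⟨Function.update μ a 0, fun p hp => ?_, rfl⟩, μ a, hμ a ha, ?_⟩
    · by_cases hpa : p = a
      · subst hpa; simp
      · simpa [hpa] using hμ p hp
    · rw [add_assoc, ← sum_update N μ g ha, Function.update_eq_self]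

/-- Every solution below `κ` agrees with `κ` at `p`. -/
def IsTight (N : ℕ) (κ : ℕ → ℕ) (g : ℕ → ZMod m) (h : ZMod m) (S : Set (ZMod m)) (p : ℕ) : Prop :=
  ∀ μ : ℕ → ℕ, (∀ p, p < N → μ p ≤ κ p) → h + ∑ p ∈ Finset.range N, (μ p : ZMod m) * g p ∈ S →
    μ p = κ p

variable {N : ℕ} {κ : ℕ → ℕ} {g : ℕ → ZMod m} {h : ZMod m} {S : Set (ZMod m)}

theorem IsTight.update {p q c : ℕ} (ht : IsTight N κ g h S q) (hc : c ≤ κ p) (hqp : q ≠ p) :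
    IsTight N (Function.update κ p c) g h S q := by
  intro μ hμ hS
  rw [Function.update_of_ne hqp]
  refine ht μ (fun p' hp' => (hμ p' hp').trans ?_) hS
  by_cases hp : p' = p
  · subst hp; simpa using hc
  · simp [hp]

/-- A solution with a value below `c` at `p` would make the problem solvable with that value as the
bound at `p`. -/
theorem isTight_update {p c : ℕ} (hp : p < N)
    (hmin : ∀ c', c' < c → ¬ (reach N (Function.update κ p c') g h ∩ S).Nonempty) :
    IsTight N (Function.update κ p c) g h S p := by
  intro μ hμ hS
  rw [Function.update_self]
  by_contra hne
  have h1 := hμ p hp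
  rw [Function.update_self] at h1
  refine hmin (μ p) (by omega) ⟨_, ⟨μ, fun p' hp' => ?_, rfl⟩, hS⟩
  by_cases hpp : p' = p
  · subst hpp; simp
  · simpa [hpp] using hμ p' hp'

theorem reach_mono {κ' : ℕ → ℕ} (hκ : ∀ p, p < N → κ p ≤ κ' p) :
    reach N κ g h ⊆ reach N κ' g h :=
  fun _ ⟨μ, hμ, hr⟩ => ⟨μ, fun p hp => (hμ p hp).trans (hκ p hp), hr⟩

/-! ### Shifting and searching tables -/

namespace IsTable

variable {γ d e o l W Z : ℤ} {Y : Set (ZMod m)} {Lo Hi Lo' Hi' : ℤ → ℤ}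

/-- Inserting the shifts of all stored residues into a table. -/
theorem shift (ht : IsTable m γ d e o l W Z Y Lo Hi) (x : ZMod m)
    (ht' : IsTable m γ d e o l W Z
      (Y ∪ {r | ∃ i, 0 ≤ i ∧ i < Z ∧ 0 ≤ Lo i ∧ (r = Lo i + x ∨ r = Hi i + x)}) Lo' Hi') :
    IsTable m γ d e o l W Z (Y ∪ {r | ∃ y ∈ Y, r = y + x}) Lo' Hi' := by
  refine ht'.mono (Set.union_subset_union_right _ ?_) ?_
  · rintro r ⟨i, h0, h1, h2, rfl | rfl⟩
    · exact ⟨_, (ht.mem i h0 h1 h2).1, rfl⟩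
    · exact ⟨_, (ht.mem i h0 h1 h2).2, rfl⟩
  · rintro y (hy | ⟨y, hy, rfl⟩) c hc hcl
    · exact ⟨y, .inl hy, c, hc, hcl, rfl⟩
    · obtain ⟨i, h0, h1, h2, c', h3, h4, h5⟩ := ht.cover y hy c hc hcl
      rcases h5 with h5 | h5
      · exact ⟨Lo i + x, .inr ⟨i, h0, h1, h2, .inl rfl⟩, c', h3, h4, by linear_combination h5⟩
      · exact ⟨Hi i + x, .inr ⟨i, h0, h1, h2, .inr rfl⟩, c', h3, h4, by linear_combination h5⟩

/-- The table covers all intervals that start in `Y`, and everything it stores comes from `Y`, so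
searching the stored intervals is exact and not merely an approximation. -/
theorem exists_iff (ht : IsTable m γ d e o l W Z Y Lo Hi) {L : ℕ} (hl : l = (L : ℤ) + 1) :
    (extend Y γ L ∩ S).Nonempty ↔ ∃ r ∈ S, ∃ i, 0 ≤ i ∧ i < Z ∧ 0 ≤ Lo i ∧
      ∃ c : ℤ, 0 ≤ c ∧ c < l ∧ (r = Lo i + c * γ ∨ r = Hi i + c * γ) := by
  constructor
  · rintro ⟨r, ⟨y, hy, c, hc, rfl⟩, hS⟩
    obtain ⟨i, h0, h1, h2, c', h3, h4, h5⟩ := ht.cover y hy c (by omega) (by omega)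
    exact ⟨_, hS, i, h0, h1, h2, c', h3, h4, by simpa using h5⟩
  · rintro ⟨r, hr, i, h0, h1, h2, c, h3, h4, h5⟩
    lift c to ℕ using h3
    rcases h5 with rfl | rfl
    · exact ⟨_, ⟨_, (ht.mem i h0 h1 h2).1, c, by omega, by simp⟩, hr⟩
    · exact ⟨_, ⟨_, (ht.mem i h0 h1 h2).2, c, by omega, by simp⟩, hr⟩

end IsTable

theorem isTable_empty {γ d e o l W Z : ℤ} {Lo Hi : ℤ → ℤ} (hm : 0 < m)
    (hLo : ∀ i, 0 ≤ i → i < Z → Lo i = -1) (hHi : ∀ i, 0 ≤ i → i < Z → Hi i = -1) :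
    IsTable m γ d e o l W Z ∅ Lo Hi := by
  have h1 : ∀ i, 0 ≤ i → i < Z → ¬ 0 ≤ Lo i := fun i h0 h1 => by rw [hLo i h0 h1]; omega
  exact
    { mem := fun i h0 h2 h => absurd h (h1 i h0 h2)
      cover := fun y hy => absurd hy (Set.notMem_empty y)
      lo_lt := fun i h0 h2 => by rw [hLo i h0 h2]; omega
      neg_one_le := fun i h0 h2 => by rw [hLo i h0 h2]
      hi_nonneg := fun i h0 h2 => by rw [hHi i h0 h2]
      hi_lt := fun i h0 h2 => by rw [hHi i h0 h2]; omega
      lo_bucket := fun i h0 h2 h => absurd h (h1 i h0 h2)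
      hi_bucket := fun i h0 h2 h => absurd h (h1 i h0 h2)
      le := fun i h0 h2 h => absurd h (h1 i h0 h2) }

/-- A multiplier below `l ≤ o` is its own remainder modulo `o` and hence equals the coordinate;
membership in an interval costs a constant number of operations. -/
theorem IsGcd.mem_iff [NeZero m] {γ d e o l c : ℤ} (h : IsGcd m γ d e o) (hl : l ≤ o) :
    (c % d = 0 ∧ coord d e o c < l) ↔ ∃ x : ℤ, 0 ≤ x ∧ x < l ∧ (c : ZMod m) = x * γ := by
  constructor
  · rintro ⟨h1, h2⟩
    refine ⟨coord d e o c, h.coord_nonneg c, h2, ?_⟩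
    have := h.coord_eq c
    rwa [h1, Int.cast_zero, zero_add] at this
  · rintro ⟨x, h0, h1, h2⟩
    obtain ⟨h3, h4⟩ := h.coord_unique h2
    rw [Int.emod_eq_of_lt h0 (by omega)] at h4
    exact ⟨h3, by omega⟩

/-- The order does not depend on the run of Euclid's algorithm that computed it, so the bound on a
multiplicity from its reduction can be used with the order computed later for the table. -/
theorem IsGcd.order_unique [NeZero m] {γ d e o d' e' o' : ℤ} (h : IsGcd m γ d e o)
    (h' : IsGcd m γ d' e' o') : o = o' := by
  have key : ∀ {d e o d' e' o' : ℤ}, IsGcd m γ d e o → IsGcd m γ d' e' o' → o ∣ o' := by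
    intro d e o d' e' o' h h'
    have h1 := (h.coord_unique (c := 0) (x := o') (by rw [h'.o_mul]; simp)).2
    have h2 : coord d e o 0 = 0 := by simp [coord]
    exact Int.dvd_of_emod_eq_zero (by omega)
  exact Int.dvd_antisymm h.o_pos.le h'.o_pos.le (key h h') (key h' h)

end Reach

/-! ### The program: residues and their orders

Variables: `2` modulus, `19` residue, `21`–`26` Euclid's algorithm, `30`, `31`, `32` greatest common
divisor with the modulus, its coefficient, order.
Array `14`: residues of the vectors found. -/

namespace Proximity

variable {H X k n m : ℕ} {s : Store}

def euclidStep : Cmd :=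
  .assign 25 (.var 21 / .var 22) ;;
  .assign 26 (.var 21 - .var 25 * .var 22) ;;
  .assign 21 (.var 22) ;;
  .assign 22 (.var 26) ;;
  .assign 26 ((.var 23 - .var 25 * .var 24) % .var 2) ;;
  .assign 23 (.var 24) ;;
  .assign 24 (.var 26)

def euclid : Cmd :=
  .assign 21 (.var 2) ;;
  .assign 22 (.var 19) ;;
  .assign 23 0 ;;
  .assign 24 1 ;;
  .loop (.not (.eq (.var 22) 0)) euclidStep ;;
  .assign 30 (.var 21) ;;
  .assign 31 (.var 23) ;;
  .assign 32 (.var 2 / .var 21)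

/-- `dvd` says that common divisors of the two remainders divide `m` and `g`, which makes the last
remainder a common divisor. The coefficients are kept modulo `m`, so they never grow. `mul_le` is
the potential for the running time: each division at least halves the product of consecutive
remainders. -/
structure EuclidInv (m : ℕ) (g : ℤ) (t : ℕ) (r₀ r₁ c₀ c₁ : ℤ) : Prop where
  nonneg : 0 ≤ r₁
  lt : r₁ < r₀
  le : r₀ ≤ m
  c₀_nonneg : 0 ≤ c₀
  c₀_le : c₀ ≤ m
  c₁_nonneg : 0 ≤ c₁
  c₁_le : c₁ ≤ m
  eq₀ : (r₀ : ZMod m) = c₀ * g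
  eq₁ : (r₁ : ZMod m) = c₁ * g
  dvd : ∀ x, x ∣ r₀ → x ∣ r₁ → x ∣ m ∧ x ∣ g
  mul_le : r₀ * r₁ * 2 ^ t ≤ m * m

theorem EuclidInv.step {g : ℤ} {t : ℕ} {r₀ r₁ c₀ c₁ : ℤ} (h : EuclidInv m g t r₀ r₁ c₀ c₁)
    (h1 : r₁ ≠ 0) :
    EuclidInv m g (t + 1) r₁ (r₀ - r₀ / r₁ * r₁) c₁ ((c₀ - r₀ / r₁ * c₁) % m) := by
  have hpos : 0 < r₁ := lt_of_le_of_ne h.nonneg (Ne.symm h1)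
  have hm : (0 : ℤ) < m := lt_of_lt_of_le (hpos.trans h.lt) h.le
  have hmod : r₀ - r₀ / r₁ * r₁ = r₀ % r₁ := by
    have := Int.emod_add_mul_ediv r₀ r₁
    linarith
  have hm1 := Int.emod_nonneg r₀ h1
  have hm2 := Int.emod_lt_of_pos r₀ hpos
  have hhalf : 2 * (r₀ % r₁) ≤ r₀ := by
    have h3 := Int.emod_add_mul_ediv r₀ r₁
    have h4 : 1 ≤ r₀ / r₁ := (Int.le_ediv_iff_mul_le hpos).2 (by linarith [h.lt])
    nlinarith
  refine ⟨by rw [hmod]; exact hm1, by rw [hmod]; exact hm2, h.lt.le.trans h.le, h.c₁_nonneg, h.c₁_le,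
    Int.emod_nonneg _ hm.ne', (Int.emod_lt_of_pos _ hm).le, h.eq₁, ?_, fun x hx hx' => ?_, ?_⟩
  · rw [ZMod.intCast_mod]
    push_cast
    rw [h.eq₀, h.eq₁]
    ring
  · refine h.dvd x ?_ hx
    have := dvd_add hx' (hx.mul_left (r₀ / r₁))
    simpa using this
  · rw [hmod]
    have := h.mul_le
    have h2 : (0 : ℤ) ≤ 2 ^ t := by positivity
    calc r₁ * (r₀ % r₁) * 2 ^ (t + 1) = (r₁ * 2 ^ t) * (2 * (r₀ % r₁)) := by ring
      _ ≤ (r₁ * 2 ^ t) * r₀ := mul_le_mul_of_nonneg_left hhalf (by positivity)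
      _ = r₀ * r₁ * 2 ^ t := by ring
      _ ≤ m * m := this

/-- While the remainder is nonzero, the product of the remainders is at least one, so `2 ^ t ≤ m² <
2 ^ (2 * m.size)`. -/
theorem EuclidInv.lt_size {g : ℤ} {t : ℕ} {r₀ r₁ c₀ c₁ : ℤ} (h : EuclidInv m g t r₀ r₁ c₀ c₁)
    (h1 : r₁ ≠ 0) : t < 2 * m.size := by
  have hpos : 0 < r₁ := lt_of_le_of_ne h.nonneg (Ne.symm h1)
  have h2 := h.mul_le
  have h3 : (2 : ℤ) ^ t ≤ m * m := by
    have : 1 ≤ r₀ * r₁ := by nlinarith [h.lt]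
    nlinarith [pow_pos (show (0 : ℤ) < 2 by norm_num) t]
  have h4 : 2 ^ t ≤ m * m := by exact_mod_cast h3
  have h5 : m * m < 2 ^ (2 * m.size) := by
    rw [two_mul, pow_add]
    exact Nat.mul_lt_mul'' (Nat.lt_size_self m) (Nat.lt_size_self m)
  exact (Nat.pow_lt_pow_iff_right (by norm_num)).1 (h4.trans_lt h5)

theorem EuclidInv.isGcd {g : ℤ} {t : ℕ} {r₀ c₀ c₁ : ℤ} (h : EuclidInv m g t r₀ 0 c₀ c₁) :
    IsGcd m g r₀ c₀ (m / r₀) := by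
  obtain ⟨h1, h2⟩ := h.dvd r₀ dvd_rfl (dvd_zero _)
  exact ⟨h.lt, Int.mul_ediv_cancel' h1, h.c₀_nonneg, h.c₀_le, h2, h.eq₀.symm⟩

theorem euclid_run {g : ℤ} (h2 : s.var 2 = m) (hg : s.var 19 = g) (hg0 : 0 ≤ g) (hgm : g < m)
    (hX : 2 * m.size ≤ X) :
    Run H X euclid s fun s' => IsGcd m g (s'.var 30) (s'.var 31) (s'.var 32) := by
  refine Run.of_small fun hH hsm => ?_
  have hmH : (m : ℤ) ≤ H := h2 ▸ (hsm 2 (by decide)).2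
  refine Run.seq (Run.assign (by decide) (by simp) (hsm 2 (by decide)) ?_)
  refine Run.seq (Run.assign (by decide) (by simp) ?_ ?_)
  · simp only [Expr.eval_var, Store.var_setVar]
    exact hsm 19 (by decide)
  refine Run.seq (Run.assign (by decide) (by simp) (by simp [Within]) ?_)
  refine Run.seq (Run.assign (by decide) (by simp) (by simp [Within]; omega) ?_)
  refine Run.seq_of (Run.loop (Q := fun s' => s'.var 22 = 0 ∧
      ∃ t, EuclidInv m g t (s'.var 21) (s'.var 22) (s'.var 23) (s'.var 24)) (by decide) (2 * m.size) hX
    (fun t s' => EuclidInv m g t (s'.var 21) (s'.var 22) (s'.var 23) (s'.var 24)) ?_ ?_ ?_ ?_ ?_) ?_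
  · simp [h2, hg]
    exact ⟨hg0, hgm, le_rfl, le_rfl, by omega, by omega, by omega, by simp, by simp,
      fun x hx hx' => ⟨hx, hx'⟩, by simp; nlinarith⟩
  · intro t s' _ _
    simp
  · intro t s' _ hI h
    simp at h
    exact hI.lt_size h
  · intro t s' hF hI h
    simp at h
    have hm := hF.var 2 rfl
    simp [h2] at hm
    have hst := hI.step h
    have hq : Within H (s'.var 21 / s'.var 22) := by
      have h0 := hI.nonneg
      have h1 := hI.lt
      have h3 := hI.le
      have h4 : 0 ≤ s'.var 21 / s'.var 22 := Int.ediv_nonneg (by omega) h0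
      have h5 : s'.var 21 / s'.var 22 ≤ s'.var 21 := Int.ediv_le_self _ (by omega)
      constructor <;> omega
    refine Run.seq (Run.assign (by decide) (by simp) (by simpa using hq) ?_)
    refine Run.seq (Run.assign (by decide) (by simp) ?_ ?_)
    · simp
      have := hst.nonneg
      have := hst.lt.trans hI.lt
      have := hI.le
      constructor <;> omega
    refine Run.seq (Run.assign (by decide) (by simp) ?_ ?_)
    · simp
      have := hst.nonneg
      have := hst.lt
      have := hst.le
      constructor <;> omega
    refine Run.seq (Run.assign (by decide) (by simp) ?_ ?_)
    · simp
      have := hst.nonneg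
      have := hst.lt
      have := hst.le
      constructor <;> omega
    refine Run.seq (Run.assign (by decide) (by simp) ?_ ?_)
    · simp [hm]
      have := hst.c₁_nonneg
      have := hst.c₁_le
      constructor <;> omega
    refine Run.seq (Run.assign (by decide) (by simp) ?_ ?_)
    · simp
      have := hI.c₁_nonneg
      have := hI.c₁_le
      constructor <;> omega
    refine Run.assign (by decide) (by simp) ?_ ?_
    · simp [hm]
      have := hst.c₁_nonneg
      have := hst.c₁_le
      constructor <;> omega
    · simpa [hm] using hst
  · intro t s' _ hI h
    simp at h
    exact ⟨h, t, hI⟩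
  · rintro s' hF ⟨h0, t, hI⟩
    rw [h0] at hI
    have hm := hF.var 2 rfl
    simp [h2] at hm
    have b1 := hI.lt
    have b2 := hI.le
    have b3 := hI.c₀_nonneg
    have b4 := hI.c₀_le
    have b5 : 0 ≤ (m : ℤ) / s'.var 21 := Int.ediv_nonneg (by omega) (by omega)
    have b6 : (m : ℤ) / s'.var 21 ≤ m := Int.ediv_le_self _ (by omega)
    refine Run.seq (Run.assign (by decide) (by simp) ?_ ?_)
    · simp
      constructor <;> omega
    refine Run.seq (Run.assign (by decide) (by simp) ?_ ?_)
    · simp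
      constructor <;> omega
    refine Run.assign (by decide) (by simp) ?_ ?_
    · simp [hm]
      constructor <;> omega
    · simpa [hm] using hI.isGcd

/-- Computes the residue of every vector found and reduces its multiplicity modulo the order. -/
def residues : Cmd :=
  .forLoop 20 5
    (.sum 16 9 1 (.arr 3 (.var 9) * cell 12 20 9) ;;
      .assign 19 (.var 16 % .var 2) ;;
      .write 14 (.var 20) (.var 19) ;;
      euclid ;;
      .write 13 (.var 20) (.arr 13 (.var 20) % .var 32))

/-- The reduced multiplicity `l'` and the residue `g` of a vector with multiplicity `l` and product
`x` with `γ`. -/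
structure IsReduced (m : ℕ) (x l g l' : ℤ) : Prop where
  nonneg : 0 ≤ g
  lt : g < m
  eq : (g : ZMod m) = x
  lam_nonneg : 0 ≤ l'
  lam_le : l' ≤ l
  mul_eq : (l' : ZMod m) * g = l * g
  lt_order : ∃ d e o, IsGcd m g d e o ∧ l' < o

/-- Dropping multiples of the order leaves the residue of the combination unchanged and only lowers
multiplicities, so conformality keeps its consequences. Afterwards the multiplicities are at most
`m`, whatever the size of `y`, and bisection over them takes `O(log m)` rounds. -/
theorem residues_run (hm : 0 < m) (h1 : s.var 1 = n) (h2 : s.var 2 = m) {N : ℕ} (h5 : s.var 5 = N)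
    (hN : N ≤ X) (hn : n ≤ X) (hX : 2 * m.size ≤ X) {γ : Fin n → ℤ}
    (hγ : ∀ j : Fin n, s.arr 3 (j : ℤ) = γ j) {M : ℤ} (hM : M ≤ H) (hγM : ∀ j, |γ j| ≤ M)
    (hnM : n * M ≤ H) (hu : ∀ p, p < N → ∀ j, |mat n (s.arr 12) p j| ≤ 1)
    (hlam : ∀ p : ℕ, p < N → 0 ≤ s.arr 13 p ∧ s.arr 13 p ≤ H) :
    Run H X residues s fun s' => ∀ p : ℕ, p < N →
      IsReduced m (dotProduct γ (mat n (s.arr 12) p)) (s.arr 13 p) (s'.arr 14 p) (s'.arr 13 p) := by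
  have : NeZero m := ⟨hm.ne'⟩
  refine Run.of_small fun hH hsm => ?_
  have hmH : (m : ℤ) ≤ H := h2 ▸ (hsm 2 (by decide)).2
  refine Run.forLoop N h5 hN (by decide) (by decide) rfl rfl (by decide)
    (fun r s' => (∀ p : ℕ, p < r → IsReduced m (dotProduct γ (mat n (s.arr 12) p)) (s.arr 13 p)
      (s'.arr 14 p) (s'.arr 13 p)) ∧ ∀ p : ℕ, r ≤ p → p < N → s'.arr 13 p = s.arr 13 p) (by simp) ?_
    fun s' _ h => h.1
  rintro p hp s1 hF1 h20 ⟨hI1, hI2⟩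
  have c1 := (hF1.var 1 rfl).trans h1
  have c2 := (hF1.var 2 rfl).trans h2
  have a12 := hF1.arr 12 rfl
  have a3 := hF1.arr 3 rfl
  refine Run.seq_of (Run.sum n c1 hn (by decide) (by decide) (by decide) (by decide)
    (by decide) (by decide) (by decide)
    (fun j => if h : j < n then γ ⟨j, h⟩ * mat n (s.arr 12) p ⟨j, h⟩ else 0) M
    (fun j hj => ?_) hnM ?_) ?_
  · rw [dif_pos hj, abs_mul]
    have h3 := hu p hp ⟨j, hj⟩
    have h4 := hγM ⟨j, hj⟩
    nlinarith [abs_nonneg (γ ⟨j, hj⟩), abs_nonneg (mat n (s.arr 12) p ⟨j, hj⟩)]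
  · intro j hj s2 hF2 h9
    have b3 : s2.arr 3 j = γ ⟨j, hj⟩ := by
      rw [hF2.arr 3 rfl, a3]
      exact hγ ⟨j, hj⟩
    have b12 : s2.arr 12 (p * n + (j : ℤ)) = mat n (s.arr 12) p ⟨j, hj⟩ := by
      rw [hF2.arr 12 rfl, a12]
      rfl
    simp [(hF2.var 20 rfl).trans h20, (hF2.var 1 rfl).trans c1, h9, b3, b12, hj]
    exact ⟨.of_abs_le (hγM _) hM, .of_abs_le (hu p hp _) (by omega)⟩
  intro s2 hF2 h16
  have hdot : s2.var 16 = dotProduct γ (mat n (s.arr 12) p) := by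
    rw [h16, Finset.sum_range]
    simp [dotProduct]
  set x := dotProduct γ (mat n (s.arr 12) p) with hx
  have hm' : (0 : ℤ) < m := by exact_mod_cast hm
  have hx0 := Int.emod_nonneg x hm'.ne'
  have hxm := Int.emod_lt_of_pos x hm'
  have d2 := (hF2.var 2 rfl).trans c2
  have d20 := (hF2.var 20 rfl).trans h20
  have d13 := hF2.arr 13 rfl
  have d14 := hF2.arr 14 rfl
  refine Run.seq (Run.assign (by decide) (by simp) ?_ ?_)
  · simp [hdot, d2]
    constructor <;> omega
  refine Run.seq (Run.write (by decide) (by decide) (by simp) (by simp) ?_)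
  simp only [Expr.eval_mod, Expr.eval_var, hdot, d2, Store.var_setVar]
  simp only [Nat.reduceEqDiff, if_false, if_true, d20]
  refine Run.seq_of (euclid_run (m := m) (g := x % m) (by simp [d2]) (by simp) hx0 hxm hX) ?_
  intro s3 hF3 hgcd
  have e20 := hF3.var 20 rfl
  have e13 := hF3.arr 13 rfl
  have e14 := hF3.arr 14 rfl
  simp at e20 e13 e14
  rw [d20] at e20
  rw [d13] at e13
  have hl := hlam p hp
  have hI2p := hI2 p le_rfl hp
  refine Run.write (by decide) (by decide) (by simp) ?_ ?_
  · simp [e20, e13, hI2p]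
    constructor <;> omega
  · simp [e20, e13, e14, d14]
    refine ⟨fun p' hp' => ?_, fun p' hp' hpN => ?_⟩
    · by_cases hpp : p' = p
      · subst hpp
        simp only [if_true, hI2p]
        have ho := hgcd.o_pos
        have q0 := Int.emod_nonneg (s.arr 13 p') ho.ne'
        refine ⟨hx0, hxm, by rw [ZMod.intCast_mod], q0, ?_, ?_, _, _, _, hgcd,
          Int.emod_lt_of_pos _ ho⟩
        · have := Int.emod_add_mul_ediv (s.arr 13 p') (s3.var 32)
          have : 0 ≤ s.arr 13 p' / s3.var 32 := Int.ediv_nonneg hl.1 ho.le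
          nlinarith
        · have h3 := congrArg (Int.cast : ℤ → ZMod m)
            (Int.emod_add_mul_ediv (s.arr 13 p') (s3.var 32))
          push_cast at h3
          rw [← h3]
          have := hgcd.o_mul
          linear_combination (-((s.arr 13 p' / s3.var 32 : ℤ) : ZMod m)) * this
      · simp only [hpp, if_false]
        exact hI1 p' (by omega)
    · rw [if_neg (by omega)]
      exact hI2 p' (by omega) hpN

end Proximity

/-! ### The program: deciding solvability

Variables: `3` number of allowed residues, `27` residue of `x₀`, `29` vector of largest multiplicity,
`33` its multiplicity plus one, `34` buckets for each remainder, `35` buckets, `39` answer,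
`40` vector, `41` copies treated, `42` copies added, `43` shift, `44` bucket, `45` residue,
`46` its bucket, `47` allowed residue.
Arrays: `4` allowed residues, `15` and `16` the table, `17` and `18` its copy. -/

namespace Proximity

variable {H X k n m : ℕ} {s : Store}

abbrev coordExpr (r : Expr) : Expr := (r / .var 30 * .var 31) % .var 32

def insert : Cmd :=
  .assign 46 (.var 45 % .var 30 * .var 34 + coordExpr (.var 45) / .var 33) ;;
  .assign 51 (.arr 15 (.var 46)) ;;
  .assign 52 (.arr 16 (.var 46)) ;;
  .ite (.lt (.var 51) 0)
    (.write 15 (.var 46) (.var 45) ;; .write 16 (.var 46) (.var 45))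
    (.ite (.lt (coordExpr (.var 45)) (coordExpr (.var 51))) (.write 15 (.var 46) (.var 45)) .skip ;;
      .ite (.lt (coordExpr (.var 52)) (coordExpr (.var 45))) (.write 16 (.var 46) (.var 45)) .skip)

/-- The shifts are inserted into the table from which they are taken, so the old content is copied
first. Shifting the two representatives of each bucket is enough, since a shift of a cover is a
cover of the shifted set. -/
def shift : Cmd :=
  .forLoop 44 35 (.write 17 (.var 44) (.arr 15 (.var 44))) ;;
  .forLoop 44 35 (.write 18 (.var 44) (.arr 16 (.var 44))) ;;
  .forLoop 44 35 (.ite (.lt (.arr 17 (.var 44)) 0) .skip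
    (.assign 45 ((.arr 17 (.var 44) + .var 43) % .var 2) ;; insert ;;
      .assign 45 ((.arr 18 (.var 44) + .var 43) % .var 2) ;; insert))

/-- After `C` copies have been treated, one shift by `q ≤ C + 1` copies treats `C + q`; the last
shift is shortened so as to end exactly at the multiplicity. -/
def addVector : Cmd :=
  .assign 41 0 ;;
  .loop (.lt (.var 41) (.arr 13 (.var 40)))
    (.ite (.le (.var 41 + 1) (.arr 13 (.var 40) - .var 41)) (.assign 42 (.var 41 + 1))
        (.assign 42 (.arr 13 (.var 40) - .var 41)) ;;
      .assign 43 (.var 42 * .arr 14 (.var 40) % .var 2) ;;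
      shift ;;
      .assign 41 (.var 41 + .var 42))

/-- Tests whether the allowed residue is in the interval that starts at the residue in array `a`. -/
def memberTest (a : ℕ) : Cmd :=
  .assign 45 ((.arr 4 (.var 47) - .arr a (.var 44)) % .var 2) ;;
  .ite (.and (.eq (.var 45 % .var 30) 0) (.lt (coordExpr (.var 45)) (.var 33))) (.assign 39 1) .skip

def search : Cmd :=
  .assign 39 0 ;;
  .forLoop 47 3 (.forLoop 44 35 (.ite (.lt (.arr 15 (.var 44)) 0) .skip
    (memberTest 15 ;; memberTest 16)))

/-- The vector `var 29` of largest multiplicity is left out of the table: its multiples are the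
intervals that start at the stored residues. -/
def oracle : Cmd :=
  .forLoop 44 35 (.write 15 (.var 44) (.lit (-1))) ;;
  .forLoop 44 35 (.write 16 (.var 44) (.lit (-1))) ;;
  .assign 45 (.var 27) ;;
  insert ;;
  .forLoop 40 5 (.ite (.eq (.var 40) (.var 29)) .skip addVector) ;;
  search

/-- The parameters of the table. -/
structure TableParams (m : ℕ) (g d e o l W : ℤ) (Z : ℕ) (s : Store) : Prop where
  gcd : IsGcd m g d e o
  l_pos : 0 < l
  l_le : l ≤ o
  width : W = o / l + 1
  size : (Z : ℤ) = d * W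
  modulus : s.var 2 = m
  var_d : s.var 30 = d
  var_e : s.var 31 = e
  var_o : s.var 32 = o
  var_l : s.var 33 = l
  var_W : s.var 34 = W
  var_Z : s.var 35 = Z

variable {g d e o l W : ℤ} {Z : ℕ}

theorem TableParams.of_frame {c : Cmd} {s' : Store} (h : TableParams m g d e o l W Z s)
    (hF : Frame c s s') (h2 : c.keepsVar 2 = true) (h30 : c.keepsVar 30 = true)
    (h31 : c.keepsVar 31 = true) (h32 : c.keepsVar 32 = true) (h33 : c.keepsVar 33 = true)
    (h34 : c.keepsVar 34 = true) (h35 : c.keepsVar 35 = true) :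
    TableParams m g d e o l W Z s' :=
  { h with
    modulus := (hF.var 2 h2).trans h.modulus
    var_d := (hF.var 30 h30).trans h.var_d
    var_e := (hF.var 31 h31).trans h.var_e
    var_o := (hF.var 32 h32).trans h.var_o
    var_l := (hF.var 33 h33).trans h.var_l
    var_W := (hF.var 34 h34).trans h.var_W
    var_Z := (hF.var 35 h35).trans h.var_Z }

theorem TableParams.setVar (h : TableParams m g d e o l W Z s) {i : ℕ} {z : ℤ}
    (hi : i ≠ 2 ∧ i ≠ 30 ∧ i ≠ 31 ∧ i ≠ 32 ∧ i ≠ 33 ∧ i ≠ 34 ∧ i ≠ 35) :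
    TableParams m g d e o l W Z (s.setVar i z) := by
  obtain ⟨i1, i2, i3, i4, i5, i6, i7⟩ := hi
  exact { h with
    modulus := by simp [Ne.symm i1, h.modulus]
    var_d := by simp [Ne.symm i2, h.var_d]
    var_e := by simp [Ne.symm i3, h.var_e]
    var_o := by simp [Ne.symm i4, h.var_o]
    var_l := by simp [Ne.symm i5, h.var_l]
    var_W := by simp [Ne.symm i6, h.var_W]
    var_Z := by simp [Ne.symm i7, h.var_Z] }

theorem insert_run [NeZero m] (hp : TableParams m g d e o l W Z s) {Y : Set (ZMod m)}
    (ht : IsTable m g d e o l W Z Y (s.arr 15) (s.arr 16)) {r : ℤ} (hr : s.var 45 = r) (hr0 : 0 ≤ r)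
    (hrm : r < m) :
    Run H X insert s fun s' =>
      IsTable m g d e o l W Z (Insert.insert (r : ZMod m) Y) (s'.arr 15) (s'.arr 16) := by
  refine Run.of_small fun hH hsm => ?_
  have hmH : (m : ℤ) ≤ H := hp.modulus ▸ (hsm 2 (by decide)).2
  have hZH : (Z : ℤ) ≤ H := hp.var_Z ▸ (hsm 35 (by decide)).2
  obtain ⟨hβ0, hβ1⟩ := bucket_bounds hp.gcd hp.l_pos hp.width r
  rw [← hp.size] at hβ1
  have hins := fun {Lo' Hi'} => ht.insert (Lo' := Lo') (Hi' := Hi') hp.gcd hp.l_pos hp.width hp.size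
    hr0 hrm
  set β := bucket d e o l W r with hβ
  have hLW : Within H (s.arr 15 β) := by
    have := ht.neg_one_le β hβ0 hβ1
    have := ht.lo_lt β hβ0 hβ1
    constructor <;> omega
  have hHW : Within H (s.arr 16 β) := by
    have := ht.hi_nonneg β hβ0 hβ1
    have := ht.hi_lt β hβ0 hβ1
    constructor <;> omega
  have hev : (Expr.var 45 % Expr.var 30 * Expr.var 34 + coordExpr (.var 45) / Expr.var 33).eval s
      = β := by
    simp [hr, hp.var_d, hp.var_W, hp.var_l, hp.var_e, hp.var_o, hβ, bucket, coord]
  refine Run.seq (Run.assign (by decide) (by simp) (by rw [hev]; constructor <;> omega) ?_)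
  rw [hev]
  refine Run.seq (Run.assign (by decide) (by simpa using hLW) (by simpa using hLW) ?_)
  refine Run.seq (Run.assign (by decide) (by simpa using hHW) (by simpa using hHW) ?_)
  simp only [Expr.eval_arr, Expr.eval_var, Store.arr_setVar, Store.var_setVar]
  simp only [Nat.reduceEqDiff, if_false, if_true]
  set s3 := ((s.setVar 46 β).setVar 51 (s.arr 15 β)).setVar 52 (s.arr 16 β) with hs3
  have c46 : s3.var 46 = β := by simp [hs3]
  have c51 : s3.var 51 = s.arr 15 β := by simp [hs3]
  have c52 : s3.var 52 = s.arr 16 β := by simp [hs3]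
  have c45 : s3.var 45 = r := by simp [hs3, hr]
  have c30 : s3.var 30 = d := by simp [hs3, hp.var_d]
  have c31 : s3.var 31 = e := by simp [hs3, hp.var_e]
  have c32 : s3.var 32 = o := by simp [hs3, hp.var_o]
  have c15 : s3.arr 15 = s.arr 15 := by simp [hs3]
  have c16 : s3.arr 16 = s.arr 16 := by simp [hs3]
  clear_value s3
  refine Run.ite (by decide) (by simp) (fun h => ?_) fun h => ?_
  · simp [c51] at h
    refine Run.seq (Run.write (by decide) (by decide) (by simp) (by simp) ?_)
    refine Run.write (by decide) (by decide) (by simp) (by simp) ?_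
    simp only [Expr.eval_var, Store.var_setArr, c46, c45]
    refine hins (fun i => ?_) fun i => ?_
    · by_cases hi : i = β <;> simp [hi, c15, h]
    · by_cases hi : i = β <;> simp [hi, c16, h]
  · simp [c51] at h
    have h' : ¬ s.arr 15 β < 0 := by omega
    refine Run.seq (Run.ite (by decide) (by simp) (fun h1 => ?_) fun h1 => ?_)
    · simp [c45, c51, c30, c31, c32] at h1
      refine Run.write (by decide) (by decide) (by simp) (by simp) ?_
      simp only [Expr.eval_var, c46, c45]
      refine Run.ite (by decide) (by simp) (fun h2 => ?_) fun h2 => ?_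
      · simp [c45, c52, c30, c31, c32] at h2
        refine Run.write (by decide) (by decide) (by simp) (by simp) ?_
        simp only [Expr.eval_var, Store.var_setArr, c46, c45]
        refine hins (fun i => ?_) fun i => ?_
        · by_cases hi : i = β <;> simp [hi, c15, h', coord, h1]
        · by_cases hi : i = β <;> simp [hi, c16, h', coord, h2]
      · simp [c45, c52, c30, c31, c32] at h2
        refine Run.skip (hins (fun i => ?_) fun i => ?_)
        · by_cases hi : i = β <;> simp [hi, c15, h', coord, h1]
        · by_cases hi : i = β <;> simp [hi, c16, h', coord, h2]
    · simp [c45, c51, c30, c31, c32] at h1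
      refine Run.skip (Run.ite (by decide) (by simp) (fun h2 => ?_) fun h2 => ?_)
      · simp [c45, c52, c30, c31, c32] at h2
        refine Run.write (by decide) (by decide) (by simp) (by simp) ?_
        simp only [Expr.eval_var, c46, c45]
        refine hins (fun i => ?_) fun i => ?_
        · by_cases hi : i = β <;> simp [hi, c15, h', coord, h1]
        · by_cases hi : i = β <;> simp [hi, c16, h', coord, h2]
      · simp [c45, c52, c30, c31, c32] at h2
        refine Run.skip (hins (fun i => ?_) fun i => ?_)
        · by_cases hi : i = β <;> simp [hi, c15, h', coord, h1]
        · by_cases hi : i = β <;> simp [hi, c16, h', coord, h2]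

theorem shift_run [NeZero m] (hp : TableParams m g d e o l W Z s) (hZ : Z ≤ X) {Y : Set (ZMod m)}
    (ht : IsTable m g d e o l W Z Y (s.arr 15) (s.arr 16)) {x : ℤ} (hx : s.var 43 = x) :
    Run H X shift s fun s' =>
      IsTable m g d e o l W Z (Y ∪ {r | ∃ y ∈ Y, r = y + x}) (s'.arr 15) (s'.arr 16) := by
  refine Run.of_small fun hH hsm => ?_
  have hmH : (m : ℤ) ≤ H := hp.modulus ▸ (hsm 2 (by decide)).2
  have hm : (0 : ℤ) < m := by exact_mod_cast Nat.pos_of_ne_zero (NeZero.ne m)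
  have hLW : ∀ i : ℕ, i < Z → Within H (s.arr 15 i) := fun i hi => by
    have := ht.neg_one_le i (by omega) (by omega)
    have := ht.lo_lt i (by omega) (by omega)
    constructor <;> omega
  have hHW : ∀ i : ℕ, i < Z → Within H (s.arr 16 i) := fun i hi => by
    have := ht.hi_nonneg i (by omega) (by omega)
    have := ht.hi_lt i (by omega) (by omega)
    constructor <;> omega
  refine Run.seq_of (Run.fill Z hp.var_Z hZ (by decide) (by decide) (by decide)
    (by decide) (by decide) (fun i => (i : ℤ)) (fun i => s.arr 15 i)
    (fun j _ j' _ h => by exact_mod_cast h) ?_) ?_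
  · intro i hi s' hF h44 _
    simp [h44, hF.arr 15 rfl, hLW i hi]
  rintro s1 hF1 ⟨h17, -⟩
  have p1 := hp.of_frame hF1 rfl rfl rfl rfl rfl rfl rfl
  refine Run.seq_of (Run.fill Z p1.var_Z hZ (by decide) (by decide) (by decide)
    (by decide) (by decide) (fun i => (i : ℤ)) (fun i => s.arr 16 i)
    (fun j _ j' _ h => by exact_mod_cast h) ?_) ?_
  · intro i hi s' hF h44 _
    simp [h44, hF.arr 16 rfl, hF1.arr 16 rfl, hHW i hi]
  rintro s2 hF2 ⟨h18, -⟩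
  have p2 := p1.of_frame hF2 rfl rfl rfl rfl rfl rfl rfl
  rw [← hF2.arr 17 rfl] at h17
  have x2 := ((hF2.var 43 rfl).trans (hF1.var 43 rfl)).trans hx
  have a15 := (hF2.arr 15 rfl).trans (hF1.arr 15 rfl)
  have a16 := (hF2.arr 16 rfl).trans (hF1.arr 16 rfl)
  refine Run.forLoop Z p2.var_Z hZ (by decide) (by decide) rfl rfl (by decide)
    -- Only the shifts of stored residues have been inserted so far; `IsTable.shift` turns this into
    -- a table for all shifts of `Y` at the end.
    (fun j s' => IsTable m g d e o l W Z (Y ∪ {r | ∃ i, 0 ≤ i ∧ i < (j : ℤ) ∧ 0 ≤ s.arr 15 i ∧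
      (r = s.arr 15 i + x ∨ r = s.arr 16 i + x)}) (s'.arr 15) (s'.arr 16)) ?_ ?_
    fun s' _ h => ht.shift (x : ZMod m) h
  · have : {r : ZMod m | ∃ i, 0 ≤ i ∧ i < ((0 : ℕ) : ℤ) ∧ 0 ≤ s.arr 15 i ∧
        (r = s.arr 15 i + x ∨ r = s.arr 16 i + x)} = ∅ := by
      ext r
      simp only [Set.mem_ofPred_eq, Set.mem_empty_iff_false, iff_false]
      rintro ⟨i, h0, h1, -⟩
      omega
    rw [this, Set.union_empty]
    simpa [a15, a16] using ht
  · intro j hj s3 hF3 h44 hI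
    have p3 := p2.of_frame hF3 rfl rfl rfl rfl rfl rfl rfl
    have b17 : s3.arr 17 j = s.arr 15 j := by rw [hF3.arr 17 rfl, h17 j hj]
    have b18 : s3.arr 18 j = s.arr 16 j := by rw [hF3.arr 18 rfl, h18 j hj]
    have b43 := (hF3.var 43 rfl).trans x2
    refine Run.ite (by decide) ?_ (fun h => Run.skip ?_) fun h => ?_
    · simp [h44, b17, hLW j hj]
    · simp [h44, b17] at h
      simp only [Store.arr_setVar]
      convert hI using 2
      ext r
      simp only [Set.mem_ofPred_eq]
      constructor
      · rintro ⟨i, h0, h1, h2, h3⟩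
        have : i ≠ j := fun hij => by rw [hij] at h2; omega
        exact ⟨i, h0, by omega, h2, h3⟩
      · rintro ⟨i, h0, h1, h2⟩
        exact ⟨i, h0, by omega, h2⟩
    · simp [h44, b17] at h
      have q0 := fun z => Int.emod_nonneg z hm.ne'
      have q1 := fun z => Int.emod_lt_of_pos z hm
      have ev1 : ((Expr.arr 17 (.var 44) + .var 43) % .var 2).eval s3 = (s.arr 15 j + x) % m := by
        simp [h44, b17, b43, p3.modulus]
      refine Run.seq (Run.assign (by decide) ?_ ?_ ?_)
      · simp [h44, b17, hLW j hj]
      · rw [ev1]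
        have := q0 (s.arr 15 j + x)
        have := q1 (s.arr 15 j + x)
        constructor <;> omega
      rw [ev1]
      refine Run.seq_of (insert_run (p3.setVar (by decide)) (by simpa using hI)
        (r := (s.arr 15 j + x) % m) (by simp) (q0 _) (q1 _)) ?_
      intro s4 hF4 hI4
      have c44 := hF4.var 44 rfl
      have c43 := hF4.var 43 rfl
      have c18 := hF4.arr 18 rfl
      simp [h44] at c44
      simp [b43] at c43
      simp at c18
      have p4 := (p3.setVar (i := 45) (z := (s.arr 15 j + x) % m) (by decide)).of_frame hF4
        rfl rfl rfl rfl rfl rfl rfl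
      have ev2 : ((Expr.arr 18 (.var 44) + .var 43) % .var 2).eval s4 = (s.arr 16 j + x) % m := by
        simp [c44, c18, b18, c43, p4.modulus]
      refine Run.seq (Run.assign (by decide) ?_ ?_ ?_)
      · simp [c44, c18, b18, hHW j hj]
      · rw [ev2]
        have := q0 (s.arr 16 j + x)
        have := q1 (s.arr 16 j + x)
        constructor <;> omega
      rw [ev2]
      refine (insert_run (p4.setVar (by decide)) (by simpa using hI4)
        (r := (s.arr 16 j + x) % m) (by simp) (q0 _) (q1 _)).mono ?_
      intro s5 _ hI5
      simp only [Store.arr_setVar]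
      convert hI5 using 1
      ext r
      simp only [Set.mem_union, Set.mem_ofPred_eq, Set.mem_insert_iff, ZMod.intCast_mod,
        Int.cast_add]
      constructor
      · rintro (hY | ⟨i, h0, h1, h2, h3⟩)
        · exact .inr (.inr (.inl hY))
        · by_cases hij : i = j
          · rw [hij] at h3
            rcases h3 with h3 | h3
            · exact .inr (.inl h3)
            · exact .inl h3
          · exact .inr (.inr (.inr ⟨i, h0, by omega, h2, h3⟩))
      · rintro (hr | hr | hY | ⟨i, h0, h1, h2, h3⟩)
        · exact .inr ⟨j, by omega, by omega, h, .inr hr⟩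
        · exact .inr ⟨j, by omega, by omega, h, .inl hr⟩
        · exact .inl hY
        · exact .inr ⟨i, h0, by omega, h2, h3⟩

theorem addVector_run [NeZero m] (hp : TableParams m g d e o l W Z s) (hZ : Z ≤ X)
    (hmX : m.size ≤ X) {Y : Set (ZMod m)}
    (ht : IsTable m g d e o l W Z Y (s.arr 15) (s.arr 16)) {p L : ℕ} (h40 : s.var 40 = p)
    (h13 : s.arr 13 p = L) (hL : L ≤ m) {x : ℤ} (h14 : s.arr 14 p = x) (hx0 : 0 ≤ x) (hxm : x < m) :
    Run H X addVector s fun s' =>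
      IsTable m g d e o l W Z (extend Y x L) (s'.arr 15) (s'.arr 16) := by
  refine Run.of_small fun hH hsm => ?_
  have hmH : (m : ℤ) ≤ H := hp.modulus ▸ (hsm 2 (by decide)).2
  have hm : (0 : ℤ) < m := by exact_mod_cast Nat.pos_of_ne_zero (NeZero.ne m)
  refine Run.seq (Run.assign (by decide) (by simp) (by simp [Within]) ?_)
  refine Run.loop (by decide) m.size hmX
    -- Each round replaces `C + 1` by `2 * (C + 1)` or finishes, so the number of rounds is
    -- logarithmic in the multiplicity.
    (fun t s' => ∃ C : ℕ, s'.var 41 = C ∧ C ≤ L ∧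
      IsTable m g d e o l W Z (extend Y x C) (s'.arr 15) (s'.arr 16) ∧ (C = L ∨ 2 ^ t ≤ C + 1))
    ⟨0, by simp, by omega, by simpa [extend_zero] using ht, .inr (by simp)⟩ ?_ ?_ ?_ ?_
  all_goals
    intro t s' hF hI
    obtain ⟨C, h41, hCL, hI, hC⟩ := hI
    have b40 := hF.var 40 rfl
    simp [h40] at b40
    have b13 : s'.arr 13 p = L := by
      have := hF.arr 13 rfl
      simp at this
      rw [this, h13]
    have b14 : s'.arr 14 p = x := by
      have := hF.arr 14 rfl
      simp at this
      rw [this, h14]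
  · simp [b40, b13]
    constructor <;> omega
  · intro h
    simp [h41, b40, b13] at h
    have h1 : 2 ^ t ≤ m := by omega
    exact (Nat.pow_lt_pow_iff_right (by norm_num)).1 (h1.trans_lt (Nat.lt_size_self m))
  · intro h
    simp [h41, b40, b13] at h
    have pp := (hp.setVar (i := 41) (z := 0) (by decide)).of_frame hF rfl rfl rfl rfl rfl rfl rfl
    have hWL : Within H (L : ℤ) := by constructor <;> omega
    have hWC : Within H (C : ℤ) := by constructor <;> omega
    refine Run.seq_of (P := fun s'' => ∃ q : ℕ, s''.var 42 = q ∧ q ≤ C + 1 ∧ C + q ≤ L ∧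
      (C + q = L ∨ q = C + 1)) ?_ ?_
    · refine Run.ite (by decide) (by simpa [b40, b13] using hWL) (fun h' => ?_) fun h' => ?_
      · simp [h41, b40, b13] at h'
        refine Run.assign (by decide) (by simp) ?_ ⟨C + 1, ?_⟩
        · simp [h41]
          constructor <;> omega
        · simp [h41]
          omega
      · simp [h41, b40, b13] at h'
        refine Run.assign (by decide) (by simpa [b40, b13] using hWL) ?_ ⟨L - C, ?_⟩
        · simp [h41, b40, b13]
          constructor <;> omega
        · simp [h41, b40, b13]
          omega
    · rintro s2 hF2 ⟨q, h42, hq, hqL, hq'⟩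
      have c40 := (hF2.var 40 rfl).trans b40
      have c41 := (hF2.var 41 rfl).trans h41
      have c14 : s2.arr 14 p = x := by rw [hF2.arr 14 rfl, b14]
      have p2 := pp.of_frame hF2 rfl rfl rfl rfl rfl rfl rfl
      have ev : (Expr.var 42 * .arr 14 (.var 40) % .var 2).eval s2 = q * x % m := by
        simp [h42, c40, c14, p2.modulus]
      have q0 := Int.emod_nonneg (q * x) hm.ne'
      have q1 := Int.emod_lt_of_pos (q * x) hm
      refine Run.seq (Run.assign (by decide) ?_ (by rw [ev]; constructor <;> omega) ?_)
      · simp [c40, c14]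
        constructor <;> omega
      rw [ev]
      have hI2 : IsTable m g d e o l W Z (extend Y x C) ((s2.setVar 43 (q * x % m)).arr 15)
          ((s2.setVar 43 (q * x % m)).arr 16) := by
        simpa [hF2.arr 15 rfl, hF2.arr 16 rfl] using hI
      refine Run.seq_of (shift_run (p2.setVar (by decide)) hZ hI2 (by simp; rfl)) ?_
      intro s3 hF3 hI3
      have d41 := hF3.var 41 rfl
      have d42 := hF3.var 42 rfl
      simp [c41] at d41
      simp [h42] at d42
      refine Run.assign (by decide) (by simp) ?_ ⟨C + q, ?_, hqL, ?_, ?_⟩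
      · simp [d41, d42]
        constructor <;> omega
      · simp [d41, d42]
      · rw [extend_add Y _ hq]
        simpa [ZMod.intCast_mod] using hI3
      · rcases hq' with hq' | hq'
        · exact .inl hq'
        · rcases hC with hC | hC
          · omega
          · right
            rw [pow_succ]
            omega
  · intro h
    simp [h41, b40, b13] at h
    obtain rfl : C = L := by omega
    exact hI

theorem memberTest_run [NeZero m] (hp : TableParams m g d e o l W Z s) {a : ℕ} {ρ z : ℤ} {i j : ℕ}
    (h47 : s.var 47 = i) (h44 : s.var 44 = j) (h4 : s.arr 4 i = ρ) (ha : s.arr a j = z)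
    (hρ : Within H ρ) (hz : Within H z) (P : Prop)
    (hP : P ↔ ∃ c : ℤ, 0 ≤ c ∧ c < l ∧ (ρ : ZMod m) = z + c * g) :
    Run H X (memberTest a) s fun s' => (P ∧ s'.var 39 = 1) ∨ (¬ P ∧ s'.var 39 = s.var 39) := by
  refine Run.of_small fun hH hsm => ?_
  have hmH : (m : ℤ) ≤ H := hp.modulus ▸ (hsm 2 (by decide)).2
  have hm : (0 : ℤ) < m := by exact_mod_cast Nat.pos_of_ne_zero (NeZero.ne m)
  have q0 := Int.emod_nonneg (ρ - z) hm.ne'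
  have q1 := Int.emod_lt_of_pos (ρ - z) hm
  -- Shifted by the starting point `z`, the question is whether `ρ - z` is one of the multiples `0,
  -- …, l - 1` of `g`.
  have hP' : P ↔ ((ρ - z) % m) % d = 0 ∧ coord d e o ((ρ - z) % m) < l := by
    rw [hp.gcd.mem_iff hp.l_le, hP]
    refine exists_congr fun c => and_congr_right fun _ => and_congr_right fun _ => ?_
    rw [ZMod.intCast_mod, Int.cast_sub]
    constructor <;> intro h
    · rw [h]; ring
    · rw [← h]; ring
  have ev : ((Expr.arr 4 (.var 47) - .arr a (.var 44)) % .var 2).eval s = (ρ - z) % m := by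
    simp [h47, h44, h4, ha, hp.modulus]
  refine Run.seq (Run.assign ?_ ?_ (by rw [ev]; constructor <;> omega) ?_)
  · exact Nat.le_of_ble_eq_true rfl
  · simpa [h47, h44, h4, ha] using ⟨hρ, hz⟩
  rw [ev]
  refine Run.ite (by decide) (by simp) (fun h => ?_) fun h => Run.skip (.inr ⟨fun hh => h ?_, by simp⟩)
  · simp [hp.var_d, hp.var_e, hp.var_o, hp.var_l] at h
    refine Run.assign (by decide) (by simp) (by simp [Within]; omega) (.inl ⟨hP'.2 ?_, by simp⟩)
    exact ⟨by simpa using h.1, h.2⟩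
  · have := hP'.1 hh
    simp [hp.var_d, hp.var_e, hp.var_o, hp.var_l]
    exact ⟨by simpa using this.1, this.2⟩

theorem search_run [NeZero m] (hp : TableParams m g d e o l W Z s) (hZ : Z ≤ X) {Y : Set (ZMod m)}
    (ht : IsTable m g d e o l W Z Y (s.arr 15) (s.arr 16)) {R : ℕ} (h3 : s.var 3 = R) (hR : R ≤ X)
    (h4 : ∀ i : ℕ, i < R → 0 ≤ s.arr 4 i ∧ s.arr 4 i < m) {L : ℕ} (hl : l = (L : ℤ) + 1)
    {S : Set (ZMod m)} (hS : ∀ r, r ∈ S ↔ ∃ i : ℕ, i < R ∧ r = s.arr 4 i) :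
    Run H X search s fun s' => (s'.var 39 = 0 ∨ s'.var 39 = 1) ∧
      (s'.var 39 = 1 ↔ (extend Y g L ∩ S).Nonempty) := by
  refine Run.of_small fun hH hsm => ?_
  have hmH : (m : ℤ) ≤ H := hp.modulus ▸ (hsm 2 (by decide)).2
  have hLW : ∀ i : ℕ, i < Z → Within H (s.arr 15 i) := fun i hi => by
    have := ht.neg_one_le i (by omega) (by omega)
    have := ht.lo_lt i (by omega) (by omega)
    constructor <;> omega
  have hHW : ∀ i : ℕ, i < Z → Within H (s.arr 16 i) := fun i hi => by
    have := ht.hi_nonneg i (by omega) (by omega)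
    have := ht.hi_lt i (by omega) (by omega)
    constructor <;> omega
  set P : ℤ → ℕ → Prop := fun z i => ∃ c : ℤ, 0 ≤ c ∧ c < l ∧ ((s.arr 4 i : ℤ) : ZMod m) = z + c * g
    with hPdef
  set hit : ℕ → ℕ → Prop := fun i j => 0 ≤ s.arr 15 j ∧ (P (s.arr 15 j) i ∨ P (s.arr 16 j) i)
    with hhit
  have hiff : (extend Y g L ∩ S).Nonempty ↔ ∃ i, i < R ∧ ∃ j, j < Z ∧ hit i j := by
    rw [ht.exists_iff hl]
    constructor
    · rintro ⟨r, hr, j, h0, h1, h2, c, h3, h4, h5⟩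
      obtain ⟨i, hi, rfl⟩ := (hS r).1 hr
      lift j to ℕ using h0
      exact ⟨i, hi, j, by omega, h2, h5.imp (fun h => ⟨c, h3, h4, h⟩) fun h => ⟨c, h3, h4, h⟩⟩
    · rintro ⟨i, hi, j, hj, h2, ⟨c, h3, h4, h5⟩ | ⟨c, h3, h4, h5⟩⟩
      · exact ⟨_, (hS _).2 ⟨i, hi, rfl⟩, j, by omega, by omega, h2, c, h3, h4, .inl h5⟩
      · exact ⟨_, (hS _).2 ⟨i, hi, rfl⟩, j, by omega, by omega, h2, c, h3, h4, .inr h5⟩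
  rw [hiff]
  refine Run.seq (Run.assign (by decide) (by simp) (by simp [Within]) ?_)
  refine Run.forLoop R (by simp [h3]) hR (by decide) (by decide) rfl rfl (by decide)
    (fun r s' => (s'.var 39 = 0 ∨ s'.var 39 = 1) ∧
      (s'.var 39 = 1 ↔ ∃ i, i < r ∧ ∃ j, j < Z ∧ hit i j)) (by simp) ?_ fun s' _ h => h
  rintro i hi s1 hF1 h47 ⟨hI0, hI⟩
  have p1 := (hp.setVar (i := 39) (z := 0) (by decide)).of_frame hF1 rfl rfl rfl rfl rfl rfl rfl
  have a4 := hF1.arr 4 rfl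
  have a15 := hF1.arr 15 rfl
  have a16 := hF1.arr 16 rfl
  simp at a4 a15 a16
  refine Run.forLoop Z p1.var_Z hZ (by decide) (by decide) rfl rfl (by decide)
    (fun r s' => (s'.var 39 = 0 ∨ s'.var 39 = 1) ∧
      (s'.var 39 = 1 ↔ (∃ i', i' < i ∧ ∃ j, j < Z ∧ hit i' j) ∨ ∃ j, j < r ∧ hit i j)) ?_ ?_ ?_
  · simpa [hI] using hI0
  · rintro j hj s2 hF2 h44 ⟨hJ0, hJ⟩
    have p2 := p1.of_frame hF2 rfl rfl rfl rfl rfl rfl rfl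
    have b47 := (hF2.var 47 rfl).trans h47
    have b4 := (hF2.arr 4 rfl).trans a4
    have b15 := (hF2.arr 15 rfl).trans a15
    have b16 := (hF2.arr 16 rfl).trans a16
    have hsucc : (∃ j', j' < j + 1 ∧ hit i j') ↔ (∃ j', j' < j ∧ hit i j') ∨ hit i j := by
      constructor
      · rintro ⟨j', hj', h⟩
        rcases Nat.lt_succ_iff_lt_or_eq.1 hj' with h' | rfl
        · exact .inl ⟨j', h', h⟩
        · exact .inr h
      · rintro (⟨j', hj', h⟩ | h)
        · exact ⟨j', by omega, h⟩
        · exact ⟨j, by omega, h⟩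
    rw [hsucc]
    have hW4 : Within H (s.arr 4 i) := by
      have := h4 i hi
      constructor <;> omega
    refine Run.ite (by decide) ?_ (fun h => Run.skip ?_) fun h => ?_
    · simp [h44, b15, hLW j hj]
    · simp [h44, b15] at h
      have hno : ¬ hit i j := fun hh => by have := hh.1; omega
      simp only [Store.var_setVar, Nat.reduceEqDiff, if_false]
      exact ⟨hJ0, by rw [hJ]; simp [hno]⟩
    · simp [h44, b15] at h
      refine Run.seq_of (memberTest_run p2 b47 h44 (by rw [b4]) (by rw [b15]) hW4 (hLW j hj)
        (P (s.arr 15 j) i) Iff.rfl) ?_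
      intro s3 hF3 h3'
      refine (memberTest_run (p2.of_frame hF3 rfl rfl rfl rfl rfl rfl rfl)
        ((hF3.var 47 rfl).trans b47) ((hF3.var 44 rfl).trans h44) (by rw [hF3.arr 4 rfl, b4])
        (by rw [hF3.arr 16 rfl, b16]) hW4 (hHW j hj) (P (s.arr 16 j) i) Iff.rfl).mono ?_
      intro s4 _ h4'
      have hhit' : hit i j ↔ P (s.arr 15 j) i ∨ P (s.arr 16 j) i := by
        simp only [hhit, h, true_and]
      rw [hhit']
      simp only [Store.var_setVar, Nat.reduceEqDiff, if_false]
      rcases h4' with ⟨g1, g2⟩ | ⟨g1, g2⟩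
      · simp [g1, g2]
      · rw [g2]
        rcases h3' with ⟨k1, k2⟩ | ⟨k1, k2⟩
        · simp [k1, k2]
        · rw [k2]
          exact ⟨hJ0, by rw [hJ]; simp [k1, g1]⟩
  · rintro s2 _ ⟨hJ0, hJ⟩
    simp only [Store.var_setVar, Nat.reduceEqDiff, if_false]
    refine ⟨hJ0, hJ.trans ⟨?_, ?_⟩⟩
    · rintro (⟨i', hi', h⟩ | h)
      · exact ⟨i', by omega, h⟩
      · exact ⟨i, by omega, h⟩
    · rintro ⟨i', hi', h⟩
      rcases Nat.lt_succ_iff_lt_or_eq.1 hi' with h' | rfl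
      · exact .inl ⟨i', h', h⟩
      · exact .inr h

/-- The loop builds a table of the residues reachable without vector `a`; intervals of length `κ a +
1` in its direction add all multiplicities `0, …, κ a`, by `extend_reach`. -/
theorem oracle_run [NeZero m] {κ : ℕ → ℕ} {γ : ℕ → ℤ} {N a R : ℕ} {h₀ : ℤ}
    (hp : TableParams m (γ a) d e o (κ a + 1) W Z s) (hZ : Z ≤ X) (hmX : m.size ≤ X)
    (h5 : s.var 5 = N) (hN : N ≤ X) (h29 : s.var 29 = a) (ha : a < N)
    (h13 : ∀ p : ℕ, p < N → s.arr 13 p = κ p) (hκ : ∀ p, p < N → κ p ≤ m)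
    (h14 : ∀ p : ℕ, p < N → s.arr 14 p = γ p) (hγ : ∀ p, p < N → 0 ≤ γ p ∧ γ p < m)
    (h27 : s.var 27 = h₀) (hh : 0 ≤ h₀ ∧ h₀ < m) (h3 : s.var 3 = R) (hR : R ≤ X)
    (h4 : ∀ i : ℕ, i < R → 0 ≤ s.arr 4 i ∧ s.arr 4 i < m)
    {S : Set (ZMod m)} (hS : ∀ r, r ∈ S ↔ ∃ i : ℕ, i < R ∧ r = s.arr 4 i) :
    Run H X oracle s fun s' => (s'.var 39 = 0 ∨ s'.var 39 = 1) ∧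
      (s'.var 39 = 1 ↔ (reach N κ (fun p => (γ p : ZMod m)) h₀ ∩ S).Nonempty) := by
  refine Run.of_small fun hH hsm => ?_
  have hm : 0 < m := Nat.pos_of_ne_zero (NeZero.ne m)
  refine Run.seq_of (Run.fill Z hp.var_Z hZ (by decide) (by decide) (by decide)
    (by decide) (by decide) (fun i => (i : ℤ)) (fun _ => -1)
    (fun j _ j' _ h => by exact_mod_cast h) ?_) ?_
  · intro i hi s' hF h44 _
    simp [h44]
  rintro s1 hF1 ⟨h15, -⟩
  have p1 := hp.of_frame hF1 rfl rfl rfl rfl rfl rfl rfl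
  refine Run.seq_of (Run.fill Z p1.var_Z hZ (by decide) (by decide) (by decide)
    (by decide) (by decide) (fun i => (i : ℤ)) (fun _ => -1)
    (fun j _ j' _ h => by exact_mod_cast h) ?_) ?_
  · intro i hi s' hF h44 _
    simp [h44]
  rintro s2 hF2 ⟨h16, -⟩
  have p2 := p1.of_frame hF2 rfl rfl rfl rfl rfl rfl rfl
  rw [← hF2.arr 15 rfl] at h15
  have ht : IsTable m (γ a) d e o (κ a + 1) W Z ∅ (s2.arr 15) (s2.arr 16) :=
    isTable_empty hm (fun i h0 h1 => by lift i to ℕ using h0; exact h15 i (by omega))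
      fun i h0 h1 => by lift i to ℕ using h0; exact h16 i (by omega)
  have c27 : s2.var 27 = h₀ := by rw [hF2.var 27 rfl, hF1.var 27 rfl, h27]
  refine Run.seq (Run.assign (by decide) (by simp) ?_ ?_)
  · rw [Expr.eval_var, c27, ← h27]
    exact hsm 27 (by decide)
  rw [Expr.eval_var, c27]
  refine Run.seq_of (insert_run (p2.setVar (by decide)) (by simpa using ht)
    (r := h₀) (by simp) hh.1 hh.2) ?_
  intro s3 hF3 ht3
  have p3 := (p2.setVar (i := 45) (z := h₀) (by decide)).of_frame hF3 rfl rfl rfl rfl rfl rfl rfl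
  have v : ∀ i, insert.keepsVar i = true → i ≠ 45 → i ≠ 44 → s3.var i = s.var i := by
    intro i hi h45 h44
    rw [hF3.var i hi]
    simp only [Store.var_setVar, h45, if_false]
    rw [hF2.var i (by simpa [Cmd.keepsVar, Cmd.forLoop] using h44),
      hF1.var i (by simpa [Cmd.keepsVar, Cmd.forLoop] using h44)]
  have w : ∀ b, insert.keepsArr b = true → b ≠ 15 → b ≠ 16 → s3.arr b = s.arr b := by
    intro b hb b15 b16
    rw [hF3.arr b hb, Store.arr_setVar]
    rw [hF2.arr b (by simpa [Cmd.keepsArr, Cmd.forLoop] using b16),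
      hF1.arr b (by simpa [Cmd.keepsArr, Cmd.forLoop] using b15)]
  have w13 := w 13 rfl (by decide) (by decide)
  have w14 := w 14 rfl (by decide) (by decide)
  have w4 := w 4 rfl (by decide) (by decide)
  have v5 := (v 5 rfl (by decide) (by decide)).trans h5
  have v29 := (v 29 rfl (by decide) (by decide)).trans h29
  have v3 := (v 3 rfl (by decide) (by decide)).trans h3
  refine Run.seq_of (Run.forLoop N v5 hN (by decide) (by decide) rfl rfl (by decide)
    (fun r s' => IsTable m (γ a) d e o (κ a + 1) W Z
      (reach r (Function.update κ a 0) (fun p => (γ p : ZMod m)) h₀) (s'.arr 15) (s'.arr 16))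
    ?_ ?_ fun s' _ h => h) ?_
  · simpa [reach_zero] using ht3
  · intro r hr s4 hF4 h40 hI
    rw [reach_succ]
    have b29 := (hF4.var 29 rfl).trans v29
    refine Run.ite (by decide) (by simp) (fun h => Run.skip ?_) fun h => ?_
    · simp only [Test.holds_eq, Expr.eval_var, h40, b29, Nat.cast_inj] at h
      subst h
      simpa [extend_zero] using hI
    · simp only [Test.holds_eq, Expr.eval_var, h40, b29, Nat.cast_inj] at h
      rw [Function.update_of_ne h]
      refine (addVector_run (p3.of_frame hF4 rfl rfl rfl rfl rfl rfl rfl) hZ hmX hI h40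
        (by rw [hF4.arr 13 rfl, w13, h13 r hr]) (hκ r hr)
        (by rw [hF4.arr 14 rfl, w14, h14 r hr]) (hγ r hr).1 (hγ r hr).2).mono ?_
      intro s5 _ h
      simpa using h
  · intro s4 hF4 ht4
    have b4 := (hF4.arr 4 rfl).trans w4
    rw [← extend_reach N κ (fun p => (γ p : ZMod m)) h₀ ha]
    exact search_run (p3.of_frame hF4 rfl rfl rfl rfl rfl rfl rfl) hZ ht4
      ((hF4.var 3 rfl).trans v3) hR (by rw [b4]; exact h4) rfl (by rw [b4]; exact hS)

end Proximity

/-! ### The program: minimal multiplicities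

Variables: `20` vector, `28` sum of the multiplicities, `36`, `37`, `38` bisection, `48` multiplicity
of the vector `29`. -/

namespace Proximity

variable {H X k n m : ℕ} {s : Store}

/-- Lowers the multiplicity of the vector `20` as far as a solution below the multiplicities
exists. -/
def tighten : Cmd :=
  .assign 36 0 ;;
  .assign 37 (.arr 13 (.var 20)) ;;
  .loop (.lt (.var 36) (.var 37))
    (.assign 38 ((.var 36 + .var 37) / 2) ;;
      .write 13 (.var 20) (.var 38) ;;
      oracle ;;
      .ite (.eq (.var 39) 1) (.assign 37 (.var 38)) (.assign 36 (.var 38 + 1))) ;;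
  .write 13 (.var 20) (.var 36)

def tightenAll : Cmd :=
  .forLoop 20 5 (.ite (.eq (.var 20) (.var 29)) .skip tighten)

/-- Computes the multiplicity of the vector `29` when all others are fixed. -/
def finish : Cmd :=
  .assign 48 (.arr 13 (.var 29)) ;;
  .write 13 (.var 29) 0 ;;
  .sum 16 20 5 (.arr 13 (.var 20) * .arr 14 (.var 20)) ;;
  .assign 19 (.var 27 + .var 16) ;;
  .minimize 48 47 3 (.eq ((.arr 4 (.var 47) - .var 19) % .var 2 % .var 30) 0)
    (coordExpr ((.arr 4 (.var 47) - .var 19) % .var 2)) ;;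
  .write 13 (.var 29) (.var 48)

def select : Cmd :=
  .assign 29 0 ;;
  .forLoop 20 5 (.ite (.lt (.arr 13 (.var 29)) (.arr 13 (.var 20))) (.assign 29 (.var 20)) .skip)

def params : Cmd :=
  .assign 19 (.arr 14 (.var 29)) ;;
  euclid ;;
  .assign 33 (.arr 13 (.var 29) + 1) ;;
  .assign 34 (.var 32 / .var 33 + 1) ;;
  .assign 35 (.var 30 * .var 34)

def reduce : Cmd :=
  .sum 28 20 5 (.arr 13 (.var 20)) ;;
  .ite (.le (.var 28) (.var 2 - .var 3)) .skip (select ;; params ;; tightenAll ;; finish)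

/-- The data of the congruence: `N` residues `γ` with multiplicities `κ`, and `R` allowed
residues `ρ`. -/
structure Congruence (m N R : ℕ) (h₀ : ℤ) (κ : ℕ → ℕ) (γ ρ : ℕ → ℤ) (s : Store) : Prop where
  modulus : s.var 2 = m
  num : s.var 5 = N
  start : s.var 27 = h₀
  card : s.var 3 = R
  mult : ∀ p : ℕ, p < N → s.arr 13 p = κ p
  res : ∀ p : ℕ, p < N → s.arr 14 p = γ p
  allowed : ∀ i : ℕ, i < R → s.arr 4 i = ρ i

/-- The allowed residues. -/
def target (m R : ℕ) (ρ : ℕ → ℤ) : Set (ZMod m) := {r | ∃ i : ℕ, i < R ∧ r = ρ i}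

/-- All numbers are in range, and all loops are short. -/
structure InRange (X m N R : ℕ) (h₀ : ℤ) (κ : ℕ → ℕ) (γ ρ : ℕ → ℤ) : Prop where
  size_le : 2 * m.size ≤ X
  num_le : N ≤ X
  card_le : R ≤ X
  start : 0 ≤ h₀ ∧ h₀ < m
  mult_le : ∀ p, p < N → κ p ≤ m
  res : ∀ p, p < N → 0 ≤ γ p ∧ γ p < m
  allowed : ∀ i, i < R → 0 ≤ ρ i ∧ ρ i < m

variable {N R a : ℕ} {h₀ : ℤ} {κ : ℕ → ℕ} {γ ρ : ℕ → ℤ}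

theorem Congruence.of_frame {c : Cmd} {s' : Store} (h : Congruence m N R h₀ κ γ ρ s)
    (hF : Frame c s s') (h2 : c.keepsVar 2 = true) (h5 : c.keepsVar 5 = true)
    (h27 : c.keepsVar 27 = true) (h3 : c.keepsVar 3 = true) (h13 : c.keepsArr 13 = true)
    (h14 : c.keepsArr 14 = true) (h4 : c.keepsArr 4 = true) : Congruence m N R h₀ κ γ ρ s' where
  modulus := (hF.var 2 h2).trans h.modulus
  num := (hF.var 5 h5).trans h.num
  start := (hF.var 27 h27).trans h.start
  card := (hF.var 3 h3).trans h.card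
  mult := by rw [hF.arr 13 h13]; exact h.mult
  res := by rw [hF.arr 14 h14]; exact h.res
  allowed := by rw [hF.arr 4 h4]; exact h.allowed

theorem Congruence.setVar (h : Congruence m N R h₀ κ γ ρ s) {i : ℕ} {z : ℤ}
    (hi : i ≠ 2 ∧ i ≠ 5 ∧ i ≠ 27 ∧ i ≠ 3) : Congruence m N R h₀ κ γ ρ (s.setVar i z) := by
  obtain ⟨i1, i2, i3, i4⟩ := hi
  exact { h with
    modulus := by simp [Ne.symm i1, h.modulus]
    num := by simp [Ne.symm i2, h.num]
    start := by simp [Ne.symm i3, h.start]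
    card := by simp [Ne.symm i4, h.card] }

theorem Congruence.setArr (h : Congruence m N R h₀ κ γ ρ s) {p c : ℕ} :
    Congruence m N R h₀ (Function.update κ p c) γ ρ (s.setArr 13 p c) :=
  { h with
    mult := fun q hq => by
      by_cases hqp : q = p
      · subst hqp; simp
      · simp [hqp, h.mult q hq]
    res := by simpa using h.res
    allowed := by simpa using h.allowed }

theorem InRange.mono {κ' : ℕ → ℕ} (h : InRange X m N R h₀ κ γ ρ) (hκ : ∀ p, p < N → κ' p ≤ κ p) :
    InRange X m N R h₀ κ' γ ρ :=
  { h with mult_le := fun p hp => (hκ p hp).trans (h.mult_le p hp) }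

theorem TableParams.setArr {g d e o l W : ℤ} {Z : ℕ} (h : TableParams m g d e o l W Z s) {b : ℕ}
    {p z : ℤ} : TableParams m g d e o l W Z (s.setArr b p z) := { h with }

/-- There is a solution below `κ`. -/
abbrev Solvable (m N R : ℕ) (h₀ : ℤ) (κ : ℕ → ℕ) (γ ρ : ℕ → ℤ) : Prop :=
  (reach N κ (fun p => (γ p : ZMod m)) h₀ ∩ target m R ρ).Nonempty

/-- Every solution below `κ` agrees with `κ` at `p`. -/
abbrev Tight (m N R : ℕ) (h₀ : ℤ) (κ : ℕ → ℕ) (γ ρ : ℕ → ℤ) (p : ℕ) : Prop :=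
  IsTight N κ (fun p => (γ p : ZMod m)) h₀ (target m R ρ) p

variable {d e o W : ℤ} {Z : ℕ}

theorem decide_run [NeZero m] (hc : Congruence m N R h₀ κ γ ρ s) (hr : InRange X m N R h₀ κ γ ρ)
    (hp : TableParams m (γ a) d e o (κ a + 1) W Z s) (hZ : Z ≤ X) (h29 : s.var 29 = a)
    (ha : a < N) :
    Run H X oracle s fun s' => (s'.var 39 = 0 ∨ s'.var 39 = 1) ∧
      (s'.var 39 = 1 ↔ Solvable m N R h₀ κ γ ρ) :=
  oracle_run hp hZ (by have := hr.size_le; omega) hc.num hr.num_le h29 ha hc.mult hr.mult_le hc.res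
    hr.res hc.start hr.start hc.card hr.card_le
    (fun i hi => by rw [hc.allowed i hi]; exact hr.allowed i hi)
    fun r => exists_congr fun i => and_congr_right fun hi => by rw [hc.allowed i hi]

/-- Solvability is monotone in the multiplicity at `p`, so bisection finds the least solvable value,
and at that value `p` is tight. As `p ≠ a`, the interval length `κ a + 1` and thus the parameters of
the table remain valid throughout. -/
theorem tighten_run [NeZero m] (hc : Congruence m N R h₀ κ γ ρ s) (hr : InRange X m N R h₀ κ γ ρ)
    (hp : TableParams m (γ a) d e o (κ a + 1) W Z s) (hZ : Z ≤ X) (h29 : s.var 29 = a)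
    (ha : a < N) {p : ℕ} (h20 : s.var 20 = p) (hpN : p < N) (hpa : p ≠ a)
    (hsol : Solvable m N R h₀ κ γ ρ) :
    Run H X tighten s fun s' => ∃ c, c ≤ κ p ∧
      Congruence m N R h₀ (Function.update κ p c) γ ρ s' ∧
      Solvable m N R h₀ (Function.update κ p c) γ ρ ∧
      Tight m N R h₀ (Function.update κ p c) γ ρ p := by
  refine Run.of_small fun hH hsm => ?_
  have hmH : (m : ℤ) ≤ H := hp.modulus ▸ (hsm 2 (by decide)).2
  have hκm := hr.mult_le p hpN
  have hsz : m < 2 ^ m.size := Nat.lt_size_self m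
  refine Run.seq (Run.assign (by decide) (by simp) (by simp [Within]) ?_)
  refine Run.seq (Run.assign (by decide) ?_ ?_ ?_)
  · simp only [Expr.ok_arr, Expr.ok_var, Expr.eval_var, Store.var_setVar, Store.arr_setVar,
      Nat.reduceEqDiff, if_false, h20, hc.mult p hpN]
    exact ⟨by decide, by omega, by omega⟩
  · simp only [Expr.eval_arr, Expr.eval_var, Store.var_setVar, Store.arr_setVar,
      Nat.reduceEqDiff, if_false, h20, hc.mult p hpN]
    exact ⟨by omega, by omega⟩
  simp only [Expr.eval_arr, Expr.eval_var, Store.var_setVar, Store.arr_setVar,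
      Nat.reduceEqDiff, if_false, h20, hc.mult p hpN, Expr.eval_zero]
  have hc2 : Congruence m N R h₀ κ γ ρ ((s.setVar 36 0).setVar 37 (κ p)) :=
    (hc.setVar (by decide)).setVar (by decide)
  have hp2 : TableParams m (γ a) d e o (κ a + 1) W Z ((s.setVar 36 0).setVar 37 (κ p)) :=
    (hp.setVar (by decide)).setVar (by decide)
  have c20 : ((s.setVar 36 0).setVar 37 (κ p)).var 20 = p := by simpa using h20
  have c29 : ((s.setVar 36 0).setVar 37 (κ p)).var 29 = a := by simpa using h29
  have c36 : ((s.setVar 36 0).setVar 37 (κ p)).var 36 = 0 := by simp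
  have c37 : ((s.setVar 36 0).setVar 37 (κ p)).var 37 = κ p := by simp
  set s2 := (s.setVar 36 0).setVar 37 (κ p)
  clear_value s2
  -- Here `x` is the value left in the array by the last query, which need not be `lo`; the final
  -- write corrects it.
  refine Run.seq_of (P := fun s' => ∃ lo x, lo ≤ κ p ∧ s'.var 36 = (lo : ℕ) ∧ s'.var 20 = p ∧
    Congruence m N R h₀ (Function.update κ p x) γ ρ s' ∧
    Solvable m N R h₀ (Function.update κ p lo) γ ρ ∧
    ∀ c, c < lo → ¬ Solvable m N R h₀ (Function.update κ p c) γ ρ) ?_ ?_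
  · refine Run.loop (by decide) m.size (by have := hr.size_le; omega)
      (fun j s' => ∃ lo hi x : ℕ, lo ≤ hi ∧ hi ≤ κ p ∧ s'.var 36 = lo ∧ s'.var 37 = hi ∧
        (hi - lo) * 2 ^ j ≤ κ p ∧ Congruence m N R h₀ (Function.update κ p x) γ ρ s' ∧
        Solvable m N R h₀ (Function.update κ p hi) γ ρ ∧
        ∀ c, c < lo → ¬ Solvable m N R h₀ (Function.update κ p c) γ ρ) ?_ ?_ ?_ ?_ ?_
    · refine ⟨0, κ p, κ p, by omega, le_rfl, by simpa using c36, c37, by simp, ?_, ?_, by simp⟩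
      · rw [Function.update_eq_self]; exact hc2
      · rw [Function.update_eq_self]; exact hsol
    · intro j s' hF hI
      simp
    · rintro j s' hF ⟨lo, hi, x, h1, h2, h3, h4, h5, -⟩ h
      simp only [Test.holds_lt, Expr.eval_var, h3, h4, Nat.cast_lt] at h
      -- The search interval is halved in each round and is not yet empty, so the number of rounds
      -- is less than `m.size`.
      have : 2 ^ j ≤ κ p := le_trans (by nlinarith [Nat.one_le_two_pow (n := j), Nat.sub_pos_of_lt h]) h5
      exact (Nat.pow_lt_pow_iff_right (by norm_num : 1 < 2)).1 (by omega)
    · rintro j s3 hF3 ⟨lo, hi, x, h1, h2, h3, h4, h5, hc3, h6, h7⟩ h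
      simp only [Test.holds_lt, Expr.eval_var, h3, h4, Nat.cast_lt] at h
      have b20 := (hF3.var 20 rfl).trans c20
      have b29 := (hF3.var 29 rfl).trans c29
      have p3 := hp2.of_frame hF3 rfl rfl rfl rfl rfl rfl rfl
      have ev : ((Expr.var 36 + .var 37) / 2).eval s3 = ((lo + hi) / 2 : ℕ) := by
        simp [h3, h4]
      set c := (lo + hi) / 2 with hcdef
      refine Run.seq (Run.assign (by decide) (by simp) (by rw [ev]; constructor <;> omega) ?_)
      rw [ev]
      refine Run.seq (Run.write (by decide) (by decide) (by simp) (by simp) ?_)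
      simp only [Expr.eval_var, Store.var_setVar, Nat.reduceEqDiff, if_false, if_true, b20]
      have hc4 := (hc3.setVar (i := 38) (z := c) (by decide)).setArr (p := p) (c := c)
      rw [Function.update_idem] at hc4
      have e36 : ((s3.setVar 38 c).setArr 13 p c).var 36 = lo := by simp [h3]
      have e37 : ((s3.setVar 38 c).setArr 13 p c).var 37 = hi := by simp [h4]
      have e38 : ((s3.setVar 38 c).setArr 13 p c).var 38 = c := by simp
      have e29 : ((s3.setVar 38 c).setArr 13 p c).var 29 = a := by simp [b29]
      have p4 : TableParams m (γ a) d e o (κ a + 1) W Z ((s3.setVar 38 c).setArr 13 p c) :=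
        (p3.setVar (by decide)).setArr
      set s4 := (s3.setVar 38 c).setArr 13 p c
      clear_value s4
      have hcu : ∀ q, q < N → Function.update κ p c q ≤ κ q := fun q _ => by
        by_cases hq : q = p
        · subst hq; simp; omega
        · simp [hq]
      refine Run.seq_of (decide_run hc4 (hr.mono hcu)
        (by rw [Function.update_of_ne (Ne.symm hpa)]; exact p4) hZ e29 ha) ?_
      rintro s5 hF5 ⟨h39, hiff⟩
      have f36 := (hF5.var 36 rfl).trans e36
      have f37 := (hF5.var 37 rfl).trans e37
      have f38 := (hF5.var 38 rfl).trans e38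
      have hc5 := hc4.of_frame hF5 rfl rfl rfl rfl rfl rfl rfl
      have hpow : ∀ z, 2 * z ≤ hi - lo → z * 2 ^ (j + 1) ≤ κ p := fun z hz => by
        refine le_trans ?_ h5
        rw [pow_succ, mul_comm (2 ^ j) 2, ← mul_assoc, mul_comm z 2]
        exact Nat.mul_le_mul_right _ hz
      refine Run.ite (by decide) (by simp) (fun hh => ?_) fun hh => ?_
      · simp only [Test.holds_eq, Expr.eval_var, Expr.eval_one] at hh
        refine Run.assign (by decide) (by simp) ?_ ?_
        · simp only [Expr.eval_var, f38]
          constructor <;> omega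
        simp only [Expr.eval_var, f38]
        exact ⟨lo, c, c, by omega, by omega, by simp [f36], by simp, hpow _ (by omega),
          hc5.setVar (by decide), hiff.1 hh, h7⟩
      · simp only [Test.holds_eq, Expr.eval_var, Expr.eval_one] at hh
        refine Run.assign (by decide) (by simp) ?_ ?_
        · simp only [Expr.eval_var, Expr.eval_add, Expr.eval_one, f38]
          constructor <;> omega
        simp only [Expr.eval_var, Expr.eval_add, Expr.eval_one, f38]
        refine ⟨c + 1, hi, c, by omega, by omega, by simp, by simp [f37], hpow _ (by omega),
          hc5.setVar (by decide), h6, fun c' hc' hS => ?_⟩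
        -- A solution below a smaller value would also be one below `c`, which the oracle has
        -- excluded.
        refine hh (hiff.2 (hS.mono (Set.inter_subset_inter_left _ (reach_mono fun q _ => ?_))))
        by_cases hq : q = p
        · subst hq; simp; omega
        · simp [hq]
    · rintro j s3 hF3 ⟨lo, hi, x, h1, h2, h3, h4, -, hc3, h6, h7⟩ h
      simp only [Test.holds_lt, Expr.eval_var, h3, h4, Nat.cast_lt] at h
      obtain rfl : lo = hi := by omega
      exact ⟨lo, x, h2, h3, (hF3.var 20 rfl).trans c20, hc3, h6, h7⟩
  · rintro s3 hF3 ⟨lo, x, h1, h36, b20, hc3, h6, h7⟩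
    refine Run.write (by decide) (by decide) (by simp) (by simp) ?_
    simp only [Expr.eval_var, b20, h36]
    have := hc3.setArr (p := p) (c := lo)
    rw [Function.update_idem] at this
    exact ⟨lo, h1, this, h6, isTight_update hpN h7⟩

/-- A single pass suffices: lowering a later multiplicity only removes solutions, so earlier ones
stay tight (`IsTight.update`). -/
theorem tightenAll_run [NeZero m] (hc : Congruence m N R h₀ κ γ ρ s)
    (hr : InRange X m N R h₀ κ γ ρ) (hp : TableParams m (γ a) d e o (κ a + 1) W Z s) (hZ : Z ≤ X)
    (h29 : s.var 29 = a) (ha : a < N) (hsol : Solvable m N R h₀ κ γ ρ) :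
    Run H X tightenAll s fun s' => ∃ κ' : ℕ → ℕ, (∀ p, p < N → κ' p ≤ κ p) ∧ κ' a = κ a ∧
      Congruence m N R h₀ κ' γ ρ s' ∧ Solvable m N R h₀ κ' γ ρ ∧
      ∀ p, p < N → p ≠ a → Tight m N R h₀ κ' γ ρ p := by
  refine Run.forLoop N hc.num hr.num_le (by decide) (by decide) rfl rfl (by decide)
    (fun r s' => ∃ κ' : ℕ → ℕ, (∀ p, p < N → κ' p ≤ κ p) ∧ κ' a = κ a ∧
      Congruence m N R h₀ κ' γ ρ s' ∧ Solvable m N R h₀ κ' γ ρ ∧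
      ∀ p, p < r → p ≠ a → Tight m N R h₀ κ' γ ρ p)
    ⟨κ, fun _ _ => le_rfl, rfl, hc.setVar (by decide), hsol, by simp⟩ ?_ fun s' _ h => h
  rintro r hrN s1 hF1 h20 ⟨κ', h1, h2, h3, h4, h5⟩
  have b29 := (hF1.var 29 rfl).trans h29
  refine Run.ite (by decide) (by simp) (fun h => Run.skip ?_) fun h => ?_
  · simp only [Test.holds_eq, Expr.eval_var, h20, b29, Nat.cast_inj] at h
    refine ⟨κ', h1, h2, h3.setVar (by decide), h4, fun p hp hpa => h5 p ?_ hpa⟩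
    omega
  · simp only [Test.holds_eq, Expr.eval_var, h20, b29, Nat.cast_inj] at h
    refine (tighten_run h3 (hr.mono h1) (by rw [h2]; exact hp.of_frame hF1 rfl rfl rfl rfl rfl rfl rfl)
      hZ b29 ha h20 hrN h h4).mono ?_
    rintro s2 _ ⟨c, g1, g2, g3, g4⟩
    refine ⟨Function.update κ' r c, fun p hp => ?_, ?_, g2.setVar (by decide), g3, fun p hp hpa => ?_⟩
    · by_cases hpr : p = r
      · subst hpr; simpa using g1.trans (h1 p hp)
      · simpa [hpr] using h1 p hp
    · rw [Function.update_of_ne (Ne.symm h), h2]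
    · by_cases hpr : p = r
      · rw [hpr]; exact g4
      · exact (h5 p (by omega) hpa).update g1 hpr

end Proximity

/-! ### The last multiplicity and the reduction as a whole -/

namespace Proximity

variable {H X k n m : ℕ} {s : Store} {N R a : ℕ} {h₀ : ℤ} {κ : ℕ → ℕ} {γ ρ : ℕ → ℤ}
variable {d e o W : ℤ} {Z : ℕ}

/-- `κ` is a solution, and no other solution lies below it. -/
structure IsMinimalSolution (m N R : ℕ) (h₀ : ℤ) (κ : ℕ → ℕ) (γ ρ : ℕ → ℤ) : Prop where
  mem : (h₀ : ZMod m) + ∑ p ∈ Finset.range N, (κ p : ZMod m) * γ p ∈ target m R ρ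
  tight : ∀ p, p < N → Tight m N R h₀ κ γ ρ p

/-- With all other multiplicities tight, every solution agrees with `κ` away from `a`. What remains
is the least `c` for which `b + c * γ a` is allowed, and for each allowed residue the only candidate
is a coordinate. -/
theorem finish_run [NeZero m] (hc : Congruence m N R h₀ κ γ ρ s) (hr : InRange X m N R h₀ κ γ ρ)
    (hp : TableParams m (γ a) d e o (κ a + 1) W Z s) (h29 : s.var 29 = a)
    (ha : a < N) (hsol : Solvable m N R h₀ κ γ ρ)
    (htight : ∀ p, p < N → p ≠ a → Tight m N R h₀ κ γ ρ p) (hH : N * ((m : ℤ) * m) + m ≤ H) :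
    Run H X finish s fun s' => ∃ κ' : ℕ → ℕ, (∀ p, p < N → κ' p ≤ κ p) ∧
      (∀ p : ℕ, p < N → s'.arr 13 p = κ' p) ∧ IsMinimalSolution m N R h₀ κ' γ ρ := by
  refine Run.of_small fun h2H hsm => ?_
  have hm : (0 : ℤ) < m := by exact_mod_cast Nat.pos_of_ne_zero (NeZero.ne m)
  have hmH : (m : ℤ) ≤ H := hp.modulus ▸ (hsm 2 (by decide)).2
  have hκa := hr.mult_le a ha
  have hlo := hp.l_le
  have hgcd := hp.gcd
  set b : ℤ := h₀ + ∑ p ∈ Finset.range N, (Function.update κ a 0 p : ℤ) * γ p with hb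
  -- solutions that differ from `κ` at `a` only
  have hsum : ∀ c : ℕ, (h₀ : ZMod m) +
      ∑ p ∈ Finset.range N, (Function.update κ a c p : ZMod m) * γ p = b + c * γ a := by
    intro c
    rw [sum_update N κ (fun p => (γ p : ZMod m)) ha, hb]
    push_cast
    rw [add_assoc]
  have hsolve : ∀ c : ℕ, ∀ r : ℤ, (b : ZMod m) + c * γ a = r ↔
      (((r - b) % m : ℤ) : ZMod m) = (c : ℤ) * γ a := by
    intro c r
    rw [ZMod.intCast_mod, Int.cast_sub, sub_eq_iff_eq_add, Int.cast_natCast, add_comm, eq_comm]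
  refine Run.seq (Run.assign (by decide) ?_ ?_ ?_)
  · simp only [Expr.ok_arr, Expr.ok_var, Expr.eval_var, h29, hc.mult a ha]
    exact ⟨by decide, by omega, by omega⟩
  · simp only [Expr.eval_arr, Expr.eval_var, h29, hc.mult a ha]
    constructor <;> omega
  simp only [Expr.eval_arr, Expr.eval_var, h29, hc.mult a ha]
  refine Run.seq (Run.write (by decide) (by decide) (by simp) (by simp) ?_)
  simp only [Expr.eval_var, Expr.eval_zero, Store.var_setVar, Nat.reduceEqDiff, if_false, h29]
  have hc2 := (hc.setVar (i := 48) (z := κ a) (by decide)).setArr (p := a) (c := 0)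
  have p2 : TableParams m (γ a) d e o (κ a + 1) W Z ((s.setVar 48 (κ a)).setArr 13 a 0) :=
    (hp.setVar (by decide)).setArr
  have c48 : ((s.setVar 48 (κ a)).setArr 13 a 0).var 48 = κ a := by simp
  have c29 : ((s.setVar 48 (κ a)).setArr 13 a 0).var 29 = a := by simp [h29]
  rw [Nat.cast_zero] at hc2
  set s2 := (s.setVar 48 (κ a)).setArr 13 a 0
  clear_value s2
  have hu : ∀ p, p < N → Function.update κ a 0 p ≤ m := fun p hp => by
    by_cases hpa : p = a
    · subst hpa; simp
    · simpa [hpa] using hr.mult_le p hp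
  have hterm : ∀ j, j < N → |(Function.update κ a 0 j : ℤ) * γ j| ≤ m * m := fun j hj => by
    have := hr.res j hj
    have h1 : (Function.update κ a 0 j : ℤ) ≤ m := by exact_mod_cast hu j hj
    rw [abs_of_nonneg (mul_nonneg (by positivity) this.1)]
    exact mul_le_mul h1 this.2.le this.1 hm.le
  have hNm : N * ((m : ℤ) * m) ≤ H := by omega
  refine Run.seq_of (Run.sum N hc2.num hr.num_le (by decide) (by decide) (by decide) (by decide)
    (by decide) (by decide) (by decide) (fun p => (Function.update κ a 0 p : ℤ) * γ p) (m * m)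
    hterm hNm ?_) ?_
  · intro j hj s' hF h20
    have e13 := (congrFun (hF.arr 13 rfl) j).trans (hc2.mult j hj)
    have e14 := (congrFun (hF.arr 14 rfl) j).trans (hc2.res j hj)
    have := hu j hj
    have := hr.res j hj
    simp only [Expr.ok_mul, Expr.ok_arr, Expr.ok_var, Expr.eval_mul, Expr.eval_arr, Expr.eval_var,
      h20, e13, e14, and_true]
    exact ⟨⟨by decide, by omega, by omega⟩, by decide, by omega, by omega⟩
  intro s3 hF3 h16
  have hc3 := hc2.of_frame hF3 rfl rfl rfl rfl rfl rfl rfl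
  have p3 := p2.of_frame hF3 rfl rfl rfl rfl rfl rfl rfl
  have d48 := (hF3.var 48 rfl).trans c48
  have d29 := (hF3.var 29 rfl).trans c29
  have hbW : Within H b := by
    have h1 : 0 ≤ ∑ p ∈ Finset.range N, (Function.update κ a 0 p : ℤ) * γ p :=
      Finset.sum_nonneg fun p hp => mul_nonneg (by positivity) (hr.res p (Finset.mem_range.1 hp)).1
    have h2 : ∑ p ∈ Finset.range N, (Function.update κ a 0 p : ℤ) * γ p ≤ N * ((m : ℤ) * m) := by
      calc _ ≤ ∑ p ∈ Finset.range N, (m : ℤ) * m := Finset.sum_le_sum fun p hp =>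
            (le_abs_self _).trans (hterm p (Finset.mem_range.1 hp))
        _ = _ := by simp
    have := hr.start
    constructor <;> omega
  have ev : (Expr.var 27 + .var 16).eval s3 = b := by
    simp only [Expr.eval_add, Expr.eval_var, hc3.start, h16, hb]
  refine Run.seq (Run.assign (by decide) (by simp) (by rw [ev]; exact hbW) ?_)
  rw [ev]
  have hc4 := hc3.setVar (i := 19) (z := b) (by decide)
  have p4 := p3.setVar (i := 19) (z := b) (by decide)
  have f48 : (s3.setVar 19 b).var 48 = κ a := by simp [d48]
  have f29 : (s3.setVar 19 b).var 29 = a := by simp [d29]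
  have f19 : (s3.setVar 19 b).var 19 = b := by simp
  set s4 := s3.setVar 19 b
  clear_value s4
  refine Run.seq_of (Run.minimize R hc4.card hr.card_le (by decide) (by decide) (by decide)
    (by decide) (by decide) (by decide) (by decide) (by decide)
    (fun i => (ρ i - b) % m % d = 0) (fun i => coord d e o ((ρ i - b) % m)) ?_ ?_) ?_
  · intro i hi
    have h1 := hgcd.coord_nonneg ((ρ i - b) % m)
    have h2 := hgcd.coord_lt ((ρ i - b) % m)
    have h3 := hgcd.o_le
    constructor <;> omega
  · intro i hi s' hF h47
    have e4 := (congrFun (hF.arr 4 rfl) i).trans (hc4.allowed i hi)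
    have e19 := (hF.var 19 rfl).trans f19
    have p5 := p4.of_frame hF rfl rfl rfl rfl rfl rfl rfl
    have := hr.allowed i hi
    have hW : Within H (ρ i) := by constructor <;> omega
    simp [h47, e4, e19, p5.modulus, p5.var_d, p5.var_e, p5.var_o, hW, coord]
  rintro s5 hF5 ⟨h1, h2, h3⟩
  rw [f48] at h1 h3
  have g29 := (hF5.var 29 rfl).trans f29
  have a13 := (hF5.arr 13 rfl)
  -- the given solution
  obtain ⟨x, ⟨μ, hμ, rfl⟩, i₀, hi₀, hx⟩ := hsol
  -- Tightness reduces the solutions below `κ` to a problem in the single unknown `μ a`.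
  have hμa : ∀ μ : ℕ → ℕ, (∀ p, p < N → μ p ≤ κ p) →
      (h₀ : ZMod m) + ∑ p ∈ Finset.range N, (μ p : ZMod m) * γ p ∈ target m R ρ →
      (h₀ : ZMod m) + ∑ p ∈ Finset.range N, (μ p : ZMod m) * γ p = b + μ a * γ a := by
    intro μ hμ hx
    rw [← hsum]
    congr 1
    refine Finset.sum_congr rfl fun p hp => ?_
    by_cases hpa : p = a
    · subst hpa; simp
    · rw [Function.update_of_ne hpa, htight p (Finset.mem_range.1 hp) hpa μ hμ hx]
  -- solutions are found
  have hfound : ∀ c i : ℕ, c ≤ κ a → i < R → (b : ZMod m) + c * γ a = ρ i →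
      (ρ i - b) % m % d = 0 ∧ coord d e o ((ρ i - b) % m) = c := by
    intro c i hca hi h
    obtain ⟨h4, h5⟩ := hgcd.coord_unique ((hsolve c (ρ i)).1 h)
    -- The multiplicity is below the order of `γ a`, so it is the coordinate itself and not only
    -- congruent to it.
    have h6 : (c : ℤ) % o = c := Int.emod_eq_of_lt (by omega) (by omega)
    exact ⟨h4, h5.trans h6⟩
  have hsol₀ : (b : ZMod m) + μ a * γ a = ρ i₀ := by rw [← hμa μ hμ ⟨i₀, hi₀, hx⟩]; exact hx
  obtain ⟨g1, g2⟩ := hfound (μ a) i₀ (hμ a ha) hi₀ hsol₀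
  have hle := h2 i₀ hi₀ g1
  simp only [g2] at hle
  obtain ⟨c, hcv⟩ : ∃ c : ℕ, s5.var 48 = c := by
    refine Int.eq_ofNat_of_zero_le ?_
    rcases h3 with h3 | ⟨j, hj, -, h3⟩
    · omega
    · rw [h3]; exact hgcd.coord_nonneg _
  rw [hcv] at h1 h2 h3 hle
  have hca : c ≤ κ a := by omega
  have hcsol : (b : ZMod m) + c * γ a ∈ target m R ρ := by
    -- If the minimum is still the initial value `κ a`, the known solution `μ`, which is among the
    -- candidates, must have `μ a = κ a`.
    rcases h3 with h3 | ⟨j, hj, h4, h3⟩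
    · have := hμ a ha
      obtain rfl : c = μ a := by omega
      exact ⟨i₀, hi₀, hsol₀⟩
    · refine ⟨j, hj, (hsolve c (ρ j)).2 ?_⟩
      have := hgcd.coord_eq ((ρ j - b) % m)
      rw [h4, ← h3] at this
      simpa using this
  have hW5 : Within H (s5.var 48) := by rw [hcv]; constructor <;> omega
  refine Run.write (by decide) (by decide) (by simp) (by simp) ?_
  simp only [Expr.eval_var, g29, hcv]
  refine ⟨Function.update κ a c, fun p _ => ?_, fun p hp => ?_, ?_, fun p hp => ?_⟩
  · by_cases hpa : p = a
    · subst hpa; simpa using hca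
    · simp [hpa]
  · by_cases hpa : p = a
    · subst hpa; simp
    · have := hc4.mult p hp
      simp only [Function.update_of_ne hpa] at this
      simp [hpa, a13, this]
  · rw [hsum]; exact hcsol
  · by_cases hpa : p = a
    · subst hpa
      intro μ hμ hS
      have hμκ : ∀ q, q < N → μ q ≤ κ q := fun q hq => (hμ q hq).trans (by
        by_cases hqp : q = p
        · subst hqp; simpa using hca
        · simp [hqp])
      have h5 := hμa μ hμκ hS
      obtain ⟨i, hi, h6⟩ := hS
      rw [h5] at h6
      obtain ⟨h7, h8⟩ := hfound (μ p) i (hμκ p ha) hi h6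
      have h9 := h2 i hi h7
      have h10 := hμ p ha
      simp only [h8] at h9
      rw [Function.update_self] at h10 ⊢
      omega
    · exact (htight p hp hpa).update hca hpa

theorem select_run (hc : Congruence m N R h₀ κ γ ρ s) (hr : InRange X m N R h₀ κ γ ρ)
    (hN : 0 < N) :
    Run H X select s fun s' => ∃ a : ℕ, s'.var 29 = a ∧ a < N ∧ ∀ p, p < N → κ p ≤ κ a := by
  refine Run.of_small fun h2H hsm => ?_
  have hmH : (m : ℤ) ≤ H := hc.modulus ▸ (hsm 2 (by decide)).2
  have hNH : (N : ℤ) ≤ H := hc.num ▸ (hsm 5 (by decide)).2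
  refine Run.seq (Run.assign (by decide) (by simp) (by simp [Within]) ?_)
  have hc1 := hc.setVar (i := 29) (z := 0) (by decide)
  refine Run.forLoop N hc1.num hr.num_le (by decide) (by decide) rfl rfl (by decide)
    (fun r s' => ∃ a : ℕ, s'.var 29 = a ∧ a < N ∧ ∀ p, p < r → κ p ≤ κ a)
    ⟨0, by simp, hN, by simp⟩ ?_ fun s' _ h => h
  rintro r hrN s2 hF2 h20 ⟨a, h1, h2, h3⟩
  have hc2 := hc1.of_frame hF2 rfl rfl rfl rfl rfl rfl rfl
  have := hr.mult_le r hrN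
  have := hr.mult_le a h2
  refine Run.ite (by decide) ?_ (fun h => ?_) fun h => Run.skip ?_
  · simp only [Test.ok_lt, Expr.ok_arr, Expr.ok_var, Expr.eval_var, h1, h20, hc2.mult a h2,
      hc2.mult r hrN]
    exact ⟨⟨by decide, by omega, by omega⟩, by decide, by omega, by omega⟩
  · simp only [Test.holds_lt, Expr.eval_arr, Expr.eval_var, h1, h20, hc2.mult a h2,
      hc2.mult r hrN, Nat.cast_lt] at h
    refine Run.assign (by decide) (by simp) ?_ ⟨r, ?_, hrN, fun p hp => ?_⟩
    · rw [Expr.eval_var, h20]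
      constructor <;> omega
    · simp [h20]
    · rcases Nat.lt_succ_iff_lt_or_eq.1 hp with h' | rfl
      · exact (h3 p h').trans h.le
      · rfl
  · simp only [Test.holds_lt, Expr.eval_arr, Expr.eval_var, h1, h20, hc2.mult a h2,
      hc2.mult r hrN, Nat.cast_lt, not_lt] at h
    refine ⟨a, by simp [h1], h2, fun p hp => ?_⟩
    rcases Nat.lt_succ_iff_lt_or_eq.1 hp with h' | rfl
    · exact h3 p h'
    · exact h

/-- The number of buckets is small because the intervals are long: `d * o = m ≤ N * l + R ≤ (N + R)
* l`. So both summands of `d * W = d * (o / l) + d` are at most `N + R`. -/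
theorem params_run [NeZero m] (hc : Congruence m N R h₀ κ γ ρ s) (hr : InRange X m N R h₀ κ γ ρ)
    (h29 : s.var 29 = a) (ha : a < N) (hord : ∃ d e o, IsGcd m (γ a) d e o ∧ (κ a : ℤ) < o)
    (hlarge : (m : ℤ) ≤ N * (κ a + 1) + R) (hH : (2 * (N + R) : ℕ) ≤ (H : ℤ)) :
    Run H X params s fun s' => ∃ d e o W : ℤ, ∃ Z : ℕ,
      TableParams m (γ a) d e o (κ a + 1) W Z s' ∧ Z ≤ 2 * (N + R) := by
  refine Run.of_small fun h2H hsm => ?_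
  have hmH : (m : ℤ) ≤ H := hc.modulus ▸ (hsm 2 (by decide)).2
  have hγa := hr.res a ha
  refine Run.seq (Run.assign (by decide) ?_ ?_ ?_)
  · simp only [Expr.ok_arr, Expr.ok_var, Expr.eval_var, h29, hc.res a ha]
    exact ⟨by decide, by omega, by omega⟩
  · simp only [Expr.eval_arr, Expr.eval_var, h29, hc.res a ha]
    constructor <;> omega
  simp only [Expr.eval_arr, Expr.eval_var, h29, hc.res a ha]
  have hc1 := hc.setVar (i := 19) (z := γ a) (by decide)
  refine Run.seq_of (euclid_run hc1.modulus (g := γ a) (by simp) hγa.1 hγa.2 hr.size_le) ?_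
  intro s2 hF2 hgcd
  have hc2 := hc1.of_frame hF2 rfl rfl rfl rfl rfl rfl rfl
  have b29 : s2.var 29 = a := by rw [hF2.var 29 rfl]; simp [h29]
  obtain ⟨d', e', o', hgcd', hκo⟩ := hord
  rw [hgcd'.order_unique hgcd] at hκo
  set d := s2.var 30 with hd
  set e := s2.var 31 with he
  set o := s2.var 32 with ho
  have hd0 := hgcd.d_pos
  have ho0 := hgcd.o_pos
  have hom := hgcd.o_le
  have hdm := hgcd.mul_eq
  set l : ℤ := κ a + 1 with hl
  have hl0 : 0 < l := by omega
  set W := o / l + 1 with hW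
  have hq0 : 0 ≤ o / l := Int.ediv_nonneg ho0.le hl0.le
  have hql : o / l * l ≤ o := Int.ediv_mul_le o hl0.ne'
  have hqo : o / l ≤ o := by nlinarith
  have hNl : N * l + R ≤ (N + R) * l := by
    have : (0 : ℤ) ≤ R := by positivity
    nlinarith
  -- From `l ≤ o`: `d * l ≤ d * o = m`.
  have h1 : d ≤ N + R := by
    have : d * l ≤ (N + R) * l := by nlinarith
    exact le_of_mul_le_mul_right this hl0
  have h2 : d * (o / l) ≤ N + R := by
    have : d * (o / l) * l ≤ (N + R) * l := by nlinarith
    exact le_of_mul_le_mul_right this hl0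
  have hZ0 : 0 ≤ d * W := by positivity
  have hZ : d * W ≤ 2 * (N + R) := by rw [hW, mul_add]; omega
  have hWZ : W ≤ d * W := by nlinarith
  have hWH : W ≤ H := by push_cast at hH; omega
  refine Run.seq (Run.assign (by decide) ?_ ?_ ?_)
  · simp only [Expr.ok_add, Expr.ok_arr, Expr.ok_var, Expr.ok_one, Expr.eval_var, b29, hc2.mult a ha]
    exact ⟨⟨by decide, by omega, by omega⟩, trivial⟩
  · simp only [Expr.eval_add, Expr.eval_one, Expr.eval_arr, Expr.eval_var, b29, hc2.mult a ha]
    constructor <;> omega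
  simp only [Expr.eval_add, Expr.eval_one, Expr.eval_arr, Expr.eval_var, b29, hc2.mult a ha, ← hl]
  have ev : (Expr.var 32 / .var 33 + 1).eval (s2.setVar 33 l) = W := by simp [← ho, hW]
  refine Run.seq (Run.assign (by decide) (by simp) (by rw [ev]; constructor <;> omega) ?_)
  rw [ev]
  have ev' : (Expr.var 30 * .var 34).eval ((s2.setVar 33 l).setVar 34 W) = d * W := by simp [← hd]
  push_cast at hH
  refine Run.assign (by decide) (by simp) (by rw [ev']; constructor <;> omega) ?_
  rw [ev']
  refine ⟨d, e, o, W, (d * W).toNat, ?_, by omega⟩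
  exact { gcd := hgcd, l_pos := hl0, l_le := by omega, width := hW, size := by simp [hZ0],
          modulus := by simpa using hc2.modulus
          var_d := by simp [hd], var_e := by simp [he], var_o := by simp [ho], var_l := by simp
          var_W := by simp, var_Z := by simp [hZ0] }

/-- Either the total multiplicity already is at most `m - R`, and minimality is not needed, or the
largest multiplicity is so large that the table stays small and a minimal solution can be computed.
-/
theorem reduce_run [NeZero m] (hc : Congruence m N R h₀ κ γ ρ s) (hr : InRange X m N R h₀ κ γ ρ)
    (hX : 2 * (N + R) ≤ X) (hord : ∀ p, p < N → ∃ d e o, IsGcd m (γ p) d e o ∧ (κ p : ℤ) < o)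
    (hmem : (h₀ : ZMod m) + ∑ p ∈ Finset.range N, (κ p : ZMod m) * γ p ∈ target m R ρ)
    (hρ : ∀ i, i < R → ∀ j, j < R → ρ i = ρ j → i = j)
    (hH : N * ((m : ℤ) * m) + m ≤ H) (hNRH : (2 * (N + R) : ℕ) ≤ (H : ℤ)) :
    Run H X reduce s fun s' => ∃ κ' : ℕ → ℕ, (∀ p, p < N → κ' p ≤ κ p) ∧
      (∀ p : ℕ, p < N → s'.arr 13 p = κ' p) ∧
      (h₀ : ZMod m) + ∑ p ∈ Finset.range N, (κ' p : ZMod m) * γ p ∈ target m R ρ ∧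
      ∑ p ∈ Finset.range N, κ' p + R ≤ m := by
  refine Run.of_small fun h2H hsm => ?_
  have hm : (0 : ℤ) < m := by exact_mod_cast Nat.pos_of_ne_zero (NeZero.ne m)
  have hmH : (m : ℤ) ≤ H := hc.modulus ▸ (hsm 2 (by decide)).2
  have hNm : N * (m : ℤ) ≤ H := by
    have : (0 : ℤ) ≤ N := by positivity
    nlinarith [mul_nonneg this (mul_nonneg hm.le (by omega : (0 : ℤ) ≤ m - 1))]
  refine Run.seq_of (Run.sum N hc.num hr.num_le (by decide) (by decide) (by decide) (by decide)
    (by decide) (by decide) (by decide) (fun p => (κ p : ℤ)) m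
    (fun j hj => by simpa using hr.mult_le j hj) hNm ?_) ?_
  · intro j hj s' hF h20
    have e13 := (congrFun (hF.arr 13 rfl) j).trans (hc.mult j hj)
    have := hr.mult_le j hj
    simp only [Expr.ok_arr, Expr.ok_var, Expr.eval_arr, Expr.eval_var, h20, e13, and_true]
    exact ⟨by decide, by omega, by omega⟩
  intro s1 hF1 h28
  have hc1 := hc.of_frame hF1 rfl rfl rfl rfl rfl rfl rfl
  refine Run.ite (by decide) (by simp) (fun h => Run.skip ?_) fun h => ?_
  · simp only [Test.holds_le, Expr.eval_sub, Expr.eval_var, h28, hc1.modulus, hc1.card] at h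
    refine ⟨κ, fun _ _ => le_rfl, hc1.mult, hmem, ?_⟩
    zify
    omega
  simp only [Test.holds_le, Expr.eval_sub, Expr.eval_var, h28, hc1.modulus, hc1.card, not_le] at h
  have hcard : ((Finset.range R).image fun i => (ρ i : ZMod m)).card = R := by
    rw [Finset.card_image_of_injOn, Finset.card_range]
    intro i hi j hj hij
    simp only [Finset.coe_range, Set.mem_Iio] at hi hj
    refine hρ i hi j hj ?_
    have h6 := hr.allowed i hi
    have h7 := hr.allowed j hj
    have h8 := (ZMod.intCast_eq_intCast_iff_dvd_sub _ _ _).1 hij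
    have h9 := Int.eq_zero_of_abs_lt_dvd h8 (by rw [abs_lt]; constructor <;> omega)
    omega
  -- Without vectors the sum is zero, and the test fails only if `m < R`, although the `R` allowed
  -- residues are distinct modulo `m`.
  have hN : 0 < N := by
    refine Nat.pos_of_ne_zero fun hN => ?_
    subst hN
    have := Finset.card_le_univ ((Finset.range R).image fun i => (ρ i : ZMod m))
    rw [hcard, ZMod.card] at this
    simp only [Finset.range_zero, Finset.sum_empty] at h
    omega
  refine Run.seq_of (select_run hc1 hr hN) ?_
  rintro s2 hF2 ⟨a, b29, ha, hmax⟩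
  have hc2 := hc1.of_frame hF2 rfl rfl rfl rfl rfl rfl rfl
  -- The sum of `N` multiplicities exceeds `m - R`, hence so does `N * κ a`.
  have hlarge : (m : ℤ) ≤ N * (κ a + 1) + R := by
    have : ∑ p ∈ Finset.range N, (κ p : ℤ) ≤ ∑ p ∈ Finset.range N, (κ a : ℤ) :=
      Finset.sum_le_sum fun p hp => by exact_mod_cast hmax p (Finset.mem_range.1 hp)
    simp only [Finset.sum_const, Finset.card_range, nsmul_eq_mul] at this
    rw [mul_add]
    omega
  refine Run.seq_of (params_run hc2 hr b29 ha (hord a ha) hlarge hNRH) ?_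
  rintro s3 hF3 ⟨d, e, o, W, Z, hp3, hZ⟩
  have hc3 := hc2.of_frame hF3 rfl rfl rfl rfl rfl rfl rfl
  have c29 := (hF3.var 29 rfl).trans b29
  have hsol : Solvable m N R h₀ κ γ ρ := ⟨_, ⟨κ, fun _ _ => le_rfl, rfl⟩, hmem⟩
  refine Run.seq_of (tightenAll_run hc3 hr hp3 (hZ.trans hX) c29 ha hsol) ?_
  rintro s4 hF4 ⟨κ', h1, h2, h3, h4, h5⟩
  refine (finish_run h3 (hr.mono h1) (by rw [h2]; exact hp3.of_frame hF4 rfl rfl rfl rfl rfl rfl rfl)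
    ((hF4.var 29 rfl).trans c29) ha h4 h5 hH).mono ?_
  rintro s5 _ ⟨κ'', g1, g2, g3, g4⟩
  refine ⟨κ'', fun p hp => (g1 p hp).trans (h1 p hp), g2, g3, ?_⟩
  have hiff : ∀ r : ZMod m, r ∈ (Finset.range R).image (fun i => (ρ i : ZMod m)) ↔
      r ∈ target m R ρ := fun r => by
    simp only [Finset.mem_image, Finset.mem_range, target, Set.mem_ofPred_eq]
    exact exists_congr fun i => and_congr_right fun _ => eq_comm
  have := sum_add_card_le_of_minimal N κ'' (fun p => (γ p : ZMod m)) h₀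
    ((Finset.range R).image fun i => (ρ i : ZMod m)) ((hiff _).2 g3)
    fun μ hμ hS p hp => g4 p hp μ hμ ((hiff _).1 hS)
  rwa [hcard] at this

end Proximity

/-! ### The whole program -/

theorem IsDecomposition.abs_le_one {k n : ℕ} {T : Matrix (Fin k) (Fin n) ℤ} {z : Fin n → ℤ} {N : ℕ}
    {lam : ℕ → ℤ} {u : ℕ → Fin n → ℤ} (hT : T.IsTotallyUnimodular)
    (h : IsDecomposition T z N lam u) {p : ℕ} (hp : p < N) (j : Fin n) : |u p j| ≤ 1 := by
  have := h.elementary p hp _ (tuAppendable_single hT j)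
  rwa [single_dotProduct, one_mul] at this

namespace Proximity

variable {H X k n m : ℕ} {s : Store}

def writeStart : Cmd :=
  .sum 27 9 1 (.arr 3 (.var 9) * .arr 5 (.var 9)) ;;
  .assign 27 (.var 27 % .var 2)

def writeOutput : Cmd :=
  .forLoop 9 1
    (.sum 16 20 5 (.arr 13 (.var 20) * cell 12 20 9) ;;
      .write 7 (.var 9) (.arr 5 (.var 9) + .var 16))

def compute : Cmd :=
  .assign 4 (.var 0 + .var 1) ;;
  .assign 6 ((.var 4 + 1) * (.var 4 + 1)) ;;
  decompose ;;
  residues ;;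
  writeStart ;;
  reduce ;;
  writeOutput

theorem writeStart_run (hm : 0 < m) (h1 : s.var 1 = n) (h2 : s.var 2 = m) (hn : n ≤ X)
    {γ x₀ : Fin n → ℤ} (hγ : ∀ j : Fin n, s.arr 3 (j : ℤ) = γ j)
    (hx : ∀ j : Fin n, s.arr 5 (j : ℤ) = x₀ j) {M : ℤ} (hM : M ≤ H) (hγM : ∀ j, |γ j| ≤ M)
    (hxM : ∀ j, |x₀ j| ≤ M) (hnM : n * (M * M) ≤ H) :
    Run H X writeStart s fun s' => s'.var 27 = dotProduct γ x₀ % m := by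
  refine Run.of_small fun h2H hsm => ?_
  have hmH : (m : ℤ) ≤ H := h2 ▸ (hsm 2 (by decide)).2
  have hW : ∀ z : ℤ, |z| ≤ M → Within H z := fun z hz => abs_le.1 (hz.trans hM)
  refine Run.seq_of (Run.sum n h1 hn (by decide) (by decide) (by decide) (by decide)
    (by decide) (by decide) (by decide) (fun j => if h : j < n then γ ⟨j, h⟩ * x₀ ⟨j, h⟩ else 0)
    (M * M) (fun j hj => ?_) hnM ?_) ?_
  · simp only [hj, dif_pos, abs_mul]
    exact mul_le_mul (hγM _) (hxM _) (abs_nonneg _) ((abs_nonneg _).trans (hγM ⟨j, hj⟩))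
  · intro j hj s' hF h9
    have e3 := (congrFun (hF.arr 3 rfl) j).trans (hγ ⟨j, hj⟩)
    have e5 := (congrFun (hF.arr 5 rfl) j).trans (hx ⟨j, hj⟩)
    simp [h9, e3, e5, hj, hW _ (hγM ⟨j, hj⟩), hW _ (hxM ⟨j, hj⟩)]
  intro s1 hF1 h27
  have hsum : s1.var 27 = dotProduct γ x₀ := by
    rw [h27, dotProduct, ← Fin.sum_univ_eq_sum_range
      (fun j => if h : j < n then γ ⟨j, h⟩ * x₀ ⟨j, h⟩ else 0)]
    simp
  have b2 := (hF1.var 2 rfl).trans h2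
  have ev : (Expr.var 27 % .var 2).eval s1 = dotProduct γ x₀ % m := by simp [hsum, b2]
  have q0 := Int.emod_nonneg (dotProduct γ x₀) (by omega : (m : ℤ) ≠ 0)
  have q1 := Int.emod_lt_of_pos (dotProduct γ x₀) (by omega : (0 : ℤ) < m)
  refine Run.assign (by decide) (by simp) (by rw [ev]; constructor <;> omega) ?_
  rw [ev]
  simp

theorem writeOutput_run (h1 : s.var 1 = n) (hn : n ≤ X) {N : ℕ} (h5 : s.var 5 = N) (hN : N ≤ X)
    {x₀ : Fin n → ℤ} (hx : ∀ j : Fin n, s.arr 5 (j : ℤ) = x₀ j) (hxH : ∀ j, |x₀ j| ≤ H)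
    {κ : ℕ → ℕ} (h13 : ∀ p : ℕ, p < N → s.arr 13 p = κ p) (hκ : ∀ p, p < N → κ p ≤ m)
    (hmH : (m : ℤ) ≤ H) (hNm : N * (m : ℤ) ≤ H)
    (hu : ∀ p, p < N → ∀ j, |mat n (s.arr 12) p j| ≤ 1) :
    Run H X writeOutput s fun s' =>
      RCCTU.output n s' = combine x₀ N (fun p => κ p) (mat n (s.arr 12)) := by
  refine Run.of_small fun h2H hsm => ?_
  refine Run.forLoop n h1 hn (by decide) (by decide) rfl rfl (by decide)
    (fun r s' => ∀ j : Fin n, (j : ℕ) < r →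
      s'.arr 7 (j : ℤ) = combine x₀ N (fun p => κ p) (mat n (s.arr 12)) j) (by simp) ?_
    fun s' _ h => funext fun j => h j j.2
  intro j hj s1 hF1 h9 hI
  have b1 := (hF1.var 1 rfl).trans h1
  have b5 := (hF1.var 5 rfl).trans h5
  have hterm : ∀ p, p < N → |(κ p : ℤ) * mat n (s.arr 12) p ⟨j, hj⟩| ≤ m := fun p hp => by
    rw [abs_mul, Nat.abs_cast]
    have h1 := hu p hp ⟨j, hj⟩
    have h2 : (κ p : ℤ) ≤ m := by exact_mod_cast hκ p hp
    have h3 : (0 : ℤ) ≤ κ p := by positivity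
    nlinarith
  refine Run.seq_of (Run.sum N b5 hN (by decide) (by decide) (by decide) (by decide)
    (by decide) (by decide) (by decide) (fun p => (κ p : ℤ) * mat n (s.arr 12) p ⟨j, hj⟩) m
    hterm hNm ?_) ?_
  · intro p hp s2 hF2 h20
    have e13 := (congrFun ((hF2.arr 13 rfl).trans (hF1.arr 13 rfl)) p).trans (h13 p hp)
    have e12 := (hF2.arr 12 rfl).trans (hF1.arr 12 rfl)
    have e9 := (hF2.var 9 rfl).trans h9
    have e1 := (hF2.var 1 rfl).trans b1
    have h1 := hu p hp ⟨j, hj⟩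
    have h2 := hκ p hp
    have hW1 : Within H (κ p) := by constructor <;> omega
    have hW2 : Within H (s.arr 12 (p * n + j)) := by
      have := abs_le.1 h1
      simp only [mat] at this
      constructor <;> omega
    simp [h20, e13, e12, e9, e1, hW1, hW2, mat]
  intro s2 hF2 h16
  have e5 := (congrFun ((hF2.arr 5 rfl).trans (hF1.arr 5 rfl)) j).trans (hx ⟨j, hj⟩)
  have e9 := (hF2.var 9 rfl).trans h9
  have e7 := hF2.arr 7 rfl
  have hWx : Within H (x₀ ⟨j, hj⟩) := abs_le.1 (hxH _)
  refine Run.write (by decide) (by decide) (by simp) (by simp [e9, e5, hWx]) ?_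
  intro j' hj'
  simp only [Expr.eval_var, Expr.eval_add, Expr.eval_arr, e9, e5, h16, Store.arr_setVar,
    Store.arr_setArr, if_true]
  split_ifs with h
  · obtain rfl : j' = ⟨j, hj⟩ := Fin.ext (by exact_mod_cast h)
    rfl
  · rw [e7]
    refine hI j' ?_
    have : (j' : ℕ) ≠ j := fun h' => h (by rw [h'])
    omega

/-- Bounds for the numbers and the loops in a run of the program. -/
structure Bounds (H X : ℕ) (P : RCCTU k n) (x₀ y : Fin n → ℤ) (M : ℕ) : Prop where
  size_le : 2 * P.m.size ≤ X
  loops : 2 * ((k + n + 1) * (k + n + 1) + P.R.card) ≤ X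
  γ : ∀ j, |P.γ j| ≤ M
  x₀ : ∀ j, |x₀ j| ≤ M
  y : ∀ j, |y j| ≤ M
  walk : 2 ^ ((k + n + 1) * (k + n + 1)) * (n * (2 * M)) ≤ H
  product : n * (M * M) ≤ H
  reduced : (k + n + 1) * (k + n + 1) * (P.m * P.m) + P.m ≤ H
  table : 2 * ((k + n + 1) * (k + n + 1) + P.R.card) ≤ H
  le : M ≤ H

variable {P : RCCTU k n} {x₀ y : Fin n → ℤ} {M : ℕ}

/-- All three conclusions hold for any combination with multiplicities between `0` and those of the
decomposition, a congruent residue and total at most `m - |R|`. Optimality of `x₀` enters only the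
proof about the cost, so one program serves both (i) and (ii). -/
theorem compute_run (hin : P.IsInput x₀ y s) (hB : Bounds H X P x₀ y M) (hx₀ : P.RelaxFeasible x₀)
    (hy : P.Feasible y) :
    Run H X compute s fun s' => P.Feasible (RCCTU.output n s') ∧
      P.Near x₀ (RCCTU.output n s') ∧
      (P.RelaxOptimal x₀ → dotProduct P.c (RCCTU.output n s') ≤ dotProduct P.c y) := by
  have : NeZero P.m := ⟨P.m_pos.ne'⟩
  refine Run.of_small fun h2H hsm => ?_
  obtain ⟨X1, X2, B1, B2, B3, H1, H2, H3, H4, H5⟩ := hB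
  set K := (k + n + 1) * (k + n + 1) with hK
  have hKn : k + n < K := by nlinarith
  have hMH : (M : ℤ) ≤ H := by exact_mod_cast H5
  have hmH : (P.m : ℤ) ≤ H := by exact_mod_cast (by omega : P.m ≤ H)
  have hnMH : (n : ℤ) * M ≤ H := by
    have : n * (2 * M) ≤ H := le_trans (Nat.le_mul_of_pos_left _ (by positivity)) H1
    have h' : n * M ≤ H := by nlinarith
    exact_mod_cast h'
  have ev4 : (Expr.var 0 + .var 1).eval s = ((k + n : ℕ) : ℤ) := by simp [hin.rows, hin.cols]
  refine Run.seq (Run.assign (by decide) (by simp) (by rw [ev4]; constructor <;> omega) ?_)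
  rw [ev4]
  have ev6 : ((Expr.var 4 + 1) * (.var 4 + 1)).eval (s.setVar 4 ((k + n : ℕ) : ℤ)) = (K : ℤ) := by
    simp [hK]
  refine Run.seq (Run.assign (by decide) (by simp) (by rw [ev6]; constructor <;> omega) ?_)
  rw [ev6]
  set s2 := (s.setVar 4 ((k + n : ℕ) : ℤ)).setVar 6 (K : ℤ) with hs2
  have d2 : Dims k n s2 := ⟨by simp [hs2, hin.rows], by simp [hs2, hin.cols], by simp [hs2]⟩
  have a2 : s2.arr = s.arr := by simp [hs2]
  refine Run.seq_of (decompose_run d2 (by simp [hs2, hK]) (by omega) P.isTotallyUnimodular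
    (by rw [a2]; exact hin.T) (by rw [a2]; exact hin.x₀) (by rw [a2]; exact hin.y)
    (M := M) (by positivity) hMH B2 B3 (by exact_mod_cast H1)) ?_
  rintro s3 hF3 ⟨N, h5, hNK, hdec, hlamH⟩
  have hN2K : 2 * (N + P.R.card) ≤ 2 * (K + P.R.card) := by omega
  have d3 := d2.of_frame hF3 rfl rfl rfl
  have c2 : s3.var 2 = P.m := by rw [hF3.var 2 rfl]; simp [hs2, hin.modulus]
  have c3 : s3.var 3 = P.R.card := by rw [hF3.var 3 rfl]; simp [hs2, hin.card]
  have A3 : s3.arr 3 = s.arr 3 := by rw [hF3.arr 3 rfl, a2]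
  have A4 : s3.arr 4 = s.arr 4 := by rw [hF3.arr 4 rfl, a2]
  have A5 : s3.arr 5 = s.arr 5 := by rw [hF3.arr 5 rfl, a2]
  set u := mat n (s3.arr 12) with hu
  have hu1 : ∀ p, p < N → ∀ j, |u p j| ≤ 1 := fun p hp j =>
    hdec.abs_le_one P.isTotallyUnimodular hp j
  refine Run.seq_of (residues_run P.m_pos d3.cols c2 h5 (by omega) (by omega) X1
    (by rw [A3]; exact hin.γ) hMH B1 hnMH hu1 fun p hp => ⟨hdec.nonneg p hp, hlamH p hp⟩) ?_
  intro s4 hF4 hred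
  have A3' := (hF4.arr 3 rfl).trans A3
  have A4' := (hF4.arr 4 rfl).trans A4
  have A5' := (hF4.arr 5 rfl).trans A5
  have c2' := (hF4.var 2 rfl).trans c2
  refine Run.seq_of (writeStart_run P.m_pos ((hF4.var 1 rfl).trans d3.cols) c2' (by omega)
    (by rw [A3']; exact hin.γ) (by rw [A5']; exact hin.x₀) hMH B1 B2 (by exact_mod_cast H2)) ?_
  intro s5 hF5 h27
  obtain ⟨κ, hκ⟩ : ∃ κ : ℕ → ℕ, ∀ p : ℕ, p < N → s4.arr 13 p = κ p :=
    ⟨fun p => (s4.arr 13 p).toNat, fun p hp => by have := (hred p hp).lam_nonneg; simp [this]⟩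
  set g : ℕ → ℤ := fun p => s4.arr 14 p with hg
  set ρ : ℕ → ℤ := fun i => s.arr 4 i with hρ
  set h₀ := dotProduct P.γ x₀ % P.m with hh₀
  have hm : (0 : ℤ) < P.m := by exact_mod_cast P.m_pos
  have hcong : Congruence P.m N P.R.card h₀ κ g ρ s5 :=
    { modulus := (hF5.var 2 rfl).trans c2'
      num := ((hF5.var 5 rfl).trans (hF4.var 5 rfl)).trans h5
      start := h27
      card := ((hF5.var 3 rfl).trans (hF4.var 3 rfl)).trans c3
      mult := by rw [hF5.arr 13 rfl]; exact hκ
      res := fun p _ => by rw [hF5.arr 14 rfl]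
      allowed := fun i _ => by rw [hF5.arr 4 rfl, A4'] }
  have hρmem : ∀ i, i < P.R.card → ∃ r ∈ P.R, ρ i = r := fun i hi => by
    have : ρ i ∈ P.R.image (fun r : ℕ => (r : ℤ)) := by
      rw [← hin.R]
      exact Finset.mem_image_of_mem _ (Finset.mem_range.2 hi)
    obtain ⟨r, hr, h⟩ := Finset.mem_image.1 this
    exact ⟨r, hr, h.symm⟩
  have htarget : ∀ z : ℤ, (z : ZMod P.m) ∈ target P.m P.R.card ρ ↔
      ∃ r ∈ P.R, z ≡ (r : ℤ) [ZMOD (P.m : ℤ)] := by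
    intro z
    simp only [target, Set.mem_ofPred_eq, ZMod.intCast_eq_intCast_iff]
    constructor
    · rintro ⟨i, hi, h⟩
      obtain ⟨r, hr, h'⟩ := hρmem i hi
      exact ⟨r, hr, h' ▸ h⟩
    · rintro ⟨r, hr, h⟩
      have : (r : ℤ) ∈ P.R.image (fun r : ℕ => (r : ℤ)) := Finset.mem_image_of_mem _ hr
      rw [← hin.R] at this
      obtain ⟨i, hi, h'⟩ := Finset.mem_image.1 this
      exact ⟨i, Finset.mem_range.1 hi, by rw [hρ]; simp only [h']; exact h⟩
  have hρinj : ∀ i, i < P.R.card → ∀ j, j < P.R.card → ρ i = ρ j → i = j := by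
    have hcard : ((Finset.range P.R.card).image (fun l : ℕ => s.arr 4 (l : ℤ))).card =
        (Finset.range P.R.card).card := by
      rw [hin.R, Finset.card_image_of_injective _ Nat.cast_injective, Finset.card_range]
    intro i hi j hj hij
    exact Finset.card_image_iff.1 hcard (by simpa using hi) (by simpa using hj) hij
  have hκm : ∀ p, p < N → κ p ≤ P.m := fun p hp => by
    obtain ⟨d, e, o, h, h'⟩ := (hred p hp).lt_order
    have := h.o_le
    rw [hκ p hp] at h'
    omega
  have hrange : InRange X P.m N P.R.card h₀ κ g ρ :=
    { size_le := X1
      num_le := by omega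
      card_le := by omega
      start := ⟨Int.emod_nonneg _ hm.ne', Int.emod_lt_of_pos _ hm⟩
      mult_le := hκm
      res := fun p hp => ⟨(hred p hp).nonneg, (hred p hp).lt⟩
      allowed := fun i hi => by
        obtain ⟨r, hr, h⟩ := hρmem i hi
        have := Finset.mem_range.1 (P.R_subset hr)
        rw [h]
        omega }
  -- the products with `γ`, as residues
  have hprod : ∀ μ : ℕ → ℕ, ((dotProduct P.γ (combine x₀ N (fun p => μ p) u) : ℤ) : ZMod P.m) =
      (h₀ : ZMod P.m) + ∑ p ∈ Finset.range N, (μ p : ZMod P.m) * g p := by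
    intro μ
    rw [dotProduct_combine, hh₀, ZMod.intCast_mod]
    push_cast
    congr 1
    refine Finset.sum_congr rfl fun p hp => ?_
    rw [(hred p (Finset.mem_range.1 hp)).eq]
  have hmem : (h₀ : ZMod P.m) + ∑ p ∈ Finset.range N, (κ p : ZMod P.m) * g p ∈
      target P.m P.R.card ρ := by
    have h1 : (h₀ : ZMod P.m) + ∑ p ∈ Finset.range N, (κ p : ZMod P.m) * g p =
        (dotProduct P.γ y : ℤ) := by
      rw [← hdec.combine_eq, dotProduct_combine, hh₀, ZMod.intCast_mod]
      push_cast
      congr 1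
      refine Finset.sum_congr rfl fun p hp => ?_
      have hp := Finset.mem_range.1 hp
      have h2 := (hred p hp).mul_eq
      rw [hκ p hp, (hred p hp).eq] at h2
      rw [hg]
      simp only [(hred p hp).eq]
      simpa using h2
    rw [h1]
    exact (htarget _).2 hy.2
  have hNm : N * ((P.m : ℤ) * P.m) + P.m ≤ H := by
    have : N * (P.m * P.m) + P.m ≤ H := by
      have : N * (P.m * P.m) ≤ K * (P.m * P.m) := Nat.mul_le_mul_right _ hNK
      omega
    exact_mod_cast this
  refine Run.seq_of (reduce_run hcong hrange (by omega)
    (fun p hp => by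
      obtain ⟨d, e, o, h, h'⟩ := (hred p hp).lt_order
      exact ⟨d, e, o, h, by rw [← hκ p hp]; exact h'⟩) hmem hρinj hNm
    (by exact_mod_cast hN2K.trans H4)) ?_
  rintro s6 hF6 ⟨κ', h1, h2, h3, h4⟩
  have A12 : s6.arr 12 = s3.arr 12 := by rw [hF6.arr 12 rfl, hF5.arr 12 rfl, hF4.arr 12 rfl]
  have A5'' : s6.arr 5 = s.arr 5 := by rw [hF6.arr 5 rfl, hF5.arr 5 rfl, A5']
  have e1 : s6.var 1 = n := by rw [hF6.var 1 rfl, hF5.var 1 rfl, hF4.var 1 rfl, d3.cols]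
  have e5 : s6.var 5 = N := by rw [hF6.var 5 rfl, hcong.num]
  have hNm' : N * (P.m : ℤ) ≤ H := by
    refine le_trans ?_ hNm
    have : (0 : ℤ) ≤ N := by positivity
    nlinarith [mul_nonneg this (mul_nonneg hm.le (by omega : (0 : ℤ) ≤ P.m - 1))]
  refine (writeOutput_run e1 (by omega) e5 (by omega) (by rw [A5'']; exact hin.x₀)
    (fun j => (B2 j).trans hMH) h2 (fun p hp => (h1 p hp).trans (hκm p hp)) hmH hNm'
    (by rw [A12]; exact hu1)).mono ?_
  intro s7 _ hout
  rw [hout, A12, ← hu]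
  have hμ : ∀ p, p < N → (0 : ℤ) ≤ κ' p ∧ (κ' p : ℤ) ≤ s3.arr 13 p := fun p hp => by
    have h5 := (hred p hp).lam_le
    have h6 := h1 p hp
    rw [hκ p hp] at h5
    omega
  refine ⟨⟨hdec.relaxFeasible hx₀ hy.1 hμ, ?_⟩, hdec.near (fun p hp => (hμ p hp).1) ?_,
    fun h => hdec.cost_le h hy.1 hμ⟩
  · rw [← htarget, hprod]
    exact h3
  · have : ((∑ p ∈ Finset.range N, κ' p + P.R.card : ℕ) : ℤ) ≤ P.m := by exact_mod_cast h4
    push_cast at this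
    linarith

end Proximity

/-! ### The running time -/

/-- The running time as a polynomial in the bound for the loops. -/
noncomputable def Cmd.timePoly : Cmd → Polynomial ℕ
  | skip => 1
  | assign _ e => .C (e.cost + 1)
  | write _ p e => .C (p.cost + e.cost + 1)
  | seq c d => c.timePoly + d.timePoly
  | ite g c d => .C g.cost + (c.timePoly + d.timePoly)
  | loop g c => .X * (.C g.cost + c.timePoly) + .C g.cost

theorem Cmd.eval_timePoly (X : ℕ) (c : Cmd) : c.timePoly.eval X = c.time X := by
  induction c <;> simp_all [timePoly, time]

namespace Proximity

/-- Sets the `j` variables from `4` on to `0`. -/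
def clear : ℕ → Cmd
  | 0 => .skip
  | j + 1 => clear j ;; .assign (4 + j) 0

theorem clear_exec {B : ℕ} (hB : 1 ≤ B) (X j : ℕ) (s : Store) :
    ∃ s', Exec B (clear j) s ((clear j).time X) s' ∧ s'.arr = s.arr ∧
      (∀ i, i < 4 → s'.var i = s.var i) ∧ ∀ i, 4 ≤ i → i < 4 + j → s'.var i = 0 := by
  induction j with
  | zero => exact ⟨s, .skip s, rfl, fun _ _ => rfl, fun i h1 h2 => by omega⟩
  | succ j ih =>
    obtain ⟨s', h1, h2, h3, h4⟩ := ih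
    refine ⟨_, .seq h1 (.assign (4 + j) 0 s' (by change bitLen 0 ≤ B; simpa [bitLen] using hB)),
      by simpa using h2, fun i hi => ?_, fun i hi hij => ?_⟩
    · simp [h3 i hi, show i ≠ 4 + j by omega]
    · by_cases hi' : i = 4 + j
      · simp [hi']
      · simp [hi', h4 i hi (by omega)]

/-- Beyond the input the initial store is arbitrary, whereas the program logic asks all of the first
64 variables to be small; hence the variables from 4 on are cleared first. -/
def solve : Cmd := clear 60 ;; compute

variable {k n : ℕ} {P : RCCTU k n} {x₀ y : Fin n → ℤ} {s : Store}

theorem isInput_congr {s' : Store} (h : P.IsInput x₀ y s) (ha : s'.arr = s.arr)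
    (hv : ∀ i, i < 4 → s'.var i = s.var i) : P.IsInput x₀ y s' where
  rows := (hv 0 (by decide)).trans h.rows
  cols := (hv 1 (by decide)).trans h.cols
  modulus := (hv 2 (by decide)).trans h.modulus
  card := (hv 3 (by decide)).trans h.card
  T := by rw [ha]; exact h.T
  b := by rw [ha]; exact h.b
  c := by rw [ha]; exact h.c
  γ := by rw [ha]; exact h.γ
  R := by rw [ha]; exact h.R
  x₀ := by rw [ha]; exact h.x₀
  y := by rw [ha]; exact h.y

theorem solve_exec {H X M : ℕ} (hin : P.IsInput x₀ y s) (hB : Bounds H X P x₀ y M)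
    (hH : 2 ≤ H) (hx₀ : P.RelaxFeasible x₀) (hy : P.Feasible y) :
    ∃ t s', Exec (64 * H.size + 2) solve s t s' ∧ t ≤ solve.time X ∧
      P.Feasible (RCCTU.output n s') ∧ P.Near x₀ (RCCTU.output n s') ∧
      (P.RelaxOptimal x₀ → dotProduct P.c (RCCTU.output n s') ≤ dotProduct P.c y) := by
  obtain ⟨s₁, h1, h2, h3, h4⟩ := clear_exec (B := 64 * H.size + 2) (by omega) X 60 s
  have hin₁ := isInput_congr hin h2 h3
  have hT := hB.table
  have hR := hB.reduced
  have hK : k + n < (k + n + 1) * (k + n + 1) := by nlinarith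
  have hok : s₁.VarsOk H := by
    refine ⟨hH, fun i hi => ?_⟩
    by_cases hi4 : 4 ≤ i
    · rw [h4 i hi4 hi]
      constructor <;> omega
    · interval_cases i
      · rw [hin₁.rows]; constructor <;> omega
      · rw [hin₁.cols]; constructor <;> omega
      · rw [hin₁.modulus]; constructor <;> omega
      · rw [hin₁.card]; constructor <;> omega
  obtain ⟨t, s', h5, h6, -, h7⟩ := compute_run hin₁ hB hx₀ hy hok
  exact ⟨_, s', .seq h1 h5, Nat.add_le_add_left h6 _, h7⟩

/-! ### Bounds in terms of the encoding length -/

theorem abs_le_two_pow_bitLen (z : ℤ) : |z| ≤ (2 ^ bitLen z : ℕ) := by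
  rw [Int.abs_eq_natAbs]
  have h1 : z.natAbs < 2 ^ z.natAbs.size := Nat.lt_size_self _
  have h2 : 2 ^ z.natAbs.size ≤ 2 ^ bitLen z :=
    Nat.pow_le_pow_right (by norm_num) (by unfold bitLen; omega)
  exact_mod_cast h1.le.trans h2

theorem one_le_bitLen (z : ℤ) : 1 ≤ bitLen z := by unfold bitLen; omega

theorem card_le_sum_bitLen {N : ℕ} (f : Fin N → ℤ) : N ≤ ∑ j, bitLen (f j) := by
  calc N = ∑ _j : Fin N, 1 := by simp
    _ ≤ _ := Finset.sum_le_sum fun j _ => one_le_bitLen _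

theorem bitLen_le_sum {N : ℕ} (f : Fin N → ℤ) (j : Fin N) : bitLen (f j) ≤ ∑ j, bitLen (f j) :=
  Finset.single_le_sum (f := fun j => bitLen (f j)) (fun _ _ => Nat.zero_le _) (Finset.mem_univ j)

/-- With `L` the encoding length, every input number is at most `2 ^ L`, and `k + n + 1 ≤ L`. The
term `L ^ 2` in the exponent comes from the doublings in the walk, `4 * L` from products of at most
four quantities bounded by `2 ^ L`, and the last `4` from constant factors. The bound for the loops
involves only the number of inputs and the length of `m`. -/
theorem bounds_of_inputBits (P : RCCTU k n) (x₀ y : Fin n → ℤ) :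
    Bounds (2 ^ (P.inputBits x₀ y ^ 2 + 4 * P.inputBits x₀ y + 4))
      (4 * (P.numInputs + bitLen P.m) ^ 2) P x₀ y (2 ^ P.inputBits x₀ y) := by
  set L := P.inputBits x₀ y with hL
  have hLdef := hL
  unfold RCCTU.inputBits at hLdef
  have l1 := one_le_bitLen k
  have l2 := one_le_bitLen n
  have lb := card_le_sum_bitLen P.b
  have lc := card_le_sum_bitLen P.c
  have hkn : k + n + 1 ≤ L := by omega
  have hK : (k + n + 1) * (k + n + 1) ≤ L ^ 2 := by rw [pow_two]; exact Nat.mul_le_mul hkn hkn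
  have habs : ∀ z : ℤ, bitLen z ≤ L → |z| ≤ (2 ^ L : ℕ) := fun z hz =>
    (abs_le_two_pow_bitLen z).trans (by exact_mod_cast Nat.pow_le_pow_right (by norm_num) hz)
  have hLL : L ≤ 2 ^ L := Nat.lt_two_pow_self.le
  have hm : P.m ≤ 2 ^ L := by
    have := habs P.m (by omega)
    rw [Nat.abs_cast] at this
    exact_mod_cast this
  have hR : P.R.card ≤ P.m := by simpa using Finset.card_le_card P.R_subset
  have hnL : n ≤ 2 ^ L := by omega
  have hK' : (k + n + 1) * (k + n + 1) ≤ 2 ^ L * 2 ^ L := by nlinarith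
  have p1 : 1 ≤ 2 ^ L := Nat.one_le_two_pow
  have hH : (2 : ℕ) ^ (L ^ 2 + 4 * L + 4) = 2 ^ L ^ 2 * (2 ^ L * 2 ^ L * (2 ^ L * 2 ^ L)) * 16 := by
    ring
  have p2 : 1 ≤ 2 ^ L ^ 2 := Nat.one_le_two_pow
  have hKpow : 2 ^ ((k + n + 1) * (k + n + 1)) ≤ 2 ^ L ^ 2 := Nat.pow_le_pow_right (by norm_num) hK
  rw [hH]
  set q := 2 ^ L with hq
  set Q := 2 ^ L ^ 2 with hQ
  set K := (k + n + 1) * (k + n + 1) with hKdef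
  clear_value q Q
  have q2 : q ≤ q * q := Nat.le_mul_of_pos_left _ p1
  have q4 : q * q ≤ q * q * (q * q) := Nat.le_mul_of_pos_left _ (by positivity)
  have q3 : q * (q * q) ≤ q * q * (q * q) := by nlinarith
  have Qq : q * q * (q * q) ≤ Q * (q * q * (q * q)) := Nat.le_mul_of_pos_left _ p2
  have hy : k + n + 1 ≤ P.numInputs + bitLen P.m := by unfold RCCTU.numInputs; omega
  have hRy : P.R.card ≤ P.numInputs + bitLen P.m := by unfold RCCTU.numInputs; omega
  have hsz : P.m.size ≤ P.numInputs + bitLen P.m := by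
    have : bitLen P.m = P.m.size + 1 := by simp [bitLen]
    omega
  set Y := P.numInputs + bitLen P.m
  have hYY : Y ≤ Y ^ 2 := Nat.le_self_pow (by norm_num) Y
  have hKY : K ≤ Y ^ 2 := by rw [pow_two]; exact Nat.mul_le_mul hy hy
  refine ⟨by omega, by omega, fun j => habs _ ?_, fun j => habs _ ?_, fun j => habs _ ?_, ?_, ?_, ?_,
    ?_, ?_⟩
  · have := bitLen_le_sum P.γ j; omega
  · have := bitLen_le_sum x₀ j; omega
  · have := bitLen_le_sum y j; omega
  · have h1 : 2 ^ K * (n * (2 * q)) ≤ Q * (q * (2 * q)) :=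
      Nat.mul_le_mul hKpow (Nat.mul_le_mul_right _ hnL)
    have h2 : Q * (q * q) ≤ Q * (q * q * (q * q)) := Nat.mul_le_mul_left _ q4
    nlinarith
  · have h1 : n * (q * q) ≤ q * (q * q) := Nat.mul_le_mul_right _ hnL
    omega
  · have h1 : K * (P.m * P.m) ≤ q * q * (q * q) := Nat.mul_le_mul hK' (Nat.mul_le_mul hm hm)
    change K * (P.m * P.m) + P.m ≤ _
    omega
  · omega
  · omega

noncomputable def timeBound : Polynomial ℕ := solve.timePoly.comp (4 * .X ^ 2)

/-- The bound `64 * H.size + 2` for `H = 2 ^ (L² + 4 * L + 4)`, whose size is one more than the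
exponent. -/
noncomputable def bitBound : Polynomial ℕ := 64 * (.X ^ 2 + 4 * .X + 5) + 2

/-- The program solves every instance, in strongly polynomial time. -/
theorem solve_spec (hin : P.IsInput x₀ y s) (hx₀ : P.RelaxFeasible x₀) (hy : P.Feasible y) :
    ∃ t s', Exec (bitBound.eval (P.inputBits x₀ y)) solve s t s' ∧
      t ≤ timeBound.eval (P.numInputs + bitLen P.m) ∧
      P.Feasible (RCCTU.output n s') ∧ P.Near x₀ (RCCTU.output n s') ∧
      (P.RelaxOptimal x₀ → dotProduct P.c (RCCTU.output n s') ≤ dotProduct P.c y) := by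
  have h := solve_exec hin (bounds_of_inputBits P x₀ y)
    (le_trans (by norm_num) (Nat.pow_le_pow_right (by norm_num) (Nat.le_add_left 4 _))) hx₀ hy
  rw [Nat.size_pow] at h
  simp only [timeBound, bitBound, Polynomial.eval_comp, Cmd.eval_timePoly, Polynomial.eval_add, Polynomial.eval_mul,
    Polynomial.eval_pow, Polynomial.eval_X, Polynomial.eval_ofNat]
  exact h

end Proximity

/-! ### Existence -/

namespace RCCTU

variable {k n : ℕ}

/-- A store that holds a given input. -/
noncomputable def inputStore (P : RCCTU k n) (x₀ y : Fin n → ℤ) : Store where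
  var i := if i = 0 then k else if i = 1 then n else if i = 2 then P.m else P.R.card
  arr a z :=
    let v (x : Fin n → ℤ) : ℤ := if h : z.toNat < n then x ⟨z.toNat, h⟩ else 0
    if a = 0 then
      if h : z.toNat / n < k ∧ z.toNat % n < n then P.T ⟨_, h.1⟩ ⟨_, h.2⟩ else 0
    else if a = 1 then if h : z.toNat < k then P.b ⟨z.toNat, h⟩ else 0
    else if a = 2 then v P.c
    else if a = 3 then v P.γ
    else if a = 4 then if h : z.toNat < P.R.card then (P.R.equivFin.symm ⟨z.toNat, h⟩ : ℕ) else 0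
    else if a = 5 then v x₀
    else v y

theorem isInput_inputStore (P : RCCTU k n) (x₀ y : Fin n → ℤ) :
    P.IsInput x₀ y (P.inputStore x₀ y) where
  rows := by simp [inputStore]
  cols := by simp [inputStore]
  modulus := by simp [inputStore]
  card := by simp [inputStore]
  T i j := by
    have hn : 0 < n := by have := j.2; omega
    have hz : ((i : ℤ) * n + j).toNat = j + i * n := by
      rw [add_comm]
      exact_mod_cast Int.toNat_natCast ((j : ℕ) + i * n)
    have h1 : ((j : ℕ) + i * n) / n = i := by
      rw [Nat.add_mul_div_right _ _ hn, Nat.div_eq_of_lt j.2, zero_add]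
    have h2 : ((j : ℕ) + i * n) % n = j := by
      rw [Nat.add_mul_mod_self_right, Nat.mod_eq_of_lt j.2]
    simp [inputStore, hz, h1, h2]
  b i := by simp [inputStore]
  c j := by simp [inputStore]
  γ j := by simp [inputStore]
  R := by
    ext z
    simp only [Finset.mem_image, Finset.mem_range]
    constructor
    · rintro ⟨l, hl, rfl⟩
      exact ⟨P.R.equivFin.symm ⟨l, hl⟩, Subtype.property _, by simp [inputStore, hl]⟩
    · rintro ⟨r, hr, rfl⟩
      exact ⟨P.R.equivFin ⟨r, hr⟩, Fin.is_lt _, by simp [inputStore]⟩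
  x₀ j := by simp [inputStore]
  y j := by simp [inputStore]

/-- Correctness of the program, applied to some store that holds the input, supplies the vector. -/
theorem exists_near {P : RCCTU k n} {x₀ y : Fin n → ℤ} (hx₀ : P.RelaxFeasible x₀)
    (hy : P.Feasible y) : ∃ x, P.Feasible x ∧ P.Near x₀ x ∧
      (P.RelaxOptimal x₀ → dotProduct P.c x ≤ dotProduct P.c y) :=
  let ⟨_, _, _, _, h⟩ := Proximity.solve_spec (P.isInput_inputStore x₀ y) hx₀ hy
  ⟨_, h⟩

theorem finite_near (P : RCCTU k n) (x₀ : Fin n → ℤ) : {x | P.Near x₀ x}.Finite := by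
  refine Set.Finite.subset
    (isCompact_closedBall x₀ ((P.m : ℝ) - (P.R.card : ℝ))).finite_of_discrete fun x hx => ?_
  rw [Metric.mem_closedBall, dist_eq_norm]
  exact hx.1

/-- That the minimum is attained is not known beforehand. Among the finitely many feasible points
near `x₀` one is cheapest, and it is optimal because every feasible `z` has a near feasible point
that costs no more than `z`. -/
theorem exists_optimal_near {P : RCCTU k n} {x₀ y : Fin n → ℤ} (hx₀ : P.RelaxOptimal x₀)
    (hy : P.Feasible y) : ∃ x, P.Optimal x ∧ P.Near x₀ x := by
  obtain ⟨x₁, h1, h2, -⟩ := exists_near hx₀.1 hy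
  obtain ⟨x, ⟨h3, h4⟩, h5⟩ := Set.exists_min_image {x | P.Near x₀ x ∧ P.Feasible x}
    (dotProduct P.c) ((P.finite_near x₀).subset fun x hx => hx.1) ⟨x₁, h2, h1⟩
  refine ⟨x, ⟨h4, fun z hz => ?_⟩, h3⟩
  obtain ⟨x₂, h6, h7, h8⟩ := exists_near hx₀.1 hz
  exact (h5 x₂ ⟨h7, h6⟩).trans (h8 hx₀)

end RCCTU

theorem theorem5 :
    (∀ (k n : ℕ) (P : RCCTU k n), (∃ y, P.Feasible y) →
      (∀ x₀, P.RelaxFeasible x₀ → ∃ x, P.Feasible x ∧ P.Near x₀ x) ∧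
      (∀ x₀, P.RelaxOptimal x₀ → ∃ x, P.Optimal x ∧ P.Near x₀ x)) ∧
    RCCTU.StronglyPolynomial
      (fun P x₀ y => P.RelaxFeasible x₀ ∧ P.Feasible y)
      (fun P x₀ x => P.Feasible x ∧ P.Near x₀ x) ∧
    RCCTU.StronglyPolynomial
      (fun P x₀ y => P.RelaxOptimal x₀ ∧ P.Optimal y)
      (fun P x₀ x => P.Optimal x ∧ P.Near x₀ x) := by
  refine ⟨fun k n P ⟨y, hy⟩ => ⟨fun x₀ hx₀ => ?_, fun x₀ hx₀ => RCCTU.exists_optimal_near hx₀ hy⟩,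
    ⟨Proximity.solve, Proximity.timeBound, Proximity.bitBound, fun k n P x₀ y h s hs => ?_⟩,
    ⟨Proximity.solve, Proximity.timeBound, Proximity.bitBound, fun k n P x₀ y h s hs => ?_⟩⟩
  · obtain ⟨x, h1, h2, -⟩ := RCCTU.exists_near hx₀ hy
    exact ⟨x, h1, h2⟩
  · obtain ⟨t, s', h1, h2, h3, h4, -⟩ := Proximity.solve_spec hs h.1 h.2
    exact ⟨t, s', h1, h2, h3, h4⟩
  · obtain ⟨t, s', h1, h2, h3, h4, h5⟩ := Proximity.solve_spec hs h.1.1 h.2.1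
    exact ⟨t, s', h1, h2, ⟨h3, fun z hz => (h5 h.1).trans (h.2.2 z hz)⟩, h4⟩
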